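/- **Grids.** Let $I=[a,b]$ with $a<b$, and let $B\ge 1$ and $M>1$ ($M$ an integer). A $(B,M)$ grid $\mathcal G_\Omega$ of $I$ consists of a function $\Omega:\mathbb N\to\mathbb N$ and, for every level $n\ge 1$, nondegenerate closed grid intervals $I^n_1,\dots,I^n_{\Omega(n)}$ such that for every $n\ge1$: the union of the intervals of level $n$ is $I$, and their interiors are pairwise disjoint; for $1\le\beta<\Omega(n)$ the intersection $I^n_\beta\cap I^n_{\beta+1}$ is only a common endpoint, and $B^{-1}\le |I^n_{\beta+1}|/|I^n_\beta|\le B$; every endpoint of an interval of level $n$ is an endpoint of an interval of level $n+1$; every interval of level $n$ contains at least two and at most $M$ intervals of level $n+1$. **Distortions.** For a homeomorphism $h:I\to J$ between compact intervals, put $$lrd(n,\beta)=\log\left(\frac{|I^n_\beta|}{|I^n_{\beta+1}|}\,\frac{|h(I^n_{\beta+1})|}{|h(I^n_\beta)|}\right)\quad(1\le\beta\le\Omega(n)-1),$$ $$crd(n,\beta)=cr\big(h(I^n_\beta),h(I^n_{\beta+1}),h(I^n_{\beta+2})\big)-cr\big(I^n_\beta,I^n_{\beta+1},I^n_{\beta+2}\big)\quad(1\le\beta\le\Omega(n)-2),$$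 where $cr(P,Q,S)=\log\left(1+\frac{|Q|}{|P|}\,\frac{|P|+|Q|+|S|}{|S|}\right)$. A *modulus* is a continuous function $\epsilon:[0,\infty)\to[0,\infty)$ with $\epsilon(0)=0$. A quantity $D(n,\beta)$ is ${\rm O}(\varphi(|I^n_\beta|))$ if there is a constant $c\ge1$ with $|D(n,\beta)|\le c\,|\varphi(|I^n_\beta|)|$; it is ${\rm o}(|I^n_\beta|)$ if there is a modulus $\epsilon$ with $|D(n,\beta)|\le\epsilon(|I^n_\beta|)\,|I^n_\beta|$; and it is ${\rm o}(|I^n_\beta|)|I^n_\beta|^{-1}$ if there is a modulus $\epsilon$ with $|D(n,\beta)|\le\epsilon(|I^n_\beta|)\,|I^n_\beta|\,|I^n_\beta|^{-1}$; in each case for all $n\ge1$ and all $\beta$ for which $D(n,\beta)$ is defined. **Smoothness.** Let $S$ be a compact interval with nonempty interior, contained in $I$. For $x-\delta_1,x,x+\delta_2\in S$ with $\delta_1,\delta_2>0$ put $$R=\left|\log\left(\frac{h(x+\delta_2)-h(x)}{h(x)-h(x-\delta_1)}\,\frac{\delta_1}{\delta_2}\right)\right|.$$ On $S$, the map $h$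 is: *quasisymmetric* if for every $d\ge1$ there is $k\ge1$ such that $R\le\log k$ whenever $d^{-1}\le\delta_2/\delta_1\le d$; *(uaa)* (uniformly asymptotically affine) if for every $d\ge1$ there is a modulus $\epsilon$ such that $R\le\epsilon(\delta_1+\delta_2)$ whenever $d^{-1}<\delta_2/\delta_1<d$; $C^{1+r}$ ($0<r\le1$) if it is differentiable and its derivative $dh$ satisfies $|dh(y)-dh(x)|\le C|y-x|^r$ for some $C\ge0$ and all $x,y\in S$; $C^{2+r}$ ($0<r\le1$) if it is twice differentiable and its second derivative satisfies such a bound; *affine* if $h(x)=mx+c$ on $S$ for some $m,c\in\mathbb R$. $C^{1+Lipschitz}$ and $C^{2+Lipschitz}$ mean $C^{1+r}$ and $C^{2+r}$ with $r=1$. Derivatives at endpoints are one-sided. **Theorem 1.3.** Let $h:I\to J$ be a homeomorphism between two compact intervals of the real line, where $I=[a,b]$ with $a<b$, and let $\mathcal G_\Omega$ be a $(B,M)$ grid of $I$. (i) *(Table 2.)* For every $0<\alpha<1$: * $h$ is quasisymmetric on $I$ if and only if $lrd(n,\beta)={\rm O}(1)$; * $h$ is (uaa) on $I$ if and only if $lrd(n,\beta)={\rm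 o}(|I^n_\beta|)|I^n_\beta|^{-1}$; * $h$ is $C^{1+\alpha}$ on $I$ and $dh(x)\ne0$ for all $x\in I$ if and only if $lrd(n,\beta)={\rm O}(|I^n_\beta|^\alpha)$; * $h$ is $C^{1+Lipschitz}$ on $I$ and $dh(x)\ne0$ for all $x\in I$ if and only if $lrd(n,\beta)={\rm O}(|I^n_\beta|)$; * $h$ is affine on $I$ and $dh(x)\ne0$ for all $x\in I$ if and only if $lrd(n,\beta)={\rm o}(|I^n_\beta|)$. (ii) *(Table 3.)* Consider the following lines, where $0<\alpha<1$: * quasisymmetric: $crd(n,\beta)={\rm O}(1)$; * (uaa): $crd(n,\beta)={\rm o}(|I^n_\beta|)|I^n_\beta|^{-1}$; * $C^{1+\alpha}$: $crd(n,\beta)={\rm O}(|I^n_\beta|^\alpha)$; * $C^{2+\alpha}$: $crd(n,\beta)={\rm O}(|I^n_\beta|^{1+\alpha})$; * $C^{2+Lipschitz}$: $crd(n,\beta)={\rm O}(|I^n_\beta|^2)$. If $h$ has the smoothness of a line on $I$ and, in the last three lines, $dh(x)\ne0$ for all $x\in I$, then $crd$ satisfies the bound of that line; the third line holds in this direction also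 for $\alpha=1$. Conversely, if $crd$ satisfies the bound of a line, then for every closed interval $K=[u,v]$ with $a<u<v<b$ the restriction $h|K$ has the smoothness of that line on $K$, and, in the last three lines, $h$ is differentiable with $dh(x)\ne0$ at every $x\in I$. -/

import Mathlib

open Set

noncomputable section

namespace GridSmoothness

/-- A `(B, M)` grid of the compact interval `[a, b]`.  At every level `n ≥ 1` there are `Ω n` grid
intervals `I n β = [left n β, right n β]`, `β = 1, …, Ω n`.  The values of `Ω`, `left` and `right`
at other indices carry no information. -/
structure Grid (B : ℝ) (M : ℕ) (a b : ℝ) where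
  Ω : ℕ → ℕ
  left : ℕ → ℕ → ℝ
  right : ℕ → ℕ → ℝ
  /-- the grid intervals are (nondegenerate) closed intervals -/
  left_lt_right : ∀ n β, 1 ≤ n → 1 ≤ β → β ≤ Ω n → left n β < right n β
  /-- the intervals of a level fill `[a, b]` -/
  cover : ∀ n, 1 ≤ n → (⋃ β ∈ Icc 1 (Ω n), Icc (left n β) (right n β)) = Icc a b
  /-- the intervals of a level have disjoint interiors -/
  disjoint : ∀ n β β', 1 ≤ n → 1 ≤ β → β ≤ Ω n → 1 ≤ β' → β' ≤ Ω n → β ≠ β' →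
    Disjoint (Ioo (left n β) (right n β)) (Ioo (left n β') (right n β'))
  /-- consecutive intervals meet in a common endpoint only; for nondegenerate closed
  intervals this says that the right endpoint of one is the left endpoint of the other -/
  adjacent : ∀ n β, 1 ≤ n → 1 ≤ β → β + 1 ≤ Ω n →
    right n β = left n (β + 1) ∨ right n (β + 1) = left n β
  /-- the endpoints of level `n` are endpoints of level `n + 1` -/
  endpoints : ∀ n, 1 ≤ n →
    {x | ∃ β, 1 ≤ β ∧ β ≤ Ω n ∧ (x = left n β ∨ x = right n β)} ⊆
      {x | ∃ β, 1 ≤ β ∧ β ≤ Ω (n + 1) ∧ (x = left (n + 1) β ∨ x = right (n + 1) β)}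
  /-- consecutive intervals have comparable lengths -/
  ratio : ∀ n β, 1 ≤ n → 1 ≤ β → β + 1 ≤ Ω n →
    B⁻¹ ≤ (right n (β + 1) - left n (β + 1)) / (right n β - left n β) ∧
      (right n (β + 1) - left n (β + 1)) / (right n β - left n β) ≤ B
  /-- an interval of level `n` contains at least two and at most `M` intervals of
  level `n + 1` -/
  children : ∀ n α, 1 ≤ n → 1 ≤ α → α ≤ Ω n →
    2 ≤ {β | 1 ≤ β ∧ β ≤ Ω (n + 1) ∧
        Icc (left (n + 1) β) (right (n + 1) β) ⊆ Icc (left n α) (right n α)}.ncard ∧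
      {β | 1 ≤ β ∧ β ≤ Ω (n + 1) ∧
        Icc (left (n + 1) β) (right (n + 1) β) ⊆ Icc (left n α) (right n α)}.ncard ≤ M

variable {B : ℝ} {M : ℕ} {a b : ℝ}

/-- The length `|I n β|` of a grid interval. -/
def Grid.len (G : Grid B M a b) (n β : ℕ) : ℝ := G.right n β - G.left n β

/-- The length `|h (I n β)|`: a homeomorphism maps `[x, y]` onto the closed interval with
endpoints `h x` and `h y`, in one order or the other. -/
def Grid.imageLen (G : Grid B M a b) (h : ℝ → ℝ) (n β : ℕ) : ℝ :=
  |h (G.right n β) - h (G.left n β)|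

/-- The logarithmic ratio distortion `lrd (I n β, I n (β + 1))`. -/
def Grid.lrd (G : Grid B M a b) (h : ℝ → ℝ) (n β : ℕ) : ℝ :=
  Real.log (G.len n β / G.len n (β + 1) * (G.imageLen h n (β + 1) / G.imageLen h n β))

/-- The (logarithmic) cross ratio of three consecutive adjacent intervals of
lengths `p`, `q`, `s`. -/
def crossRatio (p q s : ℝ) : ℝ := Real.log (1 + q / p * ((p + q + s) / s))

/-- The cross ratio distortion `crd (I n β, I n (β + 1), I n (β + 2))`. -/
def Grid.crd (G : Grid B M a b) (h : ℝ → ℝ) (n β : ℕ) : ℝ :=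
  crossRatio (G.imageLen h n β) (G.imageLen h n (β + 1)) (G.imageLen h n (β + 2)) -
    crossRatio (G.len n β) (G.len n (β + 1)) (G.len n (β + 2))

/-- Continuous functions `ε : [0, ∞) → [0, ∞)` with `ε 0 = 0`. -/
def IsModulus (ε : ℝ → ℝ) : Prop :=
  ContinuousOn ε (Ici 0) ∧ (∀ t, 0 ≤ t → 0 ≤ ε t) ∧ ε 0 = 0

/-- `lrd (I n β, I n (β + 1))` is `O (φ |I n β|)`, over all pairs of consecutive intervals. -/
def Grid.LrdBigO (G : Grid B M a b) (h : ℝ → ℝ) (φ : ℝ → ℝ) : Prop :=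
  ∃ C : ℝ, 1 ≤ C ∧ ∀ n β, 1 ≤ n → 1 ≤ β → β + 1 ≤ G.Ω n →
    |G.lrd h n β| ≤ C * |φ (G.len n β)|

/-- `lrd (I n β, I n (β + 1))` is `o (|I n β|)`, over all pairs of consecutive intervals. -/
def Grid.LrdLittleO (G : Grid B M a b) (h : ℝ → ℝ) : Prop :=
  ∃ ε : ℝ → ℝ, IsModulus ε ∧ ∀ n β, 1 ≤ n → 1 ≤ β → β + 1 ≤ G.Ω n →
    |G.lrd h n β| ≤ ε (G.len n β) * G.len n β

/-- `lrd (I n β, I n (β + 1))` is `o (|I n β|) |I n β|⁻¹`, over all pairs of consecutive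
intervals. -/
def Grid.LrdLittleODiv (G : Grid B M a b) (h : ℝ → ℝ) : Prop :=
  ∃ ε : ℝ → ℝ, IsModulus ε ∧ ∀ n β, 1 ≤ n → 1 ≤ β → β + 1 ≤ G.Ω n →
    |G.lrd h n β| ≤ ε (G.len n β) * G.len n β * (G.len n β)⁻¹

/-- `crd (I n β, I n (β + 1), I n (β + 2))` is `O (φ |I n β|)`, over all triples of consecutive
intervals. -/
def Grid.CrdBigO (G : Grid B M a b) (h : ℝ → ℝ) (φ : ℝ → ℝ) : Prop :=
  ∃ C : ℝ, 1 ≤ C ∧ ∀ n β, 1 ≤ n → 1 ≤ β → β + 2 ≤ G.Ω n →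
    |G.crd h n β| ≤ C * |φ (G.len n β)|

/-- `crd (I n β, I n (β + 1), I n (β + 2))` is `o (|I n β|) |I n β|⁻¹`, over all triples of
consecutive intervals. -/
def Grid.CrdLittleODiv (G : Grid B M a b) (h : ℝ → ℝ) : Prop :=
  ∃ ε : ℝ → ℝ, IsModulus ε ∧ ∀ n β, 1 ≤ n → 1 ≤ β → β + 2 ≤ G.Ω n →
    |G.crd h n β| ≤ ε (G.len n β) * G.len n β * (G.len n β)⁻¹

/-- `h` is quasisymmetric on `S`: for every `d ≥ 1` there is `k ≥ 1` such that the
`(d, k)` quasisymmetric condition holds. -/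
def QuasisymmetricOn (h : ℝ → ℝ) (S : Set ℝ) : Prop :=
  ∀ d : ℝ, 1 ≤ d → ∃ k : ℝ, 1 ≤ k ∧ ∀ x δ₁ δ₂ : ℝ, 0 < δ₁ → 0 < δ₂ →
    x - δ₁ ∈ S → x ∈ S → x + δ₂ ∈ S → d⁻¹ ≤ δ₂ / δ₁ → δ₂ / δ₁ ≤ d →
      |Real.log ((h (x + δ₂) - h x) / (h x - h (x - δ₁)) * (δ₁ / δ₂))| ≤ Real.log k

/-- `h` is uniformly asymptotically affine on `S`: for every `d ≥ 1` there is a modulus `ε` such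
that the `(d, ε)` uniformly asymptotically affine condition holds. -/
def UaaOn (h : ℝ → ℝ) (S : Set ℝ) : Prop :=
  ∀ d : ℝ, 1 ≤ d → ∃ ε : ℝ → ℝ, IsModulus ε ∧ ∀ x δ₁ δ₂ : ℝ, 0 < δ₁ → 0 < δ₂ →
    x - δ₁ ∈ S → x ∈ S → x + δ₂ ∈ S → d⁻¹ < δ₂ / δ₁ → δ₂ / δ₁ < d →
      |Real.log ((h (x + δ₂) - h x) / (h x - h (x - δ₁)) * (δ₁ / δ₂))| ≤ ε (δ₁ + δ₂)

/-- `g` is `r`-Hölder continuous on `S` (Lipschitz for `r = 1`). -/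
def HolderContOn (r : ℝ) (g : ℝ → ℝ) (S : Set ℝ) : Prop :=
  ∃ C : ℝ, 0 ≤ C ∧ ∀ x ∈ S, ∀ y ∈ S, |g y - g x| ≤ C * |y - x| ^ r

/-- `h` is `C^{1+r}` on `S`: differentiable with `r`-Hölder derivative.
The case `r = 1` is `C^{1+Lipschitz}`. -/
def C1HolderOn (r : ℝ) (h : ℝ → ℝ) (S : Set ℝ) : Prop :=
  DifferentiableOn ℝ h S ∧ HolderContOn r (derivWithin h S) S

/-- `h` is `C^{2+r}` on `S`: twice differentiable with `r`-Hölder second derivative.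
The case `r = 1` is `C^{2+Lipschitz}`. -/
def C2HolderOn (r : ℝ) (h : ℝ → ℝ) (S : Set ℝ) : Prop :=
  DifferentiableOn ℝ h S ∧ DifferentiableOn ℝ (derivWithin h S) S ∧
    HolderContOn r (derivWithin (derivWithin h S) S) S

/-- `h` is affine on `S`. -/
def AffineOn (h : ℝ → ℝ) (S : Set ℝ) : Prop :=
  ∃ m c : ℝ, ∀ x ∈ S, h x = m * x + c

/-- `dh(x) ≠ 0` for all `x ∈ S`.  As `derivWithin` is `0` where there is no derivative, this
includes the existence of the derivative (one-sided at the endpoints of an interval). -/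
def DerivNeZeroOn (h : ℝ → ℝ) (S : Set ℝ) : Prop :=
  ∀ x ∈ S, derivWithin h S x ≠ 0

end GridSmoothness

end

noncomputable section

/-! ### Listing the points of a grid from left to right. -/

namespace GridSmoothness

/-! After replacing `h` by `-h` if necessary, `h` is increasing, and everything can be written with
logarithms of average slopes (`logSlope`): `lrd` is, up to sign, the difference `r` of the log
slopes of two neighbours, and `crd` is an alternating sum `cd` of four log slopes.

Ratio distortions. Any interval is covered by boundedly many grid intervals of one level that are
short relative to it (`exists_fine_cover`), so the log slopes of two adjacent comparable intervals
differ by boundedly many `r` plus a small covering error. This gives the quasisymmetric and (uaa)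
lines. If `r` is `O` of a power of the length, the log slopes along nested intervals converge
geometrically to a Hölder function, the logarithm of the derivative (`exists_holder_limit`,
`exists_log_deriv`). If `r` is `o` of the length, the sum of all `|r|` of one level tends to `0` and
`h` is affine. The converses use the mean value theorem or are immediate.

From smoothness to cross ratios. `cd` is bounded by two neighbouring `r` (`abs_cd_le`); for second
order smoothness a Taylor expansion of the log slopes cancels in `cd` up to the required order.

From cross ratios to smoothness. A Möbius map preserves cross ratios, and for it the exponential of
a ratio distortion minus `1` is exactly proportional to the length of the two intervals while one
outer endpoint is kept fixed. For small cross ratio distortion this persists with an error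
(`exp_ratio_extend_right`, `exists_two_step`). Hence `exp |r| - 1` contracts from a pair of
intervals to a pair of descendants by the quotient of the lengths, up to a multiple of the cross
ratio distortion (`exists_pair_contraction`). To start the iteration `r` must be bounded: triples
give one-sided bounds that fail only at one end of the interval each, and there a contracting
recursion replaces them (`exists_boundary_step`). The iteration shows that `r` vanishes, or has
order `α` if `α < 1`. If `cd` has order `1 + α`, then `r` divided by the length of the pair
converges to a Hölder function `g` (`exists_nonlinearity`), and summation shows that the logarithm
of the derivative has derivative `2 * g`. -/

/-- A `(B, M)` grid with the points of each level listed in increasing order: the intervals of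
level `n` are `[X n i, X n (i + 1)]` for `i < N n`, and `σ n i` is the position of the point
`X n i` at level `n + 1`. -/
structure OGrid (B : ℝ) (M : ℕ) (a b : ℝ) where
  N : ℕ → ℕ
  X : ℕ → ℕ → ℝ
  σ : ℕ → ℕ → ℕ
  one_le : 1 ≤ B
  N_pos : ∀ n, 0 < N n
  X_zero : ∀ n, X n 0 = a
  X_last : ∀ n, X n (N n) = b
  X_lt : ∀ n i, i < N n → X n i < X n (i + 1)
  ratio_up : ∀ n i, i + 1 < N n → X n (i + 2) - X n (i + 1) ≤ B * (X n (i + 1) - X n i)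
  ratio_down : ∀ n i, i + 1 < N n → X n (i + 1) - X n i ≤ B * (X n (i + 2) - X n (i + 1))
  σ_zero : ∀ n, σ n 0 = 0
  σ_last : ∀ n, σ n (N n) = N (n + 1)
  σ_X : ∀ n i, i ≤ N n → X (n + 1) (σ n i) = X n i
  σ_lower : ∀ n i, i < N n → σ n i + 2 ≤ σ n (i + 1)
  σ_upper : ∀ n i, i < N n → σ n (i + 1) ≤ σ n i + M

variable {B : ℝ} {M : ℕ} {a b : ℝ}

/-- Consecutive intervals of a level are numbered all from left to right or all from right to
left. -/
lemma Grid.orientation (G : Grid B M a b) {n : ℕ} (hn : 1 ≤ n) :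
    (∀ β, 1 ≤ β → β + 1 ≤ G.Ω n → G.right n β = G.left n (β + 1)) ∨
      (∀ β, 1 ≤ β → β + 1 ≤ G.Ω n → G.right n (β + 1) = G.left n β) := by
  -- A change of direction at the interval `β + 1` would give the intervals `β` and `β + 2` a common
  -- right endpoint (or a common left endpoint, in `step2`), so their interiors would meet.
  have step1 : ∀ β, 1 ≤ β → β + 2 ≤ G.Ω n →
      ¬ (G.right n β = G.left n (β + 1) ∧ G.right n (β + 2) = G.left n (β + 1)) := by
    rintro β h1 h2 ⟨e1, e2⟩
    have hd := G.disjoint n β (β + 2) hn h1 (by omega) (by omega) h2 (by omega)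
    have l1 := G.left_lt_right n β hn h1 (by omega)
    have l2 := G.left_lt_right n (β + 2) hn (by omega) h2
    rw [Set.disjoint_left] at hd
    have hm : max (G.left n β) (G.left n (β + 2)) < G.left n (β + 1) := max_lt (by linarith) (by linarith)
    obtain ⟨z, hz1, hz2⟩ := exists_between hm
    exact hd (a := z) ⟨(le_max_left _ _).trans_lt hz1, by linarith⟩
      ⟨(le_max_right _ _).trans_lt hz1, by linarith⟩
  have step2 : ∀ β, 1 ≤ β → β + 2 ≤ G.Ω n →
      ¬ (G.right n (β + 1) = G.left n β ∧ G.right n (β + 1) = G.left n (β + 2)) := by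
    rintro β h1 h2 ⟨e1, e2⟩
    have hd := G.disjoint n β (β + 2) hn h1 (by omega) (by omega) h2 (by omega)
    have l1 := G.left_lt_right n β hn h1 (by omega)
    have l2 := G.left_lt_right n (β + 2) hn (by omega) h2
    rw [Set.disjoint_left] at hd
    have hm : G.right n (β + 1) < min (G.right n β) (G.right n (β + 2)) := lt_min (by linarith) (by linarith)
    obtain ⟨z, hz1, hz2⟩ := exists_between hm
    exact hd (a := z) ⟨by linarith, hz2.trans_le (min_le_left _ _)⟩
      ⟨by linarith, hz2.trans_le (min_le_right _ _)⟩
  by_cases h2 : 2 ≤ G.Ω n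
  swap
  · left; intro β h1 h3; omega
  rcases G.adjacent n 1 hn le_rfl h2 with h0 | h0
  · left
    intro β h1
    induction β, h1 using Nat.le_induction with
    | base => exact fun _ => h0
    | succ β h1 ih =>
      intro h3
      rcases G.adjacent n (β + 1) hn (by omega) h3 with h | h
      · exact h
      · exact absurd ⟨ih (by omega), h⟩ (step1 β h1 (by omega))
  · right
    intro β h1
    induction β, h1 using Nat.le_induction with
    | base => exact fun _ => h0
    | succ β h1 ih =>
      intro h3
      rcases G.adjacent n (β + 1) hn (by omega) h3 with h | h
      · exact absurd ⟨ih (by omega), h⟩ (step2 β h1 (by omega))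
      · exact h

lemma lt_of_lt_step {x : ℕ → ℝ} {N : ℕ} (hx : ∀ i < N, x i < x (i + 1)) {i j : ℕ} (hij : i < j)
    (hj : j ≤ N) : x i < x j := by
  induction j, hij using Nat.le_induction with
  | base => exact hx i (by omega)
  | succ j h ih => exact (ih (by omega)).trans (hx j (by omega))

lemma le_of_lt_step {x : ℕ → ℝ} {N : ℕ} (hx : ∀ i < N, x i < x (i + 1)) {i j : ℕ} (hij : i ≤ j)
    (hj : j ≤ N) : x i ≤ x j := by
  rcases hij.eq_or_lt with rfl | h
  · exact le_rfl
  · exact (lt_of_lt_step hx h hj).le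

lemma exists_mem_step {x : ℕ → ℝ} {N : ℕ} (hN : 0 < N) {z : ℝ} (h0 : x 0 ≤ z) (h1 : z ≤ x N) :
    ∃ i < N, x i ≤ z ∧ z ≤ x (i + 1) := by
  induction N with
  | zero => omega
  | succ N ih =>
    by_cases h : x N ≤ z
    · exact ⟨N, by omega, h, h1⟩
    · rcases Nat.eq_zero_or_pos N with rfl | hN'
      · exact absurd h0 h
      · obtain ⟨i, hi, h2⟩ := ih hN' (by linarith)
        exact ⟨i, by omega, h2⟩

/-- The intervals of a level, listed from left to right. -/
lemma Grid.exists_order (G : Grid B M a b) (hab : a < b) {n : ℕ} (hn : 1 ≤ n) :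
    0 < G.Ω n ∧ ∃ (x : ℕ → ℝ) (e : ℕ → ℕ), (∀ i < G.Ω n, 1 ≤ e i ∧ e i ≤ G.Ω n ∧
        G.left n (e i) = x i ∧ G.right n (e i) = x (i + 1)) ∧
      x 0 = a ∧ x (G.Ω n) = b ∧ ((∀ i, e i = i + 1) ∨ (∀ i, e i = G.Ω n - i)) := by
  have hΩ : 0 < G.Ω n := by
    have ha : a ∈ Icc a b := ⟨le_rfl, hab.le⟩
    rw [← G.cover n hn] at ha
    simp only [mem_iUnion] at ha
    obtain ⟨β, ⟨h1, h2⟩, -⟩ := ha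
    omega
  refine ⟨hΩ, ?_⟩
  obtain ⟨x, e, hxe, he⟩ : ∃ (x : ℕ → ℝ) (e : ℕ → ℕ), (∀ i < G.Ω n, 1 ≤ e i ∧ e i ≤ G.Ω n ∧
      G.left n (e i) = x i ∧ G.right n (e i) = x (i + 1)) ∧
      ((∀ i, e i = i + 1) ∨ (∀ i, e i = G.Ω n - i)) := by
    rcases G.orientation hn with h | h
    · refine ⟨fun i => if i = 0 then G.left n 1 else G.right n i, fun i => i + 1, ?_, .inl fun _ => rfl⟩
      intro i hi
      refine ⟨by dsimp only; omega, by dsimp only; omega, ?_, by simp⟩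
      rcases Nat.eq_zero_or_pos i with rfl | h0
      · simp
      · simp only [h0.ne', if_false]
        exact (h i h0 (by omega)).symm
    · refine ⟨fun i => if i = G.Ω n then G.right n 1 else G.left n (G.Ω n - i),
        fun i => G.Ω n - i, ?_, .inr fun _ => rfl⟩
      intro i hi
      refine ⟨by dsimp only; omega, by dsimp only; omega, by simp [hi.ne], ?_⟩
      by_cases h1 : i + 1 = G.Ω n
      · have : G.Ω n - i = 1 := by omega
        simp [h1, this]
      · simp only [h1, if_false]
        have := h (G.Ω n - (i + 1)) (by omega) (by omega)
        rw [← this]; congr 1; omega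
  have hx : ∀ i < G.Ω n, x i < x (i + 1) := by
    intro i hi
    obtain ⟨h1, h2, h3, h4⟩ := hxe i hi
    rw [← h3, ← h4]; exact G.left_lt_right n _ hn h1 h2
  have hsurj : ∀ β, 1 ≤ β → β ≤ G.Ω n → ∃ i < G.Ω n, e i = β := by
    intro β h1 h2
    rcases he with he | he
    · exact ⟨β - 1, by omega, by rw [he]; omega⟩
    · exact ⟨G.Ω n - β, by omega, by rw [he]; omega⟩
  have hcov : ∀ z, z ∈ Icc a b ↔ ∃ i < G.Ω n, x i ≤ z ∧ z ≤ x (i + 1) := by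
    intro z
    rw [← G.cover n hn]
    simp only [mem_iUnion]
    constructor
    · rintro ⟨β, ⟨h1, h2⟩, h3⟩
      obtain ⟨i, hi, rfl⟩ := hsurj β h1 h2
      obtain ⟨-, -, h4, h5⟩ := hxe i hi
      exact ⟨i, hi, h4 ▸ h3.1, h5 ▸ h3.2⟩
    · rintro ⟨i, hi, h3⟩
      obtain ⟨h1, h2, h4, h5⟩ := hxe i hi
      exact ⟨e i, ⟨h1, h2⟩, by rw [h4, h5]; exact h3⟩
  refine ⟨x, e, hxe, ?_, ?_, he⟩
  · obtain ⟨i, hi, h3⟩ := (hcov a).1 ⟨le_rfl, hab.le⟩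
    have h4 := (hcov (x 0)).2 ⟨0, hΩ, le_rfl, (hx 0 hΩ).le⟩
    exact le_antisymm ((le_of_lt_step hx (Nat.zero_le i) hi.le).trans h3.1) h4.1
  · obtain ⟨i, hi, h3⟩ := (hcov b).1 ⟨hab.le, le_rfl⟩
    have h4 := (hcov (x (G.Ω n))).2 ⟨G.Ω n - 1, by omega,
      le_of_lt_step hx (by omega) le_rfl, by rw [Nat.sub_add_cancel hΩ]⟩
    exact le_antisymm h4.2 (h3.2.trans (le_of_lt_step hx (by omega) le_rfl))

/-- The data of a grid, listed from left to right. -/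
lemma Grid.exists_ogrid (G : Grid B M a b) (hab : a < b) (hB : 1 ≤ B) :
    ∃ (O : OGrid B M a b) (e : ℕ → ℕ → ℕ), (∀ n, O.N n = G.Ω (n + 1)) ∧
      (∀ n, ∀ i < O.N n, 1 ≤ e n i ∧ e n i ≤ O.N n ∧
        G.left (n + 1) (e n i) = O.X n i ∧ G.right (n + 1) (e n i) = O.X n (i + 1)) ∧
      ∀ n, (∀ i, e n i = i + 1) ∨ (∀ i, e n i = O.N n - i) := by
  -- The levels of an `OGrid` start at `0`, so its level `n` is the level `n + 1` of the grid.
  have H := fun n : ℕ => G.exists_order hab (n := n + 1) (by omega)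
  choose hΩ x e hxe h0 h1 he using H
  have hx : ∀ n, ∀ i < G.Ω (n + 1), x n i < x n (i + 1) := by
    intro n i hi
    obtain ⟨h1, h2, h3, h4⟩ := hxe n i hi
    rw [← h3, ← h4]; exact G.left_lt_right (n + 1) _ (by omega) h1 h2
  have hinj' : ∀ n i j, i ≤ G.Ω (n + 1) → j ≤ G.Ω (n + 1) → x n i ≤ x n j → i ≤ j := by
    intro n i j hi hj hlt
    by_contra hc
    exact absurd (lt_of_lt_step (hx n) (not_le.1 hc) hi) (not_lt.2 hlt)
  have hsurj : ∀ n, ∀ β, 1 ≤ β → β ≤ G.Ω (n + 1) → ∃ i < G.Ω (n + 1), e n i = β := by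
    intro n β h1 h2
    rcases he n with he | he
    · exact ⟨β - 1, by omega, by rw [he]; omega⟩
    · exact ⟨G.Ω (n + 1) - β, by omega, by rw [he]; omega⟩
  have hσ : ∀ n i, ∃ j, i ≤ G.Ω (n + 1) → j ≤ G.Ω (n + 1 + 1) ∧ x (n + 1) j = x n i := by
    intro n i
    by_cases hi : i ≤ G.Ω (n + 1)
    swap
    · exact ⟨0, fun h => absurd h hi⟩
    have hm : x n i ∈ {x | ∃ β, 1 ≤ β ∧ β ≤ G.Ω (n + 1) ∧
        (x = G.left (n + 1) β ∨ x = G.right (n + 1) β)} := by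
      rcases hi.lt_or_eq with hi' | hi'
      · obtain ⟨h1, h2, h3, h4⟩ := hxe n i hi'
        exact ⟨e n i, h1, h2, .inl h3.symm⟩
      · obtain ⟨h1, h2, h3, h4⟩ := hxe n (i - 1) (by have := hΩ n; omega)
        refine ⟨e n (i - 1), h1, h2, .inr ?_⟩
        rw [h4]; congr 1; have := hΩ n; omega
    obtain ⟨β, h1, h2, h3⟩ := G.endpoints (n + 1) (by omega) hm
    obtain ⟨j, hj, rfl⟩ := hsurj (n + 1) β h1 h2
    obtain ⟨-, -, h4, h5⟩ := hxe (n + 1) j hj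
    rcases h3 with h3 | h3
    · exact ⟨j, fun _ => ⟨by omega, by rw [h3, ← h4]⟩⟩
    · exact ⟨j + 1, fun _ => ⟨by omega, by rw [h3, ← h5]⟩⟩
  choose σ hσ using hσ
  have hcard : ∀ n i, i < G.Ω (n + 1) → σ n i + 2 ≤ σ n (i + 1) ∧ σ n (i + 1) ≤ σ n i + M := by
    intro n i hi
    obtain ⟨g1, g2, g3, g4⟩ := hxe n i hi
    have hc := G.children (n + 1) (e n i) (by omega) g1 g2
    obtain ⟨s1, s2⟩ := hσ n i hi.le
    obtain ⟨s3, s4⟩ := hσ n (i + 1) hi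
    -- The children are the intervals between the positions of the two endpoints of the parent, so
    -- the count in `children` becomes a difference of values of `σ`.
    have hset : {β | 1 ≤ β ∧ β ≤ G.Ω (n + 1 + 1) ∧
        Icc (G.left (n + 1 + 1) β) (G.right (n + 1 + 1) β) ⊆
          Icc (G.left (n + 1) (e n i)) (G.right (n + 1) (e n i))} =
        (e (n + 1)) '' (↑(Finset.Ico (σ n i) (σ n (i + 1))) : Set ℕ) := by
      ext β
      simp only [mem_ofPred_eq, mem_image, Finset.coe_Ico, mem_Ico]
      rw [g3, g4, ← s2, ← s4]
      constructor
      · rintro ⟨h1, h2, h3⟩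
        obtain ⟨j, hj, rfl⟩ := hsurj (n + 1) β h1 h2
        obtain ⟨-, -, h4, h5⟩ := hxe (n + 1) j hj
        rw [h4, h5, Icc_subset_Icc_iff (hx (n + 1) j hj).le] at h3
        have q1 := hinj' (n + 1) _ _ s1 (by omega) h3.1
        have q2 := hinj' (n + 1) _ _ (by omega) s3 h3.2
        exact ⟨j, ⟨q1, by omega⟩, rfl⟩
      · rintro ⟨j, ⟨hj1, hj2⟩, rfl⟩
        have hj : j < G.Ω (n + 1 + 1) := by omega
        obtain ⟨h1, h2, h4, h5⟩ := hxe (n + 1) j hj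
        refine ⟨h1, h2, ?_⟩
        rw [h4, h5]
        exact Icc_subset_Icc (le_of_lt_step (hx (n + 1)) hj1 hj.le)
          (le_of_lt_step (hx (n + 1)) hj2 s3)
    have hinjon : InjOn (e (n + 1)) (↑(Finset.Ico (σ n i) (σ n (i + 1))) : Set ℕ) := by
      intro j hj k hk hjk
      simp only [Finset.coe_Ico, mem_Ico] at hj hk
      rcases he (n + 1) with he | he <;> rw [he, he] at hjk
      · omega
      all_goals omega
    rw [hset, InjOn.ncard_image hinjon, ncard_coe_finset, Nat.card_Ico] at hc
    omega
  have hratio : ∀ n i, i + 1 < G.Ω (n + 1) →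
      x n (i + 2) - x n (i + 1) ≤ B * (x n (i + 1) - x n i) ∧
      x n (i + 1) - x n i ≤ B * (x n (i + 2) - x n (i + 1)) := by
    intro n i hi
    obtain ⟨g1, g2, g3, g4⟩ := hxe n i (by omega)
    obtain ⟨k1, k2, k3, k4⟩ := hxe n (i + 1) hi
    have l1 := hx n i (by omega)
    have l2 := hx n (i + 1) hi
    have hB0 : 0 < B := by linarith
    rcases he n with he | he
    · have hr := G.ratio (n + 1) (e n i) (by omega) g1 (by rw [he]; omega)
      have : e n i + 1 = e n (i + 1) := by rw [he, he]
      rw [this, g3, g4, k3, k4, le_div_iff₀ (by linarith), div_le_iff₀ (by linarith),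
        inv_mul_le_iff₀ hB0] at hr
      exact ⟨hr.2, hr.1⟩
    · have hr := G.ratio (n + 1) (e n (i + 1)) (by omega) k1 (by rw [he]; omega)
      have : e n (i + 1) + 1 = e n i := by rw [he, he]; omega
      rw [this, g3, g4, k3, k4, le_div_iff₀ (by linarith), div_le_iff₀ (by linarith),
        inv_mul_le_iff₀ hB0] at hr
      exact ⟨hr.1, hr.2⟩
  refine ⟨⟨fun n => G.Ω (n + 1), x, σ, hB, hΩ, h0, h1, hx, fun n i hi => (hratio n i hi).1,
    fun n i hi => (hratio n i hi).2, ?_, ?_, fun n i hi => (hσ n i hi).2,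
    fun n i hi => (hcard n i hi).1, fun n i hi => (hcard n i hi).2⟩, e, fun _ => rfl, hxe, he⟩
  · intro n
    obtain ⟨s1, s2⟩ := hσ n 0 (Nat.zero_le _)
    rw [h0, ← h0 (n + 1)] at s2
    exact Nat.le_zero.1 (hinj' (n + 1) _ _ s1 (Nat.zero_le _) s2.le)
  · intro n
    obtain ⟨s1, s2⟩ := hσ n _ le_rfl
    replace s2 := s2.trans ((h1 n).trans (h1 (n + 1)).symm)
    exact le_antisymm s1 (hinj' (n + 1) _ _ le_rfl s1 s2.ge)

end GridSmoothness

/-! ### Geometry of a grid: comparable lengths, shrinking mesh, coverings. -/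

namespace GridSmoothness

variable {B : ℝ} {M : ℕ} {a b : ℝ}

namespace OGrid

/-- The length of the `i`-th interval of level `n`. -/
def p (G : OGrid B M a b) (n i : ℕ) : ℝ := G.X n (i + 1) - G.X n i

/-- The largest proportion of an interval that a child can occupy. -/
def lam (_ : OGrid B M a b) : ℝ := B / (1 + B)

variable (G : OGrid B M a b)

lemma B_pos (G : OGrid B M a b) : 0 < B := by linarith [G.one_le]

lemma lam_pos : 0 < G.lam := by have := G.B_pos; unfold lam; positivity

lemma lam_lt_one : G.lam < 1 := by
  have := G.B_pos
  unfold lam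
  rw [div_lt_one (by linarith)]; linarith

lemma X_lt_X {n i j : ℕ} (hij : i < j) (hj : j ≤ G.N n) : G.X n i < G.X n j :=
  lt_of_lt_step (G.X_lt n) hij hj

lemma X_le_X {n i j : ℕ} (hij : i ≤ j) (hj : j ≤ G.N n) : G.X n i ≤ G.X n j :=
  le_of_lt_step (G.X_lt n) hij hj

lemma lt_of_X_lt {n i j : ℕ} (hi : i ≤ G.N n) (h : G.X n i < G.X n j) : i < j := by
  by_contra hc
  exact absurd (G.X_le_X (not_lt.1 hc) hi) (not_le.2 h)

lemma X_mem {n i : ℕ} (hi : i ≤ G.N n) : G.X n i ∈ Icc a b :=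
  ⟨(G.X_zero n).ge.trans (G.X_le_X (Nat.zero_le i) hi),
    (G.X_le_X hi le_rfl).trans (G.X_last n).le⟩

lemma a_lt_b (G : OGrid B M a b) : a < b := by
  have := G.X_lt_X (G.N_pos 0) le_rfl
  rwa [G.X_zero, G.X_last] at this

lemma p_pos {n i : ℕ} (hi : i < G.N n) : 0 < G.p n i := sub_pos.2 (G.X_lt n i hi)

lemma p_up {n i : ℕ} (hi : i + 1 < G.N n) : G.p n (i + 1) ≤ B * G.p n i := G.ratio_up n i hi

lemma p_down {n i : ℕ} (hi : i + 1 < G.N n) : G.p n i ≤ B * G.p n (i + 1) := G.ratio_down n i hi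

lemma p_le_pow_add {n i k : ℕ} (h : i + k < G.N n) :
    G.p n i ≤ B ^ k * G.p n (i + k) ∧ G.p n (i + k) ≤ B ^ k * G.p n i := by
  have hB := G.one_le
  induction k with
  | zero => simp
  | succ k ih =>
    obtain ⟨h1, h2⟩ := ih (by omega)
    have h3 := G.p_up (n := n) (i := i + k) (by omega)
    have h4 := G.p_down (n := n) (i := i + k) (by omega)
    have hBk : 0 ≤ B ^ k := by positivity
    constructor
    · calc G.p n i ≤ B ^ k * G.p n (i + k) := h1
        _ ≤ B ^ k * (B * G.p n (i + k + 1)) := by gcongr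
        _ = _ := by rw [pow_succ]; ring_nf
    · calc G.p n (i + (k + 1)) ≤ B * G.p n (i + k) := h3
        _ ≤ B * (B ^ k * G.p n i) := by gcongr
        _ = _ := by rw [pow_succ]; ring

lemma p_le_pow {n i j k : ℕ} (hi : i < G.N n) (hj : j < G.N n) (h1 : i ≤ j + k) (h2 : j ≤ i + k) :
    G.p n i ≤ B ^ k * G.p n j := by
  have hB := G.one_le
  rcases le_total i j with h | h
  · obtain ⟨l, rfl⟩ := Nat.exists_eq_add_of_le h
    refine (G.p_le_pow_add hj).1.trans ?_
    gcongr
    · exact (G.p_pos hj).le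
    · omega
  · obtain ⟨l, rfl⟩ := Nat.exists_eq_add_of_le h
    refine (G.p_le_pow_add hi).2.trans ?_
    gcongr
    · exact (G.p_pos hj).le
    · omega

lemma σ_lt {n i j : ℕ} (hij : i < j) (hj : j ≤ G.N n) : G.σ n i < G.σ n j := by
  induction j, hij using Nat.le_induction with
  | base => have := G.σ_lower n i (by omega); simp only [Nat.succ_eq_add_one]; omega
  | succ j h ih => have := ih (by omega); have := G.σ_lower n j (by omega); omega

lemma σ_le {n i j : ℕ} (hij : i ≤ j) (hj : j ≤ G.N n) : G.σ n i ≤ G.σ n j := by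
  rcases hij.eq_or_lt with rfl | h
  · exact le_rfl
  · exact (G.σ_lt h hj).le

lemma σ_le_N {n i : ℕ} (hi : i ≤ G.N n) : G.σ n i ≤ G.N (n + 1) := by
  rw [← G.σ_last n]; exact G.σ_le hi le_rfl

lemma two_le_N (n : ℕ) : 2 ≤ G.N (n + 1) := by
  have h1 := G.σ_lower n 0 (G.N_pos n)
  have h2 := G.σ_le_N (n := n) (i := 0 + 1) (G.N_pos n)
  omega

lemma two_le_M (G : OGrid B M a b) : 2 ≤ M := by
  have h1 := G.σ_lower 0 0 (G.N_pos 0)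
  have h2 := G.σ_upper 0 0 (G.N_pos 0)
  omega

lemma exists_parent {n j : ℕ} (hj : j < G.N (n + 1)) :
    ∃ i < G.N n, G.σ n i ≤ j ∧ j < G.σ n (i + 1) := by
  have key : ∀ k ≤ G.N n, j < G.σ n k → ∃ i < k, G.σ n i ≤ j ∧ j < G.σ n (i + 1) := by
    intro k
    induction k with
    | zero => intro _ h; rw [G.σ_zero] at h; omega
    | succ k ih =>
      intro hk h
      by_cases hc : j < G.σ n k
      · obtain ⟨i, hi, h2⟩ := ih (by omega) hc
        exact ⟨i, by omega, h2⟩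
      · exact ⟨k, by omega, not_lt.1 hc, h⟩
  exact key _ le_rfl (by rw [G.σ_last]; exact hj)

/-- A child has a neighbour among its siblings (the right one, or the left one for the last child).
This neighbour is at least `B⁻¹` times as long, and both fit into the parent; hence the factor `B /
(1 + B)`. -/
lemma child_le {n i j : ℕ} (hi : i < G.N n) (h1 : G.σ n i ≤ j) (h2 : j < G.σ n (i + 1)) :
    G.p (n + 1) j ≤ G.lam * G.p n i := by
  have hB := G.B_pos
  have hN := G.σ_le_N (n := n) (i := i + 1) hi
  have hlow := G.σ_lower n i hi
  have e1 := G.σ_X n i hi.le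
  have e2 := G.σ_X n (i + 1) hi
  unfold lam
  rw [div_mul_eq_mul_div, le_div_iff₀ (by linarith)]
  by_cases h : j + 1 < G.σ n (i + 1)
  · have h3 := G.p_down (n := n + 1) (i := j) (by omega)
    have h4 : G.p (n + 1) j + G.p (n + 1) (j + 1) ≤ G.p n i := by
      have q1 := G.X_le_X (n := n + 1) h1 (by omega)
      have q2 := G.X_le_X (n := n + 1) (i := j + 2) (j := G.σ n (i + 1)) (by omega) hN
      simp only [p]; rw [← e1, ← e2]; ring_nf at *; linarith
    nlinarith
  · obtain ⟨j, rfl⟩ : ∃ k, j = k + 1 := ⟨j - 1, by omega⟩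
    have h3 := G.p_up (n := n + 1) (i := j) (by omega)
    have h4 : G.p (n + 1) j + G.p (n + 1) (j + 1) ≤ G.p n i := by
      have q1 := G.X_le_X (n := n + 1) (i := G.σ n i) (j := j) (by omega) (by omega)
      have q2 := G.X_le_X (n := n + 1) (i := j + 2) (j := G.σ n (i + 1)) (by omega) hN
      simp only [p]; rw [← e1, ← e2]; ring_nf at *; linarith
    nlinarith

/-- The parent is filled by at most `M` children, and each of them is at most `B ^ M` times as long
as any other. -/
lemma child_ge {n i j : ℕ} (hi : i < G.N n) (h1 : G.σ n i ≤ j) (h2 : j < G.σ n (i + 1)) :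
    G.p n i ≤ M * B ^ M * G.p (n + 1) j := by
  have hN := G.σ_le_N (n := n) (i := i + 1) hi
  have hup := G.σ_upper n i hi
  have hB := G.B_pos
  have hpj := G.p_pos (n := n + 1) (i := j) (by omega)
  have key : ∀ k, G.σ n i + k ≤ G.σ n (i + 1) →
      G.X (n + 1) (G.σ n i + k) - G.X (n + 1) (G.σ n i) ≤ k * (B ^ M * G.p (n + 1) j) := by
    intro k
    induction k with
    | zero => simp
    | succ k ih =>
      intro hk
      have h3 := ih (by omega)
      have h4 := G.p_le_pow (n := n + 1) (i := G.σ n i + k) (j := j) (k := M) (by omega) (by omega)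
        (by omega) (by omega)
      simp only [p] at h3 h4 ⊢
      push_cast
      rw [← add_assoc]
      linarith
  have h5 := key (G.σ n (i + 1) - G.σ n i) (by omega)
  rw [Nat.add_sub_cancel' (by omega), G.σ_X n i hi.le, G.σ_X n (i + 1) hi] at h5
  refine h5.trans ?_
  rw [mul_assoc]
  gcongr
  exact_mod_cast (by omega : G.σ n (i + 1) - G.σ n i ≤ M)

lemma p_le_mesh {n i : ℕ} (hi : i < G.N n) : G.p n i ≤ G.lam ^ n * (b - a) := by
  induction n generalizing i with
  | zero =>
    have h1 := (G.X_mem (n := 0) (i := i) hi.le).1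
    have h2 := (G.X_mem (n := 0) (i := i + 1) hi).2
    simp only [p]; linarith
  | succ n ih =>
    obtain ⟨k, hk, h1, h2⟩ := G.exists_parent hi
    refine (G.child_le hk h1 h2).trans ?_
    rw [pow_succ, mul_comm (G.lam ^ n), mul_assoc]
    exact mul_le_mul_of_nonneg_left (ih hk) G.lam_pos.le

lemma p_le_length {n i : ℕ} (hi : i < G.N n) : G.p n i ≤ b - a := by
  have h1 := (G.X_mem (n := n) (i := i) hi.le).1
  have h2 := (G.X_mem (n := n) (i := i + 1) hi).2
  simp only [p]; linarith

lemma tendsto_mesh : Filter.Tendsto (fun n => G.lam ^ n * (b - a)) Filter.atTop (nhds 0) := by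
  have := (tendsto_pow_atTop_nhds_zero_of_lt_one G.lam_pos.le G.lam_lt_one).mul_const (b - a)
  simpa using this

lemma exists_mesh_lt {δ : ℝ} (hδ : 0 < δ) : ∃ n₀, ∀ n ≥ n₀, ∀ i < G.N n, G.p n i < δ := by
  obtain ⟨n₀, h⟩ := Filter.eventually_atTop.1 (G.tendsto_mesh.eventually_lt_const hδ)
  exact ⟨n₀, fun n hn i hi => (G.p_le_mesh hi).trans_lt (h n hn)⟩

lemma exists_mem {n : ℕ} {z : ℝ} (hz : z ∈ Icc a b) :
    ∃ i < G.N n, G.X n i ≤ z ∧ z ≤ G.X n (i + 1) :=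
  exists_mem_step (G.N_pos n) (by rw [G.X_zero]; exact hz.1) (by rw [G.X_last]; exact hz.2)

/-- Here `τ` is an iterate of `σ`. Passing down `j` generations multiplies the number of intervals
by at most `M ^ j` while the lengths shrink by `lam ^ j`; this is how a covering is refined with
control of its size. -/
lemma exists_descendants (n j : ℕ) : ∃ τ : ℕ → ℕ,
    (∀ i ≤ G.N n, τ i ≤ G.N (n + j) ∧ G.X (n + j) (τ i) = G.X n i) ∧
    (∀ i < G.N n, τ i < τ (i + 1) ∧ τ (i + 1) ≤ τ i + M ^ j) ∧
    ∀ i < G.N n, ∀ t, τ i ≤ t → t < τ (i + 1) → G.p (n + j) t ≤ G.lam ^ j * G.p n i := by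
  induction j with
  | zero =>
    refine ⟨id, by simp, by simp, ?_⟩
    intro i hi t h1 h2
    obtain rfl : t = i := by simp only [id] at h1 h2; omega
    simp
  | succ j ih =>
    obtain ⟨τ, h1, h2, h3⟩ := ih
    have hle : ∀ d i, i + d ≤ G.N (n + j) → G.σ (n + j) (i + d) ≤ G.σ (n + j) i + d * M := by
      intro d
      induction d with
      | zero => simp
      | succ d ihd =>
        intro i hi
        have q1 := ihd i (by omega)
        have q2 := G.σ_upper (n + j) (i + d) (by omega)
        rw [← add_assoc, add_mul]; omega
    refine ⟨fun i => G.σ (n + j) (τ i), ?_, ?_, ?_⟩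
    · intro i hi
      obtain ⟨q1, q2⟩ := h1 i hi
      exact ⟨G.σ_le_N q1, (G.σ_X _ _ q1).trans q2⟩
    · intro i hi
      obtain ⟨q1, q2⟩ := h2 i hi
      obtain ⟨q3, -⟩ := h1 (i + 1) hi
      refine ⟨G.σ_lt q1 q3, ?_⟩
      obtain ⟨d, hd⟩ := Nat.exists_eq_add_of_lt q1
      have := hle (d + 1) (τ i) (by omega)
      dsimp only
      rw [hd, add_assoc]
      refine this.trans ?_
      rw [pow_succ]
      gcongr
      omega
    · intro i hi t q1 q2
      obtain ⟨q3, -⟩ := h1 (i + 1) hi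
      have ht : t < G.N (n + j + 1) := q2.trans_le (G.σ_le_N q3)
      obtain ⟨k, hk, q4, q5⟩ := G.exists_parent ht
      have q6 : τ i ≤ k := by
        by_contra hc
        have := G.σ_le (n := n + j) (i := k + 1) (j := τ i) (by omega) (h1 i hi.le).1
        dsimp only at q1; omega
      have q7 : k < τ (i + 1) := by
        by_contra hc
        have := G.σ_le (n := n + j) (i := τ (i + 1)) (j := k) (by omega) hk.le
        dsimp only at q2; omega
      calc G.p (n + j + 1) t ≤ G.lam * G.p (n + j) k := G.child_le hk q4 q5
        _ ≤ G.lam * (G.lam ^ j * G.p n i) :=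
            mul_le_mul_of_nonneg_left (h3 i hi k q6 q7) G.lam_pos.le
        _ = _ := by rw [pow_succ]; ring

/-- Every interval is covered by a bounded number of consecutive grid intervals of some level which
are not much longer. -/
lemma exists_cover : ∃ C : ℝ, 1 ≤ C ∧ ∃ K : ℕ, ∀ z w, a ≤ z → z < w → w ≤ b →
    ∃ m i k, k ≤ K ∧ i + k ≤ G.N m ∧ G.X m i ≤ z ∧ w ≤ G.X m (i + k) ∧
      ∀ t, i ≤ t → t < i + k → G.p m t ≤ C * (w - z) := by
  have hB := G.one_le
  have hM := G.two_le_M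
  -- Two intervals are enough for the covering except at level `0`, where all `N 0` intervals may
  -- have to be taken.
  set k₀ := max 2 (G.N 0) with hk₀
  refine ⟨B ^ k₀ * (M * B ^ M), ?_, k₀, ?_⟩
  · have h1 : (1 : ℝ) ≤ M := by exact_mod_cast (by omega : 1 ≤ M)
    exact one_le_mul_of_one_le_of_one_le (one_le_pow₀ hB)
      (one_le_mul_of_one_le_of_one_le h1 (one_le_pow₀ hB))
  intro z w hz hzw hw
  -- `P m` says that two neighbours of level `m` already cover `[z, w]`. It cannot hold at all
  -- positive levels because the mesh tends to `0`, so the covering is taken where it is lost at the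
  -- next level.
  set P : ℕ → Prop := fun m => ∃ i, i + 2 ≤ G.N m ∧ G.X m i ≤ z ∧ w ≤ G.X m (i + 2) with hP
  obtain ⟨m, ⟨i, k, hk, hik, h1, h2⟩, hnot⟩ : ∃ m, (∃ i k, k ≤ k₀ ∧ i + k ≤ G.N m ∧
      G.X m i ≤ z ∧ w ≤ G.X m (i + k)) ∧ ¬ P (m + 1) := by
    by_cases hP1 : P 1
    · by_contra hc
      have hall : ∀ m, P (m + 1) := by
        intro m
        induction m with
        | zero => exact hP1
        | succ m ih =>
          by_contra hn
          obtain ⟨i, q⟩ := ih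
          exact hc ⟨m + 1, ⟨i, 2, le_max_left _ _, q⟩, hn⟩
      obtain ⟨n₀, hn⟩ := G.exists_mesh_lt (δ := (w - z) / 2) (by linarith)
      obtain ⟨i, q1, q2, q3⟩ := hall n₀
      have q4 := hn (n₀ + 1) (by omega) i (by omega)
      have q5 := hn (n₀ + 1) (by omega) (i + 1) (by omega)
      simp only [p] at q4 q5
      have : i + 1 + 1 = i + 2 := rfl
      rw [this] at q5
      linarith
    · exact ⟨0, ⟨0, G.N 0, le_max_right _ _, by omega, by rw [G.X_zero]; exact hz,
        by rw [zero_add, G.X_last]; exact hw⟩, hP1⟩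
  refine ⟨m, i, k, hk, hik, h1, h2, ?_⟩
  intro t ht1 ht2
  -- As `P (m + 1)` fails, the interval `j + 1` of level `m + 1` lies inside `[z, w]`. Its parent
  -- `u` belongs to the covering and has length at most `M * B ^ M * (w - z)`; the other members are
  -- comparable with `u`.
  obtain ⟨j, hj, hj1, hj2⟩ := G.exists_mem (n := m + 1) (z := z) ⟨hz, by linarith⟩
  have hN2 := G.two_le_N m
  have hj3 : j + 2 ≤ G.N (m + 1) := by
    by_contra hc
    refine hnot ⟨j - 1, by omega, (G.X_le_X (by omega) (by omega)).trans hj1, ?_⟩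
    have : j - 1 + 2 = G.N (m + 1) := by omega
    rw [this, G.X_last]; exact hw
  have hj4 : G.X (m + 1) (j + 2) < w := by
    by_contra hc
    exact hnot ⟨j, hj3, hj1, not_lt.1 hc⟩
  obtain ⟨u, hu, hu1, hu2⟩ := G.exists_parent (n := m) (j := j + 1) (by omega)
  have hlt := G.X_lt (m + 1) (j + 1) (by omega)
  have e1 : G.X m u ≤ G.X (m + 1) (j + 1) := by
    rw [← G.σ_X m u hu.le]; exact G.X_le_X hu1 (by omega)
  have e2 : G.X (m + 1) (j + 2) ≤ G.X m (u + 1) := by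
    rw [← G.σ_X m (u + 1) hu]; exact G.X_le_X hu2 (G.σ_le_N hu)
  have hlt' : G.X (m + 1) (j + 1) < G.X (m + 1) (j + 2) := hlt
  have u1 : u < i + k := G.lt_of_X_lt hu.le (by linarith)
  have u2 : i < u + 1 := G.lt_of_X_lt (n := m) (by omega) (by linarith)
  calc G.p m t ≤ B ^ k₀ * G.p m u := G.p_le_pow (by omega) hu (by omega) (by omega)
    _ ≤ B ^ k₀ * (M * B ^ M * G.p (m + 1) (j + 1)) := by
        gcongr; exact G.child_ge hu hu1 hu2
    _ ≤ B ^ k₀ * (M * B ^ M * (w - z)) := by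
        have : G.p (m + 1) (j + 1) ≤ w - z := by
          simp only [p]
          have : j + 1 + 1 = j + 2 := rfl
          rw [this]; linarith
        gcongr
    _ = _ := by ring

/-- Every interval is covered by a bounded number of consecutive grid intervals of some level that
are as short as we like, relative to its length. -/
lemma exists_fine_cover {η : ℝ} (hη : 0 < η) (n₀ : ℕ) : ∃ K : ℕ, ∀ z w, a ≤ z → z < w → w ≤ b →
    ∃ n ≥ n₀, ∃ i k, i ≤ k ∧ k ≤ i + K ∧ k < G.N n ∧ G.X n i ≤ z ∧ z < G.X n (i + 1) ∧
      G.X n k < w ∧ w ≤ G.X n (k + 1) ∧ ∀ t, i ≤ t → t ≤ k → G.p n t ≤ η * (w - z) := by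
  obtain ⟨C, hC, K, hcov⟩ := G.exists_cover
  -- Going down `j` generations absorbs the constant `C` of the coarse covering into `η`; taking `j
  -- ≥ n₀` also makes the level deep enough.
  obtain ⟨j, hjn, hj⟩ : ∃ j ≥ n₀, G.lam ^ j * C ≤ η := by
    have h := (tendsto_pow_atTop_nhds_zero_of_lt_one G.lam_pos.le G.lam_lt_one).mul_const C
    rw [zero_mul] at h
    obtain ⟨j, hj⟩ := Filter.eventually_atTop.1 (h.eventually_lt_const hη)
    exact ⟨max j n₀, le_max_right _ _, (hj _ (le_max_left _ _)).le⟩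
  refine ⟨K * M ^ j, ?_⟩
  intro z w hz hzw hw
  obtain ⟨m, i, k, hk, hik, h1, h2, h3⟩ := hcov z w hz hzw hw
  obtain ⟨τ, t1, t2, t3⟩ := G.exists_descendants m j
  have hcount : ∀ d, i + d ≤ G.N m → τ (i + d) ≤ τ i + d * M ^ j := by
    intro d
    induction d with
    | zero => simp
    | succ d ih =>
      intro hd
      have q1 := ih (by omega)
      have q2 := (t2 (i + d) (by omega)).2
      rw [← add_assoc, add_mul]; omega
  obtain ⟨u, hu, hu1, hu2⟩ : ∃ u < G.N (m + j), G.X (m + j) u ≤ z ∧ z < G.X (m + j) (u + 1) := by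
    obtain ⟨u, hu, q1, q2⟩ := G.exists_mem (n := m + j) (z := z) ⟨hz, by linarith⟩
    rcases q2.lt_or_eq with q2 | q2
    · exact ⟨u, hu, q1, q2⟩
    · have : u + 1 < G.N (m + j) := by
        by_contra hc
        have : u + 1 = G.N (m + j) := by omega
        rw [this, G.X_last] at q2; linarith
      exact ⟨u + 1, this, q2.ge, by rw [q2]; exact G.X_lt _ _ this⟩
  obtain ⟨v, hv, hv1, hv2⟩ : ∃ v < G.N (m + j), G.X (m + j) v < w ∧ w ≤ G.X (m + j) (v + 1) := by
    obtain ⟨v, hv, q1, q2⟩ := G.exists_mem (n := m + j) (z := w) ⟨by linarith, hw⟩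
    rcases q1.lt_or_eq with q1 | q1
    · exact ⟨v, hv, q1, q2⟩
    · have h0 : v ≠ 0 := by
        rintro rfl
        rw [G.X_zero] at q1; linarith
      obtain ⟨v, rfl⟩ := Nat.exists_eq_succ_of_ne_zero h0
      exact ⟨v, by omega, by rw [← q1]; exact G.X_lt _ _ (by omega), q1.ge⟩
  have g1 := t1 i (by omega)
  have g2 := t1 (i + k) hik
  have hiu : τ i ≤ u := Nat.lt_succ_iff.1 (G.lt_of_X_lt g1.1 (by rw [g1.2]; linarith))
  have hvk : v < τ (i + k) := G.lt_of_X_lt hv.le (by rw [g2.2]; linarith)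
  have huv : u ≤ v := Nat.lt_succ_iff.1 (G.lt_of_X_lt hu.le (by linarith))
  refine ⟨m + j, by omega, u, v, huv, ?_, hv, hu1, hu2, hv1, hv2, ?_⟩
  · have := hcount k hik
    have : k * M ^ j ≤ K * M ^ j := Nat.mul_le_mul_right _ hk
    omega
  · intro t ht1 ht2
    have key : ∀ d, d ≤ k → t < τ (i + d) → ∃ e < d, τ (i + e) ≤ t ∧ t < τ (i + e + 1) := by
      intro d
      induction d with
      | zero => intro _ q; rw [add_zero] at q; omega
      | succ d ih =>
        intro hd q
        by_cases hc : t < τ (i + d)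
        · obtain ⟨e, he, q3⟩ := ih (by omega) hc
          exact ⟨e, by omega, q3⟩
        · exact ⟨d, by omega, not_lt.1 hc, q⟩
    obtain ⟨e, he, q1, q2⟩ := key k le_rfl (by omega)
    calc G.p (m + j) t ≤ G.lam ^ j * G.p m (i + e) := t3 (i + e) (by omega) t q1 q2
      _ ≤ G.lam ^ j * (C * (w - z)) :=
        mul_le_mul_of_nonneg_left (h3 _ (by omega) (by omega)) (pow_nonneg G.lam_pos.le j)
      _ = G.lam ^ j * C * (w - z) := by ring
      _ ≤ _ := mul_le_mul_of_nonneg_right hj (by linarith)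

end OGrid

end GridSmoothness

/-! ### Moduli, distortions in terms of log slopes, and the transfer to the listed grid. -/

namespace GridSmoothness

variable {B : ℝ} {M : ℕ} {a b : ℝ}

/-- A family of numbers that is bounded and small where the parameter `t` is small has a modulus. -/
lemma exists_modulus {ι : Type*} {t D : ι → ℝ} (ht : ∀ i, 0 < t i) {K : ℝ} (hK : ∀ i, |D i| ≤ K)
    (hD : ∀ η > 0, ∃ δ > 0, ∀ i, t i < δ → |D i| ≤ η) :
    ∃ ε, IsModulus ε ∧ ∀ i, |D i| ≤ ε (t i) := by
  obtain ⟨L, hL0, hKL⟩ : ∃ L > 0, K ≤ L := ⟨max K 1, by positivity, le_max_left _ _⟩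
  have hδ : ∀ k : ℕ, ∃ δ > 0, ∀ i, t i < δ → |D i| ≤ L * (1 / 2) ^ k := fun k =>
    hD _ (by positivity)
  choose δ hδ0 hδ using hδ
  have hg : Summable fun k : ℕ => 2 * L * (1 / 2 : ℝ) ^ k :=
    (summable_geometric_of_lt_one (by norm_num) (by norm_num)).mul_left _
  have hbound : ∀ k s, 0 ≤ s → ‖2 * L * (1 / 2 : ℝ) ^ k * min 1 (s / δ k)‖ ≤ 2 * L * (1 / 2 : ℝ) ^ k := by
    intro k s hs
    have h1 : 0 ≤ min 1 (s / δ k) := le_min zero_le_one (div_nonneg hs (hδ0 k).le)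
    rw [Real.norm_of_nonneg (by positivity)]
    exact mul_le_of_le_one_right (by positivity) (min_le_left _ _)
  -- Let `k` be the least index with `δ k ≤ t`. The `k`-th term is then `2 * L * (1 / 2) ^ k`, and
  -- `t < δ (k - 1)` bounds `|D|` by the same number; for `k = 0` the global bound `L` suffices. If
  -- there is no such `k`, then `D = 0`.
  refine ⟨fun s => ∑' k : ℕ, 2 * L * (1 / 2 : ℝ) ^ k * min 1 (s / δ k), ⟨?_, ?_, ?_⟩, ?_⟩
  · exact continuousOn_tsum (fun k => by fun_prop) hg (fun k s hs => hbound k s hs)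
  · intro s hs
    refine tsum_nonneg fun k => ?_
    have h1 : 0 ≤ min 1 (s / δ k) := le_min zero_le_one (div_nonneg hs (hδ0 k).le)
    positivity
  · simp
  · intro i
    have hnonneg : ∀ k, 0 ≤ 2 * L * (1 / 2 : ℝ) ^ k * min 1 (t i / δ k) := fun k => by
      have h1 : 0 ≤ min 1 (t i / δ k) := le_min zero_le_one (div_nonneg (ht i).le (hδ0 k).le)
      positivity
    have hsum : Summable fun k : ℕ => 2 * L * (1 / 2 : ℝ) ^ k * min 1 (t i / δ k) :=
      hg.of_norm_bounded (fun k => hbound k _ (ht i).le)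
    by_cases hex : ∃ k, δ k ≤ t i
    · classical
      have hk := Nat.find_spec hex
      set k := Nat.find hex with hkdef
      have hle := hsum.le_tsum k (fun j _ => hnonneg j)
      refine le_trans ?_ hle
      have h1 : min 1 (t i / δ k) = 1 := min_eq_left ((one_le_div (hδ0 k)).2 hk)
      rw [h1, mul_one]
      rcases Nat.eq_zero_or_pos k with h0 | h0
      · rw [h0, pow_zero]; linarith [hK i]
      · obtain ⟨l, hl⟩ := Nat.exists_eq_succ_of_ne_zero h0.ne'
        have h2 : t i < δ l := not_le.1 (Nat.find_min hex (by omega))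
        have h3 := hδ l i h2
        rw [hl, Nat.succ_eq_add_one, pow_succ]; linarith
    · push Not at hex
      have h0 : |D i| ≤ 0 := by
        have hl : Filter.Tendsto (fun k : ℕ => L * (1 / 2 : ℝ) ^ k) Filter.atTop (nhds 0) := by
          simpa using (tendsto_pow_atTop_nhds_zero_of_lt_one (by norm_num : (0 : ℝ) ≤ 1 / 2)
            (by norm_num)).const_mul L
        exact ge_of_tendsto' hl fun k => hδ k i (hex k)
      exact h0.trans (tsum_nonneg hnonneg)

lemma IsModulus.exists_small {ε : ℝ → ℝ} (hε : IsModulus ε) {η : ℝ} (hη : 0 < η) :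
    ∃ δ > 0, ∀ t, 0 ≤ t → t < δ → ε t ≤ η := by
  have h := hε.1 0 self_mem_Ici
  rw [Metric.continuousWithinAt_iff] at h
  obtain ⟨δ, hδ, h⟩ := h η hη
  refine ⟨δ, hδ, fun t ht htδ => ?_⟩
  have := h ht (by rw [Real.dist_eq, sub_zero, abs_of_nonneg ht]; exact htδ)
  rw [hε.2.2, Real.dist_eq, sub_zero] at this
  exact (le_abs_self _).trans this.le

/-- The logarithm of the average slope of `h` on `[x, y]`. -/
def logSlope (h : ℝ → ℝ) (x y : ℝ) : ℝ := Real.log ((h y - h x) / (y - x))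

/-- The cross ratio distortion of four points. -/
def crossDist (h : ℝ → ℝ) (w x y z : ℝ) : ℝ :=
  logSlope h w y + logSlope h x z - logSlope h w x - logSlope h y z

/-- The argument of the logarithm factors as `(p + q) * (q + s) / (p * s)`. This makes cross ratio
distortions additive in log slopes, so that they can be telescoped. -/
lemma crossRatio_eq {p q s : ℝ} (hp : 0 < p) (hq : 0 < q) (hs : 0 < s) :
    crossRatio p q s = Real.log (p + q) + Real.log (q + s) - Real.log p - Real.log s := by
  have h : 1 + q / p * ((p + q + s) / s) = (p + q) * (q + s) / p / s := by field_simp; ring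
  unfold crossRatio
  rw [h, Real.log_div (by positivity) hs.ne', Real.log_div (by positivity) hp.ne',
    Real.log_mul (by positivity) (by positivity)]

lemma crossDist_eq {h : ℝ → ℝ} {S : Set ℝ} (hm : StrictMonoOn h S) {w x y z : ℝ} (hw : w ∈ S)
    (hx : x ∈ S) (hy : y ∈ S) (hz : z ∈ S) (hwx : w < x) (hxy : x < y) (hyz : y < z) :
    crossRatio (h x - h w) (h y - h x) (h z - h y) - crossRatio (x - w) (y - x) (z - y) =
      crossDist h w x y z := by
  have i1 := hm hw hx hwx
  have i2 := hm hx hy hxy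
  have i3 := hm hy hz hyz
  rw [crossRatio_eq (by linarith) (by linarith) (by linarith),
    crossRatio_eq (by linarith) (by linarith) (by linarith)]
  unfold crossDist logSlope
  have e1 : h x - h w + (h y - h x) = h y - h w := by ring
  have e2 : h y - h x + (h z - h y) = h z - h x := by ring
  have e3 : x - w + (y - x) = y - w := by ring
  have e4 : y - x + (z - y) = z - x := by ring
  rw [e1, e2, e3, e4, Real.log_div (by linarith) (by linarith),
    Real.log_div (by linarith) (by linarith), Real.log_div (by linarith) (by linarith),
    Real.log_div (by linarith) (by linarith)]
  ring

namespace OGrid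

variable (G : OGrid B M a b) (h : ℝ → ℝ)

/-- The logarithm of the average slope of `h` on the `i`-th interval of level `n`. -/
def ls (n i : ℕ) : ℝ := logSlope h (G.X n i) (G.X n (i + 1))

/-- The logarithmic ratio distortion of the intervals `i` and `i + 1` of level `n`. -/
def r (n i : ℕ) : ℝ := G.ls h n (i + 1) - G.ls h n i

/-- The cross ratio distortion of the intervals `i`, `i + 1`, `i + 2` of level `n`. -/
def cd (n i : ℕ) : ℝ :=
  crossDist h (G.X n i) (G.X n (i + 1)) (G.X n (i + 2)) (G.X n (i + 3))

/-- `D n i`, defined for `i + k < N n`, tends to `0` uniformly as `n → ∞`. -/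
def Vanishes (k : ℕ) (D : ℕ → ℕ → ℝ) : Prop :=
  ∀ η > 0, ∃ n₀, ∀ n ≥ n₀, ∀ i, i + k < G.N n → |D n i| ≤ η

variable {G h}

/-- Finitely many levels contain finitely many intervals. This turns eventual bounds into uniform
ones. -/
lemma exists_bound_below (G : OGrid B M a b) (k : ℕ) (D : ℕ → ℕ → ℝ) (n₀ : ℕ) :
    ∃ K, 0 ≤ K ∧ ∀ n < n₀, ∀ i, i + k < G.N n → |D n i| ≤ K := by
  induction n₀ with
  | zero => exact ⟨0, le_rfl, by simp⟩
  | succ n₀ ih =>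
    obtain ⟨K, hK0, hK⟩ := ih
    refine ⟨K + ∑ i ∈ Finset.range (G.N n₀), |D n₀ i|, by positivity, ?_⟩
    intro n hn i hi
    rcases (Nat.lt_succ_iff.1 hn).lt_or_eq with h1 | rfl
    · exact (hK n h1 i hi).trans (le_add_of_nonneg_right (by positivity))
    · refine le_add_of_nonneg_of_le hK0 ?_
      exact Finset.single_le_sum (f := fun i => |D n i|) (fun _ _ => abs_nonneg _)
        (Finset.mem_range.2 (by omega))

lemma exists_lower_bound_p (G : OGrid B M a b) (n₀ : ℕ) :
    ∃ δ > 0, ∀ n < n₀, ∀ i < G.N n, δ ≤ G.p n i := by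
  obtain ⟨K, hK0, hK⟩ := G.exists_bound_below 0 (fun n i => (G.p n i)⁻¹) n₀
  refine ⟨(K + 1)⁻¹, by positivity, fun n hn i hi => ?_⟩
  have := (le_abs_self _).trans (hK n hn i hi)
  exact inv_le_of_inv_le₀ (G.p_pos hi) (by linarith)

lemma Vanishes.exists_bound {k : ℕ} {D : ℕ → ℕ → ℝ} (hD : G.Vanishes k D) :
    ∃ K, 0 ≤ K ∧ ∀ n i, i + k < G.N n → |D n i| ≤ K := by
  obtain ⟨n₀, hn⟩ := hD 1 one_pos
  obtain ⟨K, hK0, hK⟩ := G.exists_bound_below k D n₀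
  refine ⟨K + 1, by linarith, fun n i hi => ?_⟩
  rcases lt_or_ge n n₀ with h1 | h1
  · linarith [hK n h1 i hi]
  · linarith [hn n h1 i hi]

/-- Intervals of the first `n₀` levels have lengths bounded away from `0`, so a short interval can
only occur at a deep level. -/
lemma Vanishes.exists_small {k : ℕ} {D : ℕ → ℕ → ℝ} (hD : G.Vanishes k D) {η : ℝ} (hη : 0 < η) :
    ∃ δ > 0, ∀ n i j, i + k < G.N n → j < G.N n → G.p n j < δ → |D n i| ≤ η := by
  obtain ⟨n₀, hn⟩ := hD η hη
  obtain ⟨δ, hδ, hp⟩ := G.exists_lower_bound_p n₀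
  refine ⟨δ, hδ, fun n i j hi hj hlt => ?_⟩
  refine hn n ?_ i hi
  by_contra hc
  exact absurd (hp n (not_le.1 hc) j hj) (not_le.2 hlt)

section Transfer

variable {Γ : Grid B M a b} {e : ℕ → ℕ → ℕ}

/-- `e` matches the increasing listing `O` with the numbering of the grid `Γ`. -/
def Matches (O : OGrid B M a b) (Γ : Grid B M a b) (e : ℕ → ℕ → ℕ) : Prop :=
  (∀ n, O.N n = Γ.Ω (n + 1)) ∧
    (∀ n, ∀ i < O.N n, 1 ≤ e n i ∧ e n i ≤ O.N n ∧
      Γ.left (n + 1) (e n i) = O.X n i ∧ Γ.right (n + 1) (e n i) = O.X n (i + 1)) ∧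
    ∀ n, (∀ i, e n i = i + 1) ∨ (∀ i, e n i = O.N n - i)

lemma Matches.len (hO : G.Matches Γ e) {n i : ℕ} (hi : i < G.N n) :
    Γ.len (n + 1) (e n i) = G.p n i := by
  obtain ⟨-, -, h3, h4⟩ := hO.2.1 n i hi
  simp only [Grid.len, p, h3, h4]

lemma Matches.imageLen (hO : G.Matches Γ e) (hm : StrictMonoOn h (Icc a b)) {n i : ℕ}
    (hi : i < G.N n) : Γ.imageLen h (n + 1) (e n i) = h (G.X n (i + 1)) - h (G.X n i) := by
  obtain ⟨-, -, h3, h4⟩ := hO.2.1 n i hi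
  have := hm (G.X_mem hi.le) (G.X_mem hi) (G.X_lt n i hi)
  simp only [Grid.imageLen, h3, h4]
  exact abs_of_pos (by linarith)

lemma slope_pos (hm : StrictMonoOn h (Icc a b)) {x y : ℝ} (hx : x ∈ Icc a b) (hy : y ∈ Icc a b)
    (hxy : x < y) : 0 < (h y - h x) / (y - x) :=
  div_pos (sub_pos.2 (hm hx hy hxy)) (sub_pos.2 hxy)

lemma ratio_log_eq (hm : StrictMonoOn h (Icc a b)) {x y z : ℝ} (hx : x ∈ Icc a b)
    (hy : y ∈ Icc a b) (hz : z ∈ Icc a b) (hxy : x < y) (hyz : y < z) :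
    Real.log ((y - x) / (z - y) * ((h z - h y) / (h y - h x))) =
      logSlope h y z - logSlope h x y := by
  have i1 := hm hx hy hxy
  have i2 := hm hy hz hyz
  unfold logSlope
  rw [← Real.log_div (slope_pos hm hy hz hyz).ne' (slope_pos hm hx hy hxy).ne']
  congr 1
  have : y - x ≠ 0 := by linarith
  have : z - y ≠ 0 := by linarith
  have : h y - h x ≠ 0 := by linarith
  field_simp

lemma Matches.lrd_up (hO : G.Matches Γ e) (hm : StrictMonoOn h (Icc a b)) {n i : ℕ}
    (hi : i + 1 < G.N n) :
    Real.log (Γ.len (n + 1) (e n i) / Γ.len (n + 1) (e n (i + 1)) *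
      (Γ.imageLen h (n + 1) (e n (i + 1)) / Γ.imageLen h (n + 1) (e n i))) = G.r h n i := by
  rw [hO.len hi, hO.len (by omega), hO.imageLen hm hi, hO.imageLen hm (by omega)]
  exact ratio_log_eq hm (G.X_mem (by omega)) (G.X_mem (by omega)) (G.X_mem hi)
    (G.X_lt n i (by omega)) (G.X_lt n (i + 1) hi)

/-- If the grid is numbered from right to left, the quotient inside `lrd` is inverted and the
reference length is that of the right-hand interval. Hence the absolute values and the alternative
for the length. -/
lemma Matches.abs_lrd (hO : G.Matches Γ e) (hm : StrictMonoOn h (Icc a b)) {n i : ℕ}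
    (hi : i + 1 < G.N n) : ∃ β, 1 ≤ β ∧ β + 1 ≤ Γ.Ω (n + 1) ∧ |Γ.lrd h (n + 1) β| = |G.r h n i| ∧
      (Γ.len (n + 1) β = G.p n i ∨ Γ.len (n + 1) β = G.p n (i + 1)) := by
  have hup := hO.lrd_up hm hi
  have hN := hO.1 n
  rcases hO.2.2 n with he | he
  · refine ⟨e n i, by rw [he]; omega, by rw [he]; omega, ?_, .inl (hO.len (by omega))⟩
    have e1 : e n i + 1 = e n (i + 1) := by rw [he, he]
    simp only [Grid.lrd, e1]
    rw [hup]
  · refine ⟨e n (i + 1), by rw [he]; omega, by rw [he]; omega, ?_, .inr (hO.len (by omega))⟩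
    have e1 : e n (i + 1) + 1 = e n i := by rw [he, he]; omega
    simp only [Grid.lrd, e1]
    rw [← hup, ← abs_neg, ← Real.log_inv]
    congr 2
    rw [mul_inv, inv_div, inv_div]

lemma Matches.abs_lrd' (hO : G.Matches Γ e) (hm : StrictMonoOn h (Icc a b)) {n β : ℕ}
    (hn : 1 ≤ n) (hβ : 1 ≤ β) (hβ' : β + 1 ≤ Γ.Ω n) :
    ∃ m i, i + 1 < G.N m ∧ |Γ.lrd h n β| = |G.r h m i| ∧
      (Γ.len n β = G.p m i ∨ Γ.len n β = G.p m (i + 1)) := by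
  obtain ⟨n, rfl⟩ : ∃ m, n = m + 1 := ⟨n - 1, by omega⟩
  have hN := hO.1 n
  obtain ⟨i, hi, hiβ⟩ : ∃ i, i + 1 < G.N n ∧ ((∀ i, e n i = i + 1) ∧ β = i + 1 ∨
      (∀ i, e n i = G.N n - i) ∧ β = G.N n - (i + 1)) := by
    rcases hO.2.2 n with he | he
    · exact ⟨β - 1, by omega, .inl ⟨he, by omega⟩⟩
    · exact ⟨G.N n - (β + 1), by omega, .inr ⟨he, by omega⟩⟩
  refine ⟨n, i, hi, ?_⟩
  have hup := hO.lrd_up hm hi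
  rcases hiβ with ⟨he, hβe⟩ | ⟨he, hβe⟩
  · have e0 : β = e n i := by rw [he, hβe]
    have e1 : β + 1 = e n (i + 1) := by rw [he, hβe]
    refine ⟨?_, .inl (by rw [e0]; exact hO.len (by omega))⟩
    simp only [Grid.lrd, e1]
    rw [e0, hup]
  · have e0 : β = e n (i + 1) := by rw [he, hβe]
    have e1 : β + 1 = e n i := by rw [he]; omega
    refine ⟨?_, .inr (by rw [e0]; exact hO.len (by omega))⟩
    simp only [Grid.lrd, e1]
    rw [e0, ← hup, ← abs_neg, ← Real.log_inv]
    congr 2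
    rw [mul_inv, inv_div, inv_div]

/-- By this symmetry `crd` does not depend on the direction of the numbering. -/
lemma crossRatio_symm (p q s : ℝ) : crossRatio p q s = crossRatio s q p := by
  unfold crossRatio
  congr 2
  rw [div_mul_div_comm, div_mul_div_comm, mul_comm p s]
  congr 2; ring

lemma Matches.crd_up (hO : G.Matches Γ e) (hm : StrictMonoOn h (Icc a b)) {n i : ℕ}
    (hi : i + 2 < G.N n) :
    crossRatio (Γ.imageLen h (n + 1) (e n i)) (Γ.imageLen h (n + 1) (e n (i + 1)))
        (Γ.imageLen h (n + 1) (e n (i + 2))) -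
      crossRatio (Γ.len (n + 1) (e n i)) (Γ.len (n + 1) (e n (i + 1)))
        (Γ.len (n + 1) (e n (i + 2))) = G.cd h n i := by
  rw [hO.len (i := i) (by omega), hO.len (i := i + 1) (by omega), hO.len hi,
    hO.imageLen hm (i := i) (by omega), hO.imageLen hm (i := i + 1) (by omega), hO.imageLen hm hi]
  exact crossDist_eq hm (G.X_mem (by omega)) (G.X_mem (by omega)) (G.X_mem (by omega))
    (G.X_mem hi) (G.X_lt n i (by omega)) (G.X_lt n (i + 1) (by omega)) (G.X_lt n (i + 2) hi)

lemma Matches.crd_eq (hO : G.Matches Γ e) (hm : StrictMonoOn h (Icc a b)) {n i : ℕ}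
    (hi : i + 2 < G.N n) : ∃ β, 1 ≤ β ∧ β + 2 ≤ Γ.Ω (n + 1) ∧ Γ.crd h (n + 1) β = G.cd h n i ∧
      (Γ.len (n + 1) β = G.p n i ∨ Γ.len (n + 1) β = G.p n (i + 2)) := by
  have hup := hO.crd_up hm hi
  have hN := hO.1 n
  rcases hO.2.2 n with he | he
  · refine ⟨e n i, by rw [he]; omega, by rw [he]; omega, ?_, .inl (hO.len (by omega))⟩
    have e1 : e n i + 1 = e n (i + 1) := by rw [he, he]
    have e2 : e n i + 2 = e n (i + 2) := by rw [he, he]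
    simp only [Grid.crd, e1, e2]
    rw [hup]
  · refine ⟨e n (i + 2), by rw [he]; omega, by rw [he]; omega, ?_, .inr (hO.len (by omega))⟩
    have e1 : e n (i + 2) + 1 = e n (i + 1) := by rw [he, he]; omega
    have e2 : e n (i + 2) + 2 = e n i := by rw [he, he]; omega
    simp only [Grid.crd, e1, e2]
    rw [← hup, crossRatio_symm, crossRatio_symm (Γ.len _ _)]

lemma Matches.crd_eq' (hO : G.Matches Γ e) (hm : StrictMonoOn h (Icc a b)) {n β : ℕ}
    (hn : 1 ≤ n) (hβ : 1 ≤ β) (hβ' : β + 2 ≤ Γ.Ω n) :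
    ∃ m i, i + 2 < G.N m ∧ Γ.crd h n β = G.cd h m i ∧
      (Γ.len n β = G.p m i ∨ Γ.len n β = G.p m (i + 2)) := by
  obtain ⟨n, rfl⟩ : ∃ m, n = m + 1 := ⟨n - 1, by omega⟩
  have hN := hO.1 n
  obtain ⟨i, hi, hiβ⟩ : ∃ i, i + 2 < G.N n ∧ ((∀ i, e n i = i + 1) ∧ β = i + 1 ∨
      (∀ i, e n i = G.N n - i) ∧ β = G.N n - (i + 2)) := by
    rcases hO.2.2 n with he | he
    · exact ⟨β - 1, by omega, .inl ⟨he, by omega⟩⟩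
    · exact ⟨G.N n - (β + 2), by omega, .inr ⟨he, by omega⟩⟩
  refine ⟨n, i, hi, ?_⟩
  have hup := hO.crd_up hm hi
  rcases hiβ with ⟨he, hβe⟩ | ⟨he, hβe⟩
  · have e0 : β = e n i := by rw [he, hβe]
    have e1 : β + 1 = e n (i + 1) := by rw [he, hβe]
    have e2 : β + 2 = e n (i + 2) := by rw [he, hβe]
    refine ⟨?_, .inl (by rw [e0]; exact hO.len (by omega))⟩
    simp only [Grid.crd, e1, e2]
    rw [e0, hup]
  · have e0 : β = e n (i + 2) := by rw [he, hβe]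
    have e1 : β + 1 = e n (i + 1) := by rw [he]; omega
    have e2 : β + 2 = e n i := by rw [he]; omega
    refine ⟨?_, .inr (by rw [e0]; exact hO.len (by omega))⟩
    simp only [Grid.crd, e1, e2]
    rw [e0, ← hup, crossRatio_symm, crossRatio_symm (Γ.len _ _)]

/-- Functions of the length that change by a bounded factor between comparable lengths. -/
def Doubling (B : ℝ) (φ : ℝ → ℝ) : Prop :=
  (∀ t, 0 < t → 0 ≤ φ t) ∧ ∃ K, 0 ≤ K ∧ ∀ s t, 0 < s → 0 < t → s ≤ B ^ 2 * t → φ s ≤ K * φ t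

lemma doubling_rpow (hB : 1 ≤ B) {α : ℝ} (hα : 0 ≤ α) : Doubling B (fun t => t ^ α) := by
  refine ⟨fun t ht => Real.rpow_nonneg ht.le _, (B ^ 2) ^ α, by positivity, ?_⟩
  intro s t hs ht hst
  rw [← Real.mul_rpow (by positivity) ht.le]
  exact Real.rpow_le_rpow hs.le hst hα

lemma bigO_transfer {φ : ℝ → ℝ} (hφ : Doubling B φ) {s t C x : ℝ} (hs : 0 < s)
    (ht : 0 < t) (hts : s ≤ B ^ 2 * t) (hC : 0 ≤ C) (hx : |x| ≤ C * |φ s|) :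
    |x| ≤ C * Classical.choose hφ.2 * φ t := by
  obtain ⟨h0, h1⟩ := Classical.choose_spec hφ.2
  rw [abs_of_nonneg (hφ.1 s hs)] at hx
  rw [mul_assoc]
  exact hx.trans (mul_le_mul_of_nonneg_left (h1 s t hs ht hts) hC)

/-- Reversing the numbering of a triple exchanges its first and third interval, whose lengths
compare with the factor `B ^ 2`. This is the factor in `Doubling`. -/
lemma p_le_sq_mul {n i j : ℕ} (hi : i < G.N n) (hj : j < G.N n) (h1 : i ≤ j + 2) (h2 : j ≤ i + 2) :
    G.p n i ≤ B ^ 2 * G.p n j := G.p_le_pow hi hj h1 h2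

lemma Matches.lrdBigO_iff (hO : G.Matches Γ e) (hm : StrictMonoOn h (Icc a b)) {φ : ℝ → ℝ}
    (hφ : Doubling B φ) : Γ.LrdBigO h φ ↔
      ∃ C, 0 ≤ C ∧ ∀ n i, i + 1 < G.N n → |G.r h n i| ≤ C * φ (G.p n i) := by
  have hK := (Classical.choose_spec hφ.2).1
  constructor
  · rintro ⟨C, hC, H⟩
    refine ⟨C * Classical.choose hφ.2, by positivity, fun n i hi => ?_⟩
    obtain ⟨β, b1, b2, b3, b4⟩ := hO.abs_lrd hm hi
    have := H (n + 1) β (by omega) b1 b2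
    rw [b3] at this
    refine bigO_transfer hφ (s := Γ.len (n + 1) β) ?_ (G.p_pos (by omega)) ?_
      (by linarith) this
    · rcases b4 with b4 | b4 <;> rw [b4] <;> exact G.p_pos (by omega)
    · rcases b4 with b4 | b4 <;> rw [b4] <;>
        exact p_le_sq_mul (by omega) (by omega) (by omega) (by omega)
  · rintro ⟨C, hC, H⟩
    -- The summand `1` is there because `LrdBigO` asks for a constant at least `1`.
    refine ⟨C * Classical.choose hφ.2 + 1, by nlinarith, fun n β hn h1 h2 => ?_⟩
    obtain ⟨m, i, hi, e1, e2⟩ := hO.abs_lrd' hm hn h1 h2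
    have hlen : 0 < Γ.len n β ∧ G.p m i ≤ B ^ 2 * Γ.len n β := by
      rcases e2 with e2 | e2 <;> rw [e2] <;>
        exact ⟨G.p_pos (by omega), p_le_sq_mul (by omega) (by omega) (by omega) (by omega)⟩
    have hp : 0 < G.p m i := G.p_pos (by omega)
    have := H m i hi
    rw [e1, abs_of_nonneg (hφ.1 _ hlen.1)]
    rw [← abs_of_nonneg (hφ.1 _ hp)] at this
    have h3 := bigO_transfer hφ hp hlen.1 hlen.2 hC this
    have := hφ.1 _ hlen.1
    linarith

lemma Matches.crdBigO_iff (hO : G.Matches Γ e) (hm : StrictMonoOn h (Icc a b)) {φ : ℝ → ℝ}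
    (hφ : Doubling B φ) : Γ.CrdBigO h φ ↔
      ∃ C, 0 ≤ C ∧ ∀ n i, i + 2 < G.N n → |G.cd h n i| ≤ C * φ (G.p n i) := by
  have hK := (Classical.choose_spec hφ.2).1
  constructor
  · rintro ⟨C, hC, H⟩
    refine ⟨C * Classical.choose hφ.2, by positivity, fun n i hi => ?_⟩
    obtain ⟨β, b1, b2, b3, b4⟩ := hO.crd_eq hm hi
    have := H (n + 1) β (by omega) b1 b2
    rw [b3] at this
    refine bigO_transfer hφ (s := Γ.len (n + 1) β) ?_ (G.p_pos (by omega)) ?_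
      (by linarith) this
    · rcases b4 with b4 | b4 <;> rw [b4] <;> exact G.p_pos (by omega)
    · rcases b4 with b4 | b4 <;> rw [b4] <;>
        exact p_le_sq_mul (by omega) (by omega) (by omega) (by omega)
  · rintro ⟨C, hC, H⟩
    refine ⟨C * Classical.choose hφ.2 + 1, by nlinarith, fun n β hn h1 h2 => ?_⟩
    obtain ⟨m, i, hi, e1, e2⟩ := hO.crd_eq' hm hn h1 h2
    have hlen : 0 < Γ.len n β ∧ G.p m i ≤ B ^ 2 * Γ.len n β := by
      rcases e2 with e2 | e2 <;> rw [e2] <;>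
        exact ⟨G.p_pos (by omega), p_le_sq_mul (by omega) (by omega) (by omega) (by omega)⟩
    have hp : 0 < G.p m i := G.p_pos (by omega)
    have := H m i hi
    rw [e1, abs_of_nonneg (hφ.1 _ hlen.1)]
    rw [← abs_of_nonneg (hφ.1 _ hp)] at this
    have h3 := bigO_transfer hφ hp hlen.1 hlen.2 hC this
    have := hφ.1 _ hlen.1
    linarith

/-- A family of distortions is bounded by a modulus of the lengths if and only if it tends to `0`
uniformly. -/
lemma modulus_iff_vanishes {k : ℕ} {D : ℕ → ℕ → ℝ} {E : ℕ → ℕ → ℝ} {len : ℕ → ℕ → ℝ}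
    {P : ℕ → ℕ → Prop}
    (h1 : ∀ n i, i + k < G.N n → ∃ m β, P m β ∧ |E m β| = |D n i| ∧
      ∃ j < G.N n, len m β = G.p n j)
    (h2 : ∀ m β, P m β → ∃ n i, i + k < G.N n ∧ |E m β| = |D n i| ∧
      ∃ j < G.N n, len m β = G.p n j) :
    (∃ ε, IsModulus ε ∧ ∀ m β, P m β → |E m β| ≤ ε (len m β) * len m β * (len m β)⁻¹) ↔
      G.Vanishes k D := by
  have hlen : ∀ m β, P m β → 0 < len m β := by
    intro m β hP
    obtain ⟨n, i, hi, -, j, hj, e2⟩ := h2 m β hP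
    rw [e2]; exact G.p_pos hj
  constructor
  · rintro ⟨ε, hε, H⟩ η hη
    obtain ⟨δ, hδ, hs⟩ := hε.exists_small hη
    obtain ⟨n₀, hn⟩ := G.exists_mesh_lt hδ
    refine ⟨n₀, fun n hn0 i hi => ?_⟩
    obtain ⟨m, β, hP, e1, j, hj, e2⟩ := h1 n i hi
    have h3 := H m β hP
    have h4 := hlen m β hP
    rw [mul_inv_cancel_right₀ h4.ne', e1] at h3
    exact h3.trans (hs _ h4.le (by rw [e2]; exact hn n hn0 j hj))
  · intro hV
    obtain ⟨K, -, hK⟩ := hV.exists_bound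
    obtain ⟨ε, hε, H⟩ := exists_modulus (ι := {q : ℕ × ℕ // P q.1 q.2})
      (t := fun q => len q.1.1 q.1.2) (D := fun q => E q.1.1 q.1.2) (K := K)
      (fun q => hlen _ _ q.2)
      (fun q => by obtain ⟨n, i, hi, e1, -⟩ := h2 _ _ q.2; rw [e1]; exact hK n i hi)
      (fun η hη => by
        obtain ⟨δ, hδ, hs⟩ := hV.exists_small hη
        refine ⟨δ, hδ, fun q hq => ?_⟩
        obtain ⟨n, i, hi, e1, j, hj, e2⟩ := h2 _ _ q.2
        rw [e1]; exact hs n i j hi hj (by rw [← e2]; exact hq))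
    refine ⟨ε, hε, fun m β hP => ?_⟩
    rw [mul_inv_cancel_right₀ (hlen m β hP).ne']
    exact H ⟨(m, β), hP⟩

lemma Matches.lrdLittleODiv_iff (hO : G.Matches Γ e) (hm : StrictMonoOn h (Icc a b)) :
    Γ.LrdLittleODiv h ↔ G.Vanishes 1 (G.r h) := by
  rw [← modulus_iff_vanishes (G := G) (D := G.r h) (E := Γ.lrd h) (len := Γ.len) (k := 1)
    (P := fun n β => 1 ≤ n ∧ 1 ≤ β ∧ β + 1 ≤ Γ.Ω n)]
  · simp only [Grid.LrdLittleODiv, and_imp]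
  · intro n i hi
    obtain ⟨β, b1, b2, b3, b4⟩ := hO.abs_lrd hm hi
    refine ⟨n + 1, β, ⟨by omega, b1, b2⟩, b3, ?_⟩
    rcases b4 with b4 | b4
    exacts [⟨i, by omega, b4⟩, ⟨i + 1, by omega, b4⟩]
  · rintro m β ⟨q1, q2, q3⟩
    obtain ⟨n, i, hi, b3, b4⟩ := hO.abs_lrd' hm q1 q2 q3
    refine ⟨n, i, hi, b3, ?_⟩
    rcases b4 with b4 | b4
    exacts [⟨i, by omega, b4⟩, ⟨i + 1, by omega, b4⟩]

lemma Matches.crdLittleODiv_iff (hO : G.Matches Γ e) (hm : StrictMonoOn h (Icc a b)) :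
    Γ.CrdLittleODiv h ↔ G.Vanishes 2 (G.cd h) := by
  rw [← modulus_iff_vanishes (G := G) (D := G.cd h) (E := Γ.crd h) (len := Γ.len) (k := 2)
    (P := fun n β => 1 ≤ n ∧ 1 ≤ β ∧ β + 2 ≤ Γ.Ω n)]
  · simp only [Grid.CrdLittleODiv, and_imp]
  · intro n i hi
    obtain ⟨β, b1, b2, b3, b4⟩ := hO.crd_eq hm hi
    refine ⟨n + 1, β, ⟨by omega, b1, b2⟩, by rw [b3], ?_⟩
    rcases b4 with b4 | b4
    exacts [⟨i, by omega, b4⟩, ⟨i + 2, by omega, b4⟩]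
  · rintro m β ⟨q1, q2, q3⟩
    obtain ⟨n, i, hi, b3, b4⟩ := hO.crd_eq' hm q1 q2 q3
    refine ⟨n, i, hi, by rw [b3], ?_⟩
    rcases b4 with b4 | b4
    exacts [⟨i, by omega, b4⟩, ⟨i + 2, by omega, b4⟩]

/-- The ratio distortions are `o` of the lengths. -/
lemma Matches.small_of_lrdLittleO (hO : G.Matches Γ e) (hm : StrictMonoOn h (Icc a b))
    (H : Γ.LrdLittleO h) : ∀ η > 0, ∃ n₀, ∀ n ≥ n₀, ∀ i, i + 1 < G.N n →
      |G.r h n i| ≤ η * (G.p n i + G.p n (i + 1)) := by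
  obtain ⟨ε, hε, H⟩ := H
  intro η hη
  obtain ⟨δ, hδ, hs⟩ := hε.exists_small hη
  obtain ⟨n₀, hn⟩ := G.exists_mesh_lt hδ
  refine ⟨n₀, fun n hn0 i hi => ?_⟩
  obtain ⟨β, b1, b2, b3, b4⟩ := hO.abs_lrd hm hi
  have h3 := H (n + 1) β (by omega) b1 b2
  rw [b3] at h3
  have p1 := G.p_pos (n := n) (i := i) (by omega)
  have p2 := G.p_pos hi
  refine h3.trans ?_
  rcases b4 with b4 | b4 <;> rw [b4]
  · exact mul_le_mul (hs _ p1.le (hn n hn0 i (by omega))) (by linarith) p1.le hη.le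
  · exact mul_le_mul (hs _ p2.le (hn n hn0 _ hi)) (by linarith) p2.le hη.le

end Transfer

end OGrid

end GridSmoothness

/-! ### Ratio distortions: quasisymmetric, (uaa) and affine maps, Hölder limits. -/

namespace GridSmoothness

variable {B : ℝ} {M : ℕ} {a b : ℝ} {h : ℝ → ℝ}

lemma increment_bounds_endpoints {x : ℕ → ℝ} {N : ℕ} {lo hi : ℝ}
    (hb : ∀ i < N, lo * (x (i + 1) - x i) ≤ h (x (i + 1)) - h (x i) ∧
      h (x (i + 1)) - h (x i) ≤ hi * (x (i + 1) - x i)) {i j : ℕ} (hij : i ≤ j) (hj : j ≤ N) :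
    lo * (x j - x i) ≤ h (x j) - h (x i) ∧ h (x j) - h (x i) ≤ hi * (x j - x i) := by
  induction j, hij using Nat.le_induction with
  | base => simp
  | succ j hij ih =>
    have h1 := ih (by omega)
    have h2 := hb j (by omega)
    constructor <;> linarith [h1.1, h1.2, h2.1, h2.2]

/-- If `h` is monotone and its slopes over the steps of a sequence lie between `lo` and `hi`, then
its increments over arbitrary intervals obey these bounds up to the step size. -/
lemma increment_bounds {x : ℕ → ℝ} {N : ℕ} (hN : 0 < N) (hx : ∀ i < N, x i < x (i + 1))
    (hmono : MonotoneOn h (Icc (x 0) (x N))) {lo hi μ : ℝ} (hlo : 0 ≤ lo)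
    (hb : ∀ i < N, lo * (x (i + 1) - x i) ≤ h (x (i + 1)) - h (x i) ∧
      h (x (i + 1)) - h (x i) ≤ hi * (x (i + 1) - x i)) (hμ : ∀ i < N, x (i + 1) - x i ≤ μ)
    {z w : ℝ} (hz : x 0 ≤ z) (hzw : z ≤ w) (hw : w ≤ x N) :
    lo * (w - z - 2 * μ) ≤ h w - h z ∧ h w - h z ≤ hi * (w - z + 2 * μ) := by
  have hmem : ∀ i ≤ N, x i ∈ Icc (x 0) (x N) := fun i hi =>
    ⟨le_of_lt_step hx (Nat.zero_le i) hi, le_of_lt_step hx hi le_rfl⟩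
  have hzm : z ∈ Icc (x 0) (x N) := ⟨hz, by linarith⟩
  have hwm : w ∈ Icc (x 0) (x N) := ⟨by linarith, hw⟩
  have hhi : 0 ≤ hi := by
    have h1 := hmono (hmem 0 (by omega)) (hmem 1 hN) (hx 0 hN).le
    have h2 := (hb 0 hN).2
    have h3 := hx 0 hN
    simp only [zero_add] at h2 h3
    by_contra hc
    nlinarith
  obtain ⟨u, hu, hu1, hu2⟩ := exists_mem_step hN hzm.1 hzm.2
  obtain ⟨v, hv, hv1, hv2⟩ := exists_mem_step hN hwm.1 hwm.2
  have mu := hμ u hu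
  have mv := hμ v hv
  constructor
  · by_cases huv : u + 1 ≤ v
    · have h1 := (increment_bounds_endpoints hb huv hv.le).1
      have h2 := hmono hzm (hmem (u + 1) hu) hu2
      have h3 := hmono (hmem v hv.le) hwm hv1
      have h4 : lo * (w - z - 2 * μ) ≤ lo * (x v - x (u + 1)) :=
        mul_le_mul_of_nonneg_left (by linarith) hlo
      linarith
    · have h1 := le_of_lt_step hx (i := v) (j := u) (by omega) hu.le
      have h2 := le_of_lt_step hx (i := v + 1) (j := u + 1) (by omega) hu
      have h3 := hmono hzm hwm hzw
      have h4 : w - z ≤ μ := by linarith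
      have h5 : 0 ≤ μ := by linarith
      have h6 : lo * (w - z - 2 * μ) ≤ 0 := mul_nonpos_of_nonneg_of_nonpos hlo (by linarith)
      linarith
  · have huv : u ≤ v + 1 := by
      by_contra hc
      have := lt_of_lt_step hx (i := v + 1) (j := u) (by omega) hu.le
      linarith
    have h1 := (increment_bounds_endpoints hb huv hv).2
    have h2 := hmono (hmem u hu.le) hzm hu1
    have h3 := hmono hwm (hmem (v + 1) hv) hv2
    have h4 : hi * (x (v + 1) - x u) ≤ hi * (w - z + 2 * μ) :=
        mul_le_mul_of_nonneg_left (by linarith) hhi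
    linarith

lemma increment_of_logSlope {S : Set ℝ} (hm : StrictMonoOn h S) {x y : ℝ} (hx : x ∈ S)
    (hy : y ∈ S) (hxy : x < y) {L E : ℝ} (hE : |logSlope h x y - L| ≤ E) :
    Real.exp (L - E) * (y - x) ≤ h y - h x ∧ h y - h x ≤ Real.exp (L + E) * (y - x) := by
  have h0 : 0 < (h y - h x) / (y - x) := div_pos (sub_pos.2 (hm hx hy hxy)) (sub_pos.2 hxy)
  have h1 : Real.exp (logSlope h x y) * (y - x) = h y - h x := by
    unfold logSlope
    rw [Real.exp_log h0, div_mul_cancel₀]; linarith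
  rw [← h1]
  have := abs_le.1 hE
  constructor
  · exact mul_le_mul_of_nonneg_right (Real.exp_le_exp.2 (by linarith)) (by linarith)
  · exact mul_le_mul_of_nonneg_right (Real.exp_le_exp.2 (by linarith)) (by linarith)

lemma logSlope_of_increment {x y : ℝ} (hxy : x < y) {lo hi : ℝ} (hlo : 0 < lo)
    (h1 : lo * (y - x) ≤ h y - h x) (h2 : h y - h x ≤ hi * (y - x)) :
    Real.log lo ≤ logSlope h x y ∧ logSlope h x y ≤ Real.log hi := by
  have hxy' : 0 < y - x := by linarith
  have h3 : lo ≤ (h y - h x) / (y - x) := (le_div_iff₀ hxy').2 h1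
  have h4 : (h y - h x) / (y - x) ≤ hi := (div_le_iff₀ hxy').2 h2
  exact ⟨Real.log_le_log hlo h3, Real.log_le_log (hlo.trans_le h3) h4⟩

/-- The average slope over a chain of intervals lies between the slopes over its members. -/
lemma abs_logSlope_chain_sub_le {x : ℕ → ℝ} {S : Set ℝ} (hm : StrictMonoOn h S) {i j : ℕ}
    (hij : i < j) (hx : ∀ t, i ≤ t → t < j → x t < x (t + 1)) (hS : ∀ t, i ≤ t → t ≤ j → x t ∈ S)
    {L E : ℝ} (hE : ∀ t, i ≤ t → t < j → |logSlope h (x t) (x (t + 1)) - L| ≤ E) :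
    |logSlope h (x i) (x j) - L| ≤ E := by
  have hb := increment_bounds_endpoints (h := h) (x := fun t => x (i + t)) (N := j - i)
    (lo := Real.exp (L - E)) (hi := Real.exp (L + E)) (fun t ht =>
      increment_of_logSlope hm (hS _ (by omega) (by omega)) (hS _ (by omega) (by omega))
        (hx (i + t) (by omega) (by omega)) (hE (i + t) (by omega) (by omega)))
    (Nat.zero_le (j - i)) le_rfl
  have hlt : x i < x j := by
    have := lt_of_lt_step (x := fun t => x (i + t)) (N := j - i)
      (fun t ht => hx (i + t) (by omega) (by omega)) (i := 0) (j := j - i) (by omega) le_rfl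
    simpa [Nat.add_sub_cancel' hij.le] using this
  simp only [Nat.add_sub_cancel' hij.le, add_zero] at hb
  have := logSlope_of_increment hlt (Real.exp_pos _) hb.1 hb.2
  rw [Real.log_exp, Real.log_exp] at this
  rw [abs_le]; constructor <;> linarith [this.1, this.2]

lemma log_ratio_eq {S : Set ℝ} (hm : StrictMonoOn h S) {x δ₁ δ₂ : ℝ} (h1 : 0 < δ₁) (h2 : 0 < δ₂)
    (m1 : x - δ₁ ∈ S) (m2 : x ∈ S) (m3 : x + δ₂ ∈ S) :
    Real.log ((h (x + δ₂) - h x) / (h x - h (x - δ₁)) * (δ₁ / δ₂)) =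
      logSlope h x (x + δ₂) - logSlope h (x - δ₁) x := by
  have i1 := hm m1 m2 (by linarith)
  have i2 := hm m2 m3 (by linarith)
  unfold logSlope
  have e1 : x + δ₂ - x = δ₂ := by ring
  have e2 : x - (x - δ₁) = δ₁ := by ring
  rw [e1, e2, ← Real.log_div (div_pos (by linarith) h2).ne' (div_pos (by linarith) h1).ne']
  congr 1
  have : h x - h (x - δ₁) ≠ 0 := by linarith
  field_simp

namespace OGrid

variable {G : OGrid B M a b}

lemma abs_ls_sub_le {n i k : ℕ} {ρ : ℝ} (hr : ∀ t, i ≤ t → t < k → |G.r h n t| ≤ ρ) {t : ℕ}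
    (h1 : i ≤ t) (h2 : t ≤ k) : |G.ls h n t - G.ls h n i| ≤ (t - i : ℕ) * ρ := by
  induction t, h1 using Nat.le_induction with
  | base => simp
  | succ t ht ih =>
    have h3 := ih (by omega)
    have h4 := hr t ht (by omega)
    rw [Nat.succ_sub ht]
    push_cast
    have : G.ls h n (t + 1) - G.ls h n i = G.r h n t + (G.ls h n t - G.ls h n i) := by
      unfold r; ring
    rw [this]
    refine (abs_add_le _ _).trans ?_
    linarith

/-- By monotonicity, replacing `[z, w]` by a union of grid intervals changes the length by at most
`2 * η * (w - z)`. So the slope is distorted by factors between `1 - 2 * η` and `1 + 2 * η`, and the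
latter is at most `(1 - 2 * η)⁻¹`. -/
lemma logSlope_sub_le (hm : StrictMonoOn h (Icc a b)) {n i k : ℕ} (hik : i ≤ k) (hk : k < G.N n)
    {L E η z w : ℝ} (hE : ∀ t, i ≤ t → t ≤ k → |G.ls h n t - L| ≤ E) (hη' : η < 1 / 2)
    (hz : G.X n i ≤ z) (hzw : z < w) (hw : w ≤ G.X n (k + 1))
    (hp : ∀ t, i ≤ t → t ≤ k → G.p n t ≤ η * (w - z)) :
    |logSlope h z w - L| ≤ E - Real.log (1 - 2 * η) := by
  have hη : 0 ≤ η := by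
    have h1 := hp i le_rfl hik
    have h2 := G.p_pos (n := n) (i := i) (by omega)
    by_contra hc
    nlinarith
  have hx : ∀ t < k + 1 - i, G.X n (i + t) < G.X n (i + t + 1) := fun t ht => G.X_lt n _ (by omega)
  have e : i + (k + 1 - i) = k + 1 := by omega
  have hsub : Icc (G.X n i) (G.X n (k + 1)) ⊆ Icc a b :=
    Icc_subset_Icc (G.X_mem (by omega)).1 (G.X_mem hk).2
  obtain ⟨h1, h2⟩ := increment_bounds (h := h) (x := fun t => G.X n (i + t)) (N := k + 1 - i)
    (lo := Real.exp (L - E)) (hi := Real.exp (L + E)) (μ := η * (w - z)) (z := z) (w := w)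
    (by omega) hx (by simp only [e, add_zero]; exact hm.monotoneOn.mono hsub)
    (Real.exp_pos _).le (fun t ht =>
      increment_of_logSlope hm (G.X_mem (by omega)) (G.X_mem (by omega)) (hx t ht)
        (hE (i + t) (by omega) (by omega)))
    (fun t ht => hp (i + t) (by omega) (by omega)) hz hzw.le (by simp only [e]; exact hw)
  have h3 := logSlope_of_increment (lo := Real.exp (L - E) * (1 - 2 * η))
    (hi := Real.exp (L + E) * (1 + 2 * η)) hzw (mul_pos (Real.exp_pos _) (by linarith))
    (by linarith) (by linarith)
  rw [Real.log_mul (Real.exp_pos _).ne' (by linarith), Real.log_exp,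
    Real.log_mul (Real.exp_pos _).ne' (by linarith), Real.log_exp] at h3
  have h4 : Real.log (1 + 2 * η) ≤ - Real.log (1 - 2 * η) := by
    rw [← Real.log_inv]
    refine Real.log_le_log (by linarith) ?_
    rw [le_inv_comm₀ (by linarith) (by linarith), inv_eq_one_div, le_div_iff₀ (by linarith)]
    nlinarith
  rw [abs_le]; constructor <;> linarith [h3.1, h3.2]

/-- The distortion of two adjacent intervals is controlled by the ratio distortions of the grid
intervals which meet them. -/
lemma exists_distortion_bound (G : OGrid B M a b) (hm : StrictMonoOn h (Icc a b)) {d η : ℝ} (hd : 1 ≤ d) (hη : 0 < η)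
    (hη' : η < 1 / 2) (n₀ : ℕ) : ∃ K : ℕ, ∀ x δ₁ δ₂ : ℝ, 0 < δ₁ → 0 < δ₂ → a ≤ x - δ₁ →
      x + δ₂ ≤ b → d⁻¹ ≤ δ₂ / δ₁ → δ₂ / δ₁ ≤ d → ∃ n ≥ n₀, ∃ i k, k < G.N n ∧
        (∀ t, i ≤ t → t < k → G.X n (t + 1) ∈ Icc (x - δ₁) (x + δ₂)) ∧
        (∀ t, i ≤ t → t ≤ k → G.p n t ≤ η * (δ₁ + δ₂)) ∧
        ∀ ρ, 0 ≤ ρ → (∀ t, i ≤ t → t < k → |G.r h n t| ≤ ρ) →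
          |Real.log ((h (x + δ₂) - h x) / (h x - h (x - δ₁)) * (δ₁ / δ₂))| ≤
            2 * (K * ρ - Real.log (1 - 2 * η)) := by
  obtain ⟨K, hK⟩ := G.exists_fine_cover (η := η / (d + 1)) (by positivity) n₀
  refine ⟨K, ?_⟩
  intro x δ₁ δ₂ h1 h2 ha hb hd1 hd2
  obtain ⟨n, hn, i, k, hik, hkK, hk, c1, c2, c3, c4, c5⟩ := hK (x - δ₁) (x + δ₂) ha (by linarith) hb
  have e0 : x + δ₂ - (x - δ₁) = δ₁ + δ₂ := by ring
  rw [e0] at c5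
  rw [div_le_iff₀ h1] at hd2
  rw [le_div_iff₀ h1, inv_mul_le_iff₀ (by linarith)] at hd1
  have p1 : ∀ t, i ≤ t → t ≤ k → G.p n t ≤ η * δ₁ := fun t q1 q2 => by
    refine (c5 t q1 q2).trans ?_
    rw [div_mul_eq_mul_div, div_le_iff₀ (by linarith)]
    nlinarith
  have p2 : ∀ t, i ≤ t → t ≤ k → G.p n t ≤ η * δ₂ := fun t q1 q2 => by
    refine (c5 t q1 q2).trans ?_
    rw [div_mul_eq_mul_div, div_le_iff₀ (by linarith)]
    nlinarith
  refine ⟨n, hn, i, k, hk, ?_, fun t q1 q2 => (p1 t q1 q2).trans (by nlinarith), ?_⟩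
  · intro t q1 q2
    have g1 := G.X_le_X (n := n) (i := i + 1) (j := t + 1) (by omega) (by omega)
    have g2 := G.X_le_X (n := n) (i := t + 1) (j := k) (by omega) (by omega)
    exact ⟨by linarith, by linarith⟩
  · intro ρ hρ hr
    have hE : ∀ t, i ≤ t → t ≤ k → |G.ls h n t - G.ls h n i| ≤ K * ρ := fun t q1 q2 => by
      refine (abs_ls_sub_le hr q1 q2).trans ?_
      gcongr
      omega
    have l1 := logSlope_sub_le hm hik hk hE hη' (z := x - δ₁) (w := x) c1 (by linarith)
      (by linarith) (fun t q1 q2 => (p1 t q1 q2).trans_eq (by ring))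
    have l2 := logSlope_sub_le hm hik hk hE hη' (z := x) (w := x + δ₂) (by linarith) (by linarith)
      c4 (fun t q1 q2 => (p2 t q1 q2).trans_eq (by ring))
    rw [log_ratio_eq hm h1 h2 ⟨ha, by linarith⟩ ⟨by linarith, by linarith⟩ ⟨by linarith, hb⟩]
    rw [abs_le] at l1 l2 ⊢
    constructor <;> linarith [l1.1, l1.2, l2.1, l2.2]

/-- The bound is required only at deep levels and for pairs whose common endpoint lies in `[u, v]`.
A bound on cross ratio distortions provides no more than that, because it controls the pairs at the
ends of `[a, b]` from one side only. -/
lemma quasisymmetricOn_of_bound (hm : StrictMonoOn h (Icc a b)) {u v : ℝ} (hu : a ≤ u)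
    (hv : v ≤ b) {n₀ : ℕ} {C : ℝ} (hC : 0 ≤ C) (hr : ∀ n ≥ n₀, ∀ t, t + 1 < G.N n →
      G.X n (t + 1) ∈ Icc u v → |G.r h n t| ≤ C) : QuasisymmetricOn h (Icc u v) := by
  intro d hd
  obtain ⟨K, hK⟩ := G.exists_distortion_bound hm hd (η := 1 / 4) (by norm_num) (by norm_num) n₀
  have hl : Real.log (1 - 2 * (1 / 4)) ≤ 0 := Real.log_nonpos (by norm_num) (by norm_num)
  refine ⟨Real.exp (2 * (K * C - Real.log (1 - 2 * (1 / 4)))), ?_, ?_⟩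
  · rw [Real.one_le_exp_iff]
    have : 0 ≤ K * C := by positivity
    linarith
  · intro x δ₁ δ₂ h1 h2 m1 m2 m3 d1 d2
    rw [Real.log_exp]
    obtain ⟨n, hn, i, k, hk, c1, -, c3⟩ := hK x δ₁ δ₂ h1 h2 (hu.trans m1.1) (m3.2.trans hv) d1 d2
    refine c3 C hC fun t q1 q2 => hr n hn t (by omega) ?_
    have := c1 t q1 q2
    exact ⟨m1.1.trans this.1, this.2.trans m3.2⟩

lemma quasisymmetricOn_iff (hm : StrictMonoOn h (Icc a b)) : QuasisymmetricOn h (Icc a b) ↔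
    ∃ C, 0 ≤ C ∧ ∀ n i, i + 1 < G.N n → |G.r h n i| ≤ C := by
  constructor
  · intro hq
    obtain ⟨k, hk, H⟩ := hq B G.one_le
    refine ⟨Real.log k, Real.log_nonneg hk, fun n i hi => ?_⟩
    have p1 := G.p_pos (n := n) (i := i) (by omega)
    have p2 := G.p_pos hi
    have e1 : G.X n (i + 1) - G.p n i = G.X n i := by unfold p; ring
    have e2 : G.X n (i + 1) + G.p n (i + 1) = G.X n (i + 2) := by unfold p; ring_nf
    have m1 : G.X n (i + 1) - G.p n i ∈ Icc a b := by rw [e1]; exact G.X_mem (by omega)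
    have m2 : G.X n (i + 1) ∈ Icc a b := G.X_mem (by omega)
    have m3 : G.X n (i + 1) + G.p n (i + 1) ∈ Icc a b := by rw [e2]; exact G.X_mem (by omega)
    have := H _ _ _ p1 p2 m1 m2 m3
      (by rw [le_div_iff₀ p1, inv_mul_le_iff₀ G.B_pos]; exact G.p_down hi)
      (by rw [div_le_iff₀ p1]; exact G.p_up hi)
    rw [log_ratio_eq hm p1 p2 m1 m2 m3, e1, e2] at this
    exact this
  · rintro ⟨C, hC, H⟩
    exact quasisymmetricOn_of_bound (G := G) hm le_rfl le_rfl (n₀ := 0) hC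
      (fun n _ t ht _ => H n t ht)

lemma exists_neg_log_lt {η : ℝ} (hη : 0 < η) : ∃ θ > 0, θ < 1 / 2 ∧ -Real.log (1 - 2 * θ) ≤ η := by
  refine ⟨(1 - Real.exp (-η)) / 2, ?_, ?_, ?_⟩
  · have := Real.exp_lt_exp.2 (show -η < 0 by linarith)
    rw [Real.exp_zero] at this
    linarith
  · have := Real.exp_pos (-η); linarith
  · have : 1 - 2 * ((1 - Real.exp (-η)) / 2) = Real.exp (-η) := by ring
    rw [this, Real.log_exp, neg_neg]

lemma uaaOn_iff (hm : StrictMonoOn h (Icc a b)) : UaaOn h (Icc a b) ↔ G.Vanishes 1 (G.r h) := by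
  have hB := G.one_le
  constructor
  · intro hu η hη
    -- The (uaa) condition has strict inequalities for the ratio, and neighbours may have ratio
    -- exactly `B`.
    obtain ⟨ε, hε, H⟩ := hu (B + 1) (by linarith)
    obtain ⟨δ, hδ, hs⟩ := hε.exists_small hη
    obtain ⟨n₀, hn⟩ := G.exists_mesh_lt (δ := δ / 2) (by linarith)
    refine ⟨n₀, fun n hn0 i hi => ?_⟩
    have p1 := G.p_pos (n := n) (i := i) (by omega)
    have p2 := G.p_pos hi
    have e1 : G.X n (i + 1) - G.p n i = G.X n i := by unfold p; ring
    have e2 : G.X n (i + 1) + G.p n (i + 1) = G.X n (i + 2) := by unfold p; ring_nf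
    have m1 : G.X n (i + 1) - G.p n i ∈ Icc a b := by rw [e1]; exact G.X_mem (by omega)
    have m2 : G.X n (i + 1) ∈ Icc a b := G.X_mem (by omega)
    have m3 : G.X n (i + 1) + G.p n (i + 1) ∈ Icc a b := by rw [e2]; exact G.X_mem (by omega)
    have := H _ _ _ p1 p2 m1 m2 m3
      (by rw [lt_div_iff₀ p1, inv_mul_lt_iff₀ (by linarith)]
          have := G.p_down hi; nlinarith)
      (by rw [div_lt_iff₀ p1]
          have := G.p_up hi; nlinarith)
    rw [log_ratio_eq hm p1 p2 m1 m2 m3, e1, e2] at this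
    refine this.trans (hs _ (by linarith) ?_)
    linarith [hn n hn0 i (by omega), hn n hn0 (i + 1) hi]
  · intro hV d hd
    obtain ⟨C, hC, hr⟩ := hV.exists_bound
    have hq := (quasisymmetricOn_iff (G := G) hm).2 ⟨C, hC, hr⟩
    obtain ⟨k, hk, hq⟩ := hq d hd
    -- The family of distortions is indexed by all admissible triples. It is bounded by
    -- quasisymmetry; smallness comes from splitting `η` equally between the covering error and at
    -- most `K` ratio distortions.
    obtain ⟨ε, hε, H⟩ := exists_modulus
      (ι := {q : ℝ × ℝ × ℝ // 0 < q.2.1 ∧ 0 < q.2.2 ∧ q.1 - q.2.1 ∈ Icc a b ∧ q.1 ∈ Icc a b ∧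
        q.1 + q.2.2 ∈ Icc a b ∧ d⁻¹ < q.2.2 / q.2.1 ∧ q.2.2 / q.2.1 < d})
      (t := fun q => q.1.2.1 + q.1.2.2)
      (D := fun q => Real.log ((h (q.1.1 + q.1.2.2) - h q.1.1) / (h q.1.1 - h (q.1.1 - q.1.2.1)) *
        (q.1.2.1 / q.1.2.2))) (K := Real.log k)
      (fun q => by linarith [q.2.1, q.2.2.1])
      (fun ⟨⟨x, δ₁, δ₂⟩, q1, q2, q3, q4, q5, q6, q7⟩ => hq x δ₁ δ₂ q1 q2 q3 q4 q5 q6.le q7.le)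
      (fun η hη => by
        obtain ⟨θ, hθ, hθ', hθη⟩ := exists_neg_log_lt (η := η / 4) (by linarith)
        obtain ⟨K, hK⟩ := G.exists_distortion_bound hm hd hθ hθ' 0
        obtain ⟨δ, hδ, hs⟩ := hV.exists_small (η := η / (4 * (K + 1))) (by positivity)
        refine ⟨δ, hδ, ?_⟩
        rintro ⟨⟨x, δ₁, δ₂⟩, q1, q2, q3, q4, q5, q6, q7⟩ hlt
        obtain ⟨n, -, i, k, hk, -, c2, c3⟩ := hK x δ₁ δ₂ q1 q2 q3.1 q5.2 q6.le q7.le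
        dsimp only at q1 q2 hlt ⊢
        refine (c3 (η / (4 * (K + 1))) (by positivity) fun t t1 t2 =>
          hs n t t (by omega) (by omega) ?_).trans ?_
        · refine (c2 t t1 t2.le).trans_lt ?_
          nlinarith
        · have : K * (η / (4 * (K + 1))) ≤ η / 4 := by
            rw [mul_div_assoc', div_le_div_iff₀ (by positivity) (by norm_num)]
            nlinarith
          linarith)
    exact ⟨ε, hε, fun x δ₁ δ₂ q1 q2 q3 q4 q5 q6 q7 => H ⟨(x, δ₁, δ₂), q1, q2, q3, q4, q5, q6, q7⟩⟩

/-- If the ratio distortions are `o` of the lengths, then `h` is affine. -/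
lemma affine_of_small (hm : StrictMonoOn h (Icc a b)) (hr : ∀ η > 0, ∃ n₀, ∀ n ≥ n₀, ∀ i,
    i + 1 < G.N n → |G.r h n i| ≤ η * (G.p n i + G.p n (i + 1))) :
    ∀ x ∈ Icc a b, h x = (h b - h a) / (b - a) * (x - a) + h a := by
  have hab := G.a_lt_b
  have key : ∀ z w, a ≤ z → z ≤ w → w ≤ b → h w - h z ≤ (h b - h a) / (b - a) * (w - z) := by
    intro z w hz hzw hw
    have hc : ∀ c > 0, c < (b - a) / 4 → (h w - h z) * (b - a - 2 * c) ≤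
        Real.exp (2 * c) * (h b - h a) * (w - z + 2 * c) := by
      intro c hc hc'
      obtain ⟨n₁, hn₁⟩ := hr (c / (2 * (b - a))) (div_pos hc (by linarith))
      obtain ⟨n₂, hn₂⟩ := G.exists_mesh_lt hc
      set n := max n₁ n₂
      have hn1 := hn₁ n (le_max_left _ _)
      have hn2 := hn₂ n (le_max_right _ _)
      -- The bounds for the ratio distortions add up along the level, and each interval is counted
      -- at most twice. The total is therefore at most `2 * (b - a)` times the coefficient, that is
      -- `c`.
      have hls : ∀ t, t < G.N n → |G.ls h n t - G.ls h n 0| ≤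
          c / (2 * (b - a)) * (G.X n t - a + (G.X n (t + 1) - a)) := by
        intro t
        induction t with
        | zero =>
          intro ht
          rw [G.X_zero, sub_self, abs_zero]
          have := (G.X_mem (n := n) (i := 0 + 1) ht).1
          refine mul_nonneg (div_nonneg hc.le (by linarith)) (by linarith)
        | succ t ih =>
          intro ht
          have h1 := ih (by omega)
          have h2 := hn1 t ht
          have h3 : G.ls h n (t + 1) - G.ls h n 0 = G.r h n t + (G.ls h n t - G.ls h n 0) := by
            unfold r; ring
          rw [h3]
          refine (abs_add_le _ _).trans ((add_le_add h2 h1).trans_eq ?_)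
          unfold p; ring
      have hE : ∀ t < G.N n, |G.ls h n t - G.ls h n 0| ≤ c := by
        intro t ht
        refine (hls t ht).trans ?_
        rw [div_mul_eq_mul_div, div_le_iff₀ (by linarith)]
        have h1 := (G.X_mem (n := n) (i := t) ht.le).2
        have h2 := (G.X_mem (n := n) (i := t + 1) ht).2
        nlinarith
      have hb := fun t (ht : t < G.N n) => increment_of_logSlope hm (G.X_mem ht.le) (G.X_mem ht)
        (G.X_lt n t ht) (hE t ht)
      have hmono : MonotoneOn h (Icc (G.X n 0) (G.X n (G.N n))) := by
        rw [G.X_zero, G.X_last]; exact hm.monotoneOn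
      obtain ⟨-, u1⟩ := increment_bounds (G.N_pos n) (G.X_lt n) hmono (Real.exp_pos _).le hb
        (fun t ht => (hn2 t ht).le) (z := z) (w := w) (by rw [G.X_zero]; exact hz) hzw
        (by rw [G.X_last]; exact hw)
      obtain ⟨u2, -⟩ := increment_bounds (G.N_pos n) (G.X_lt n) hmono (Real.exp_pos _).le hb
        (fun t ht => (hn2 t ht).le) (z := a) (w := b) (by rw [G.X_zero]) hab.le
        (by rw [G.X_last])
      set L := G.ls h n 0
      have e : Real.exp (L + c) = Real.exp (2 * c) * Real.exp (L - c) := by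
        rw [← Real.exp_add]; congr 1; ring
      calc (h w - h z) * (b - a - 2 * c) ≤ Real.exp (L + c) * (w - z + 2 * c) * (b - a - 2 * c) :=
            mul_le_mul_of_nonneg_right u1 (by linarith)
        _ = Real.exp (2 * c) * (w - z + 2 * c) * (Real.exp (L - c) * (b - a - 2 * c)) := by
            rw [e]; ring
        _ ≤ Real.exp (2 * c) * (w - z + 2 * c) * (h b - h a) :=
            mul_le_mul_of_nonneg_left u2 (mul_nonneg (Real.exp_pos _).le (by linarith))
        _ = _ := by ring
    -- The limit `c → 0` removes both the slope error and the mesh error.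
    have hlim : (h w - h z) * (b - a - 2 * 0) ≤
        Real.exp (2 * 0) * (h b - h a) * (w - z + 2 * 0) := by
      have t1 : Filter.Tendsto (fun c : ℝ => (h w - h z) * (b - a - 2 * c)) (nhdsWithin 0 (Ioi 0))
          (nhds ((h w - h z) * (b - a - 2 * 0))) := by
        refine (Continuous.tendsto ?_ 0).mono_left nhdsWithin_le_nhds; fun_prop
      have t2 : Filter.Tendsto (fun c : ℝ => Real.exp (2 * c) * (h b - h a) * (w - z + 2 * c))
          (nhdsWithin 0 (Ioi 0)) (nhds (Real.exp (2 * 0) * (h b - h a) * (w - z + 2 * 0))) := by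
        refine (Continuous.tendsto ?_ 0).mono_left nhdsWithin_le_nhds; fun_prop
      refine le_of_tendsto_of_tendsto t1 t2 ?_
      filter_upwards [Ioo_mem_nhdsGT (show (0 : ℝ) < (b - a) / 4 by linarith)] with c hc1
      exact hc c hc1.1 hc1.2
    simp only [mul_zero, sub_zero, add_zero, Real.exp_zero, one_mul] at hlim
    rw [div_mul_eq_mul_div, le_div_iff₀ (by linarith)]
    exact hlim
  -- The upper bounds on `[a, x]` and `[x, b]` add up to the exact increment of `h` on `[a, b]`, so
  -- both are equalities.
  intro x hx
  have h1 := key a x le_rfl hx.1 hx.2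
  have h2 := key x b hx.1 hx.2 le_rfl
  have h3 : (h b - h a) / (b - a) * (b - a) = h b - h a := div_mul_cancel₀ _ (by linarith)
  have h4 : (h b - h a) / (b - a) * (b - x) + (h b - h a) / (b - a) * (x - a) = h b - h a :=
    (by ring : _ = (h b - h a) / (b - a) * (b - a)).trans h3
  linarith

/-- Numbers attached to the grid intervals that vary Hölder continuously from an interval to its
neighbours and to its children converge to a Hölder continuous function. -/
lemma exists_holder_limit {F : ℕ → ℕ → ℝ} {α C : ℝ} (hα : 0 < α) (hC : 0 ≤ C)
    (h1 : ∀ n i, i + 1 < G.N n → |F n (i + 1) - F n i| ≤ C * G.p n i ^ α)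
    (h2 : ∀ n i j, i < G.N n → G.σ n i ≤ j → j < G.σ n (i + 1) →
      |F (n + 1) j - F n i| ≤ C * G.p n i ^ α) :
    ∃ (f : ℝ → ℝ) (C' : ℝ), 0 ≤ C' ∧ (∀ n i x, i < G.N n → G.X n i ≤ x → x ≤ G.X n (i + 1) →
      |F n i - f x| ≤ C' * G.p n i ^ α) ∧
      ∀ x ∈ Icc a b, ∀ y ∈ Icc a b, |f y - f x| ≤ C' * |y - x| ^ α := by
  -- Half-open intervals, with the last one closed: each point lies in exactly one of them at each
  -- level, and those containing a given point are nested (`hpar`).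
  set I : ℕ → ℕ → ℝ → Prop := fun n i x =>
    i < G.N n ∧ G.X n i ≤ x ∧ (x < G.X n (i + 1) ∨ i + 1 = G.N n) with hI
  have hex : ∀ n x, ∃ i, x ∈ Icc a b → I n i x := by
    intro n x
    by_cases hx : x ∈ Icc a b
    · obtain ⟨i, hi, q1, q2⟩ := G.exists_mem (n := n) hx
      rcases q2.lt_or_eq with q2 | q2
      · exact ⟨i, fun _ => ⟨hi, q1, .inl q2⟩⟩
      · by_cases hl : i + 1 = G.N n
        · exact ⟨i, fun _ => ⟨hi, q1, .inr hl⟩⟩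
        · exact ⟨i + 1, fun _ => ⟨by omega, q2.ge, .inl (by rw [q2]; exact G.X_lt n _ (by omega))⟩⟩
    · exact ⟨0, fun hx' => absurd hx' hx⟩
  have hlt : ∀ n i j x, I n i x → I n j x → ¬ i < j := by
    rintro n i j x ⟨i1, i2, i3⟩ ⟨j1, j2, -⟩ hij
    rcases i3 with i3 | i3
    · have := G.X_le_X (n := n) (i := i + 1) (j := j) hij j1.le
      linarith
    · omega
  have huniq : ∀ n i j x, I n i x → I n j x → i = j := fun n i j x hi hj =>
    le_antisymm (not_lt.1 (hlt n j i x hj hi)) (not_lt.1 (hlt n i j x hi hj))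
  choose ι hι using hex
  have hpar : ∀ n x, x ∈ Icc a b → G.σ n (ι n x) ≤ ι (n + 1) x ∧
      ι (n + 1) x < G.σ n (ι n x + 1) := by
    intro n x hx
    obtain ⟨j1, j2, j3⟩ := hι (n + 1) x hx
    obtain ⟨k, hk, k1, k2⟩ := G.exists_parent j1
    have hkI : I n k x := by
      refine ⟨hk, ?_, ?_⟩
      · rw [← G.σ_X n k hk.le]; exact (G.X_le_X k1 j1.le).trans j2
      · rcases j3 with j3 | j3
        · left
          rw [← G.σ_X n (k + 1) hk]; exact j3.trans_le (G.X_le_X k2 (G.σ_le_N hk))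
        · right
          by_contra hc
          have := G.σ_lt (n := n) (i := k + 1) (j := G.N n) (by omega) le_rfl
          rw [G.σ_last] at this
          omega
    rw [huniq n _ _ x (hι n x hx) hkI]
    exact ⟨k1, k2⟩
  have hlamα : G.lam ^ α < 1 := Real.rpow_lt_one G.lam_pos.le G.lam_lt_one hα
  have hlamα0 : 0 < G.lam ^ α := Real.rpow_pos_of_pos G.lam_pos α
  have hp0 : ∀ n x, x ∈ Icc a b → 0 < G.p n (ι n x) := fun n x hx => G.p_pos (hι n x hx).1
  -- Nested intervals shrink at least by `lam` per level, so the successive differences are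
  -- dominated by a geometric series with quotient `lam ^ α`.
  have hstep : ∀ m x, x ∈ Icc a b → ∀ k, dist (F (m + k) (ι (m + k) x))
      (F (m + (k + 1)) (ι (m + (k + 1)) x)) ≤ C * G.p m (ι m x) ^ α * (G.lam ^ α) ^ k := by
    intro m x hx k
    have hdec : G.p (m + k) (ι (m + k) x) ≤ G.lam ^ k * G.p m (ι m x) := by
      induction k with
      | zero => simp
      | succ k ih =>
        obtain ⟨q1, q2⟩ := hpar (m + k) x hx
        refine (G.child_le (hι (m + k) x hx).1 q1 q2).trans ?_
        rw [pow_succ]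
        nlinarith [G.lam_pos]
    obtain ⟨q1, q2⟩ := hpar (m + k) x hx
    rw [dist_comm, Real.dist_eq]
    refine (h2 (m + k) _ _ (hι (m + k) x hx).1 q1 q2).trans ?_
    rw [mul_assoc]
    refine mul_le_mul_of_nonneg_left ?_ hC
    refine (Real.rpow_le_rpow (hp0 _ x hx).le hdec hα.le).trans_eq ?_
    rw [Real.mul_rpow (pow_nonneg G.lam_pos.le k) (hp0 m x hx).le, mul_comm, ← Real.rpow_natCast,
      ← Real.rpow_natCast, ← Real.rpow_mul G.lam_pos.le, ← Real.rpow_mul G.lam_pos.le,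
      mul_comm (k : ℝ)]
  have hlim : ∀ x, ∃ y, x ∈ Icc a b →
      Filter.Tendsto (fun k => F (0 + k) (ι (0 + k) x)) Filter.atTop (nhds y) := by
    intro x
    by_cases hx : x ∈ Icc a b
    · obtain ⟨y, hy⟩ := cauchySeq_tendsto_of_complete (cauchySeq_of_le_geometric _ _ hlamα
        (hstep 0 x hx))
      exact ⟨y, fun _ => hy⟩
    · exact ⟨0, fun hx' => absurd hx' hx⟩
  choose f hf using hlim
  set C₁ := C / (1 - G.lam ^ α) with hC₁
  have hC₁0 : 0 ≤ C₁ := div_nonneg hC (by linarith)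
  have hnear : ∀ m x, x ∈ Icc a b → |F m (ι m x) - f x| ≤ C₁ * G.p m (ι m x) ^ α := by
    intro m x hx
    have ht : Filter.Tendsto (fun k => F (m + k) (ι (m + k) x)) Filter.atTop (nhds (f x)) := by
      have := (hf x hx).comp (Filter.tendsto_add_atTop_nat m)
      refine this.congr fun k => ?_
      simp only [Function.comp, zero_add]
      rw [add_comm]
    have := dist_le_of_le_geometric_of_tendsto₀ _ _ hlamα (hstep m x hx) ht
    rw [Real.dist_eq] at this
    simp only [add_zero] at this
    refine this.trans_eq ?_
    rw [hC₁]; ring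
  set C₂ := C + C₁ * B ^ α + C₁ with hC₂
  have hBα : 0 < B ^ α := Real.rpow_pos_of_pos G.B_pos α
  have hC₂0 : 0 ≤ C₂ := by positivity
  have hclose : ∀ n i x, i < G.N n → G.X n i ≤ x → x ≤ G.X n (i + 1) →
      |F n i - f x| ≤ C₂ * G.p n i ^ α := by
    intro n i x hi hx1 hx2
    have hx : x ∈ Icc a b := ⟨(G.X_mem hi.le).1.trans hx1, hx2.trans (G.X_mem hi).2⟩
    have hpi := G.p_pos hi
    have hpα : 0 ≤ G.p n i ^ α := Real.rpow_nonneg hpi.le _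
    have h0 := hι n x hx
    by_cases hc : x < G.X n (i + 1) ∨ i + 1 = G.N n
    · have h3 := hnear n x hx
      rw [huniq n _ _ x h0 ⟨hi, hx1, hc⟩] at h3
      refine h3.trans (mul_le_mul_of_nonneg_right ?_ hpα)
      have : 0 ≤ C₁ * B ^ α := by positivity
      linarith
    -- At the right endpoint of an interval the selected interval is the next one; this accounts for
    -- the terms `C` and `C₁ * B ^ α` in `C₂`.
    · push Not at hc
      have hi1 : i + 1 < G.N n := by have := hc.2; omega
      have hxe : x = G.X n (i + 1) := le_antisymm hx2 hc.1
      have hI1 : I n (i + 1) x := ⟨hi1, hxe.ge, .inl (by rw [hxe]; exact G.X_lt n _ hi1)⟩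
      have h3 := hnear n x hx
      rw [huniq n _ _ x h0 hI1] at h3
      have h4 := h1 n i hi1
      have h5 : G.p n (i + 1) ^ α ≤ B ^ α * G.p n i ^ α := by
        rw [← Real.mul_rpow G.B_pos.le hpi.le]
        exact Real.rpow_le_rpow (G.p_pos hi1).le (G.p_up hi1) hα.le
      have h6 : C₁ * G.p n (i + 1) ^ α ≤ C₁ * (B ^ α * G.p n i ^ α) :=
        mul_le_mul_of_nonneg_left h5 hC₁0
      have h7 : F n i - f x = -(F n (i + 1) - F n i) + (F n (i + 1) - f x) := by ring
      rw [h7]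
      refine (abs_add_le _ _).trans ?_
      rw [abs_neg]
      have : 0 ≤ C₁ * G.p n i ^ α := by positivity
      rw [hC₂, add_mul, add_mul]
      linarith
  -- A chain with at most `K` neighbour steps, made of intervals of length at most `y - x`, joins
  -- `x` to `y`; each step costs at most `C * (y - x) ^ α`.
  obtain ⟨K, hK⟩ := G.exists_fine_cover one_pos 0
  have hhol : ∀ x ∈ Icc a b, ∀ y ∈ Icc a b, x < y → |f y - f x| ≤ (2 * C₂ + K * C) * (y - x) ^ α := by
    intro x hx y hy hxy
    obtain ⟨n, -, i, k, hik, hkK, hk, c1, c2, c3, c4, c5⟩ := hK x y hx.1 hxy hy.2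
    have hpow : ∀ t, i ≤ t → t ≤ k → G.p n t ^ α ≤ (y - x) ^ α := fun t t1 t2 =>
      Real.rpow_le_rpow (G.p_pos (by omega)).le ((c5 t t1 t2).trans_eq (one_mul _)) hα.le
    have hY : 0 ≤ (y - x) ^ α := Real.rpow_nonneg (by linarith) _
    have hF : ∀ d, i + d ≤ k → |F n (i + d) - F n i| ≤ d * (C * (y - x) ^ α) := by
      intro d
      induction d with
      | zero => simp
      | succ d ih =>
        intro hd
        have q1 := ih (by omega)
        have q2 := (h1 n (i + d) (by omega)).trans
          (mul_le_mul_of_nonneg_left (hpow (i + d) (by omega) (by omega)) hC)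
        have q3 : F n (i + (d + 1)) - F n i =
          (F n (i + d + 1) - F n (i + d)) + (F n (i + d) - F n i) := by ring_nf
        rw [q3]
        refine (abs_add_le _ _).trans ?_
        push_cast
        linarith
    have g1 := (hclose n i x (by omega) c1 c2.le).trans
      (mul_le_mul_of_nonneg_left (hpow i le_rfl hik) hC₂0)
    have g2 := (hclose n k y hk c3.le c4).trans
      (mul_le_mul_of_nonneg_left (hpow k hik le_rfl) hC₂0)
    have g3 := hF (k - i) (by omega)
    rw [Nat.add_sub_cancel' hik] at g3
    have g4 : ((k - i : ℕ) : ℝ) * (C * (y - x) ^ α) ≤ K * (C * (y - x) ^ α) := by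
      gcongr
      omega
    rw [abs_le] at g1 g2 g3 ⊢
    constructor <;> linarith [g1.1, g1.2, g2.1, g2.2, g3.1, g3.2]
  refine ⟨f, 2 * C₂ + K * C, by positivity, ?_, ?_⟩
  · intro n i x hi q1 q2
    refine (hclose n i x hi q1 q2).trans (mul_le_mul_of_nonneg_right ?_
      (Real.rpow_nonneg (G.p_pos hi).le _))
    have : 0 ≤ K * C := by positivity
    linarith
  · intro x hx y hy
    rcases lt_trichotomy x y with hxy | rfl | hxy
    · rw [abs_of_pos (sub_pos.2 hxy)]; exact hhol x hx y hy hxy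
    · rw [sub_self, sub_self, abs_zero]; positivity
    · rw [abs_sub_comm, abs_sub_comm y, abs_of_pos (sub_pos.2 hxy)]; exact hhol y hy x hx hxy

end OGrid

end GridSmoothness

/-! ### Differentiable maps: Hölder derivatives and the distortions of smooth maps. -/

namespace GridSmoothness

variable {B : ℝ} {M : ℕ} {a b : ℝ} {h : ℝ → ℝ}

lemma tendsto_abs_rpow {α : ℝ} (hα : 0 < α) (C x : ℝ) (l : Filter ℝ) (hl : l ≤ nhds x) :
    Filter.Tendsto (fun y => C * |y - x| ^ α) l (nhds 0) := by
  have hc : Continuous fun y : ℝ => C * |y - x| ^ α := by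
    refine continuous_const.mul (Continuous.rpow_const (by fun_prop) fun _ => .inr hα.le)
  have := (hc.tendsto x).mono_left hl
  simpa [Real.zero_rpow hα.ne'] using this

lemma HolderContOn.continuousOn {α : ℝ} (hα : 0 < α) {g : ℝ → ℝ} {S : Set ℝ}
    (hg : HolderContOn α g S) : ContinuousOn g S := by
  obtain ⟨C, -, H⟩ := hg
  intro x hx
  rw [ContinuousWithinAt, tendsto_iff_dist_tendsto_zero]
  refine squeeze_zero' (.of_forall fun _ => dist_nonneg) ?_
    (tendsto_abs_rpow hα C x _ nhdsWithin_le_nhds)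
  filter_upwards [self_mem_nhdsWithin] with y hy
  rw [Real.dist_eq]
  exact H x hx y hy

lemma hasDerivWithinAt_of_abs_sub_le {F : ℝ → ℝ} {S : Set ℝ} {x g C α : ℝ} (hα : 0 < α)
    (H : ∀ y ∈ S, |F y - F x - g * (y - x)| ≤ C * |y - x| ^ (1 + α)) :
    HasDerivWithinAt F g S x := by
  rw [hasDerivWithinAt_iff_tendsto_slope, tendsto_iff_dist_tendsto_zero]
  refine squeeze_zero' (.of_forall fun _ => dist_nonneg) ?_
    (tendsto_abs_rpow hα C x _ nhdsWithin_le_nhds)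
  filter_upwards [self_mem_nhdsWithin] with y hy
  have hne : y - x ≠ 0 := sub_ne_zero.2 hy.2
  have hpos : 0 < |y - x| := abs_pos.2 hne
  have h1 := H y hy.1
  rw [Real.rpow_add hpos, Real.rpow_one] at h1
  have e : slope F x y - g = (F y - F x - g * (y - x)) / (y - x) := by
    rw [slope_def_field]; field_simp
  rw [Real.dist_eq, e, abs_div, div_le_iff₀ hpos]
  linarith

lemma abs_log_sub_log_le {m u v : ℝ} (hm : 0 < m) (hu : m ≤ u) (hv : m ≤ v) :
    |Real.log u - Real.log v| ≤ |u - v| / m := by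
  have key : ∀ u v : ℝ, m ≤ u → m ≤ v → Real.log u - Real.log v ≤ |u - v| / m := by
    intro u v hu hv
    have hv0 : 0 < v := by linarith
    rw [← Real.log_div (by linarith) hv0.ne']
    refine (Real.log_le_sub_one_of_pos (div_pos (by linarith) hv0)).trans ?_
    have : u / v - 1 = (u - v) / v := by field_simp
    rw [this]
    exact (div_le_div_of_nonneg_right (le_abs_self _) hv0.le).trans
      (div_le_div_of_nonneg_left (abs_nonneg _) hm hv)
  rw [abs_le]
  have h1 := key u v hu hv
  have h2 := key v u hv hu
  rw [abs_sub_comm] at h2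
  constructor <;> linarith

lemma abs_log_one_add_sub_le {κ z : ℝ} (hκ : 0 < κ) (hz : κ ≤ 1 + z) :
    |Real.log (1 + z) - z| ≤ z ^ 2 / κ := by
  have h0 : 0 < 1 + z := by linarith
  have h1 := Real.log_le_sub_one_of_pos h0
  have h2 := Real.one_sub_inv_le_log_of_pos h0
  have h3 : z ^ 2 / (1 + z) ≤ z ^ 2 / κ := div_le_div_of_nonneg_left (sq_nonneg z) hκ hz
  have h4 : 1 - (1 + z)⁻¹ = z - z ^ 2 / (1 + z) := by field_simp; ring
  have h5 : 0 ≤ z ^ 2 / κ := by positivity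
  rw [abs_le]; constructor <;> linarith

lemma derivWithin_Icc_eq {u v x : ℝ} {f : ℝ → ℝ} (hu : a ≤ u) (hv : v ≤ b) (huv : u < v)
    (hf : DifferentiableOn ℝ f (Icc a b)) (hx : x ∈ Icc u v) :
    derivWithin f (Icc u v) x = derivWithin f (Icc a b) x := by
  have hsub : Icc u v ⊆ Icc a b := Icc_subset_Icc hu hv
  exact ((hf x (hsub hx)).hasDerivWithinAt.mono hsub).derivWithin (uniqueDiffOn_Icc huv x hx)

lemma HolderContOn.mono {α : ℝ} {g : ℝ → ℝ} {S T : Set ℝ} (hg : HolderContOn α g S) (hTS : T ⊆ S) :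
    HolderContOn α g T := by
  obtain ⟨C, hC, H⟩ := hg
  exact ⟨C, hC, fun x hx y hy => H x (hTS hx) y (hTS hy)⟩

lemma HolderContOn.congr {α : ℝ} {g g' : ℝ → ℝ} {S : Set ℝ} (hg : HolderContOn α g S)
    (he : ∀ x ∈ S, g' x = g x) : HolderContOn α g' S := by
  obtain ⟨C, hC, H⟩ := hg
  exact ⟨C, hC, fun x hx y hy => by rw [he x hx, he y hy]; exact H x hx y hy⟩

lemma C1HolderOn.mono_Icc {α u v : ℝ} (H : C1HolderOn α h (Icc a b)) (hu : a ≤ u) (hv : v ≤ b)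
    (huv : u < v) : C1HolderOn α h (Icc u v) :=
  ⟨H.1.mono (Icc_subset_Icc hu hv), (H.2.mono (Icc_subset_Icc hu hv)).congr
    fun _ hx => derivWithin_Icc_eq hu hv huv H.1 hx⟩

lemma C2HolderOn.mono_Icc {α u v : ℝ} (H : C2HolderOn α h (Icc a b)) (hu : a ≤ u) (hv : v ≤ b)
    (huv : u < v) : C2HolderOn α h (Icc u v) := by
  have hsub : Icc u v ⊆ Icc a b := Icc_subset_Icc hu hv
  have e : ∀ x ∈ Icc u v, derivWithin h (Icc u v) x = derivWithin h (Icc a b) x :=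
    fun _ hx => derivWithin_Icc_eq hu hv huv H.1 hx
  refine ⟨H.1.mono hsub, (H.2.1.mono hsub).congr e, (H.2.2.mono hsub).congr fun x hx => ?_⟩
  rw [derivWithin_congr e (e x hx), derivWithin_Icc_eq hu hv huv H.2.1 hx]

lemma abs_exp_sub_exp_le {K u v : ℝ} (hu : u ≤ K) (hv : v ≤ K) :
    |Real.exp u - Real.exp v| ≤ Real.exp K * |u - v| := by
  have key : ∀ u v : ℝ, u ≤ K → Real.exp u - Real.exp v ≤ Real.exp K * |u - v| := by
    intro u v hu
    have h1 := Real.add_one_le_exp (v - u)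
    have h2 : Real.exp v = Real.exp u * Real.exp (v - u) := by rw [← Real.exp_add]; congr 1; ring
    have h3 := Real.exp_le_exp.2 hu
    have h4 := Real.exp_pos u
    have h5 : Real.exp u - Real.exp v ≤ Real.exp u * |u - v| := by
      rw [h2]; nlinarith [le_abs_self (u - v)]
    exact h5.trans (mul_le_mul_of_nonneg_right h3 (abs_nonneg _))
  have h1 := key u v hu
  have h2 := key v u hv
  rw [abs_sub_comm] at h2
  rw [abs_le]; constructor <;> linarith

lemma HolderContOn.exp {α : ℝ} {f : ℝ → ℝ} {S : Set ℝ} {K : ℝ} (hf : HolderContOn α f S)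
    (hK : ∀ x ∈ S, f x ≤ K) : HolderContOn α (fun x => Real.exp (f x)) S := by
  obtain ⟨C, hC, H⟩ := hf
  refine ⟨Real.exp K * C, by positivity, fun x hx y hy => ?_⟩
  refine (abs_exp_sub_exp_le (hK y hy) (hK x hx)).trans ?_
  rw [mul_assoc]
  exact mul_le_mul_of_nonneg_left (H x hx y hy) (Real.exp_pos _).le

lemma HolderContOn.exists_bound {α : ℝ} (hα : 0 < α) {f : ℝ → ℝ}
    (hf : HolderContOn α f (Icc a b)) : ∃ K, 0 ≤ K ∧ ∀ x ∈ Icc a b, |f x| ≤ K := by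
  obtain ⟨K, hK⟩ := isCompact_Icc.exists_bound_of_continuousOn (hf.continuousOn hα)
  exact ⟨max K 0, le_max_right _ _, fun x hx => (hK x hx).trans (le_max_left _ _)⟩

namespace OGrid

variable {G : OGrid B M a b}

/-- If the ratio distortions are `O` of a power of the lengths, then `h` is differentiable and the
logarithm of the derivative is Hölder continuous. -/
lemma exists_log_deriv (hm : StrictMonoOn h (Icc a b)) {α C : ℝ} (hα : 0 < α) (hC : 0 ≤ C)
    (hr : ∀ n i, i + 1 < G.N n → |G.r h n i| ≤ C * G.p n i ^ α) :
    ∃ f : ℝ → ℝ, (∀ x ∈ Icc a b, HasDerivWithinAt h (Real.exp (f x)) (Icc a b) x) ∧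
      HolderContOn α f (Icc a b) ∧ ∃ C', 0 ≤ C' ∧ ∀ n i x, i < G.N n → G.X n i ≤ x →
        x ≤ G.X n (i + 1) → |G.ls h n i - f x| ≤ C' * G.p n i ^ α := by
  -- The slope of the parent is an average of the slopes of its children, and the log slopes of the
  -- children differ by at most `M` ratio distortions.
  have hchild : ∀ n i j, i < G.N n → G.σ n i ≤ j → j < G.σ n (i + 1) →
      |G.ls h (n + 1) j - G.ls h n i| ≤ M * C * G.p n i ^ α := by
    intro n i j hi hj1 hj2
    have hN := G.σ_le_N (n := n) (i := i + 1) hi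
    have hup := G.σ_upper n i hi
    have hρ : ∀ t, G.σ n i ≤ t → t < G.σ n (i + 1) - 1 →
        |G.r h (n + 1) t| ≤ C * G.p n i ^ α := by
      intro t t1 t2
      refine (hr (n + 1) t (by omega)).trans (mul_le_mul_of_nonneg_left ?_ hC)
      refine Real.rpow_le_rpow (G.p_pos (by omega)).le ?_ hα.le
      refine (G.child_le hi t1 (by omega)).trans ?_
      have := G.p_pos hi
      nlinarith [G.lam_lt_one]
    have hpair : ∀ s t, G.σ n i ≤ s → s ≤ t → t < G.σ n (i + 1) →
        |G.ls h (n + 1) t - G.ls h (n + 1) s| ≤ M * C * G.p n i ^ α := by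
      intro s t s1 st t2
      have := abs_ls_sub_le (G := G) (h := h) (n := n + 1) (i := s) (k := t)
        (ρ := C * G.p n i ^ α) (fun t' q1 q2 => hρ t' (by omega) (by omega)) st le_rfl
      refine this.trans ?_
      rw [mul_assoc]
      have : 0 ≤ C * G.p n i ^ α := mul_nonneg hC (Real.rpow_nonneg (G.p_pos hi).le _)
      gcongr
      omega
    have := abs_logSlope_chain_sub_le hm (x := G.X (n + 1)) (i := G.σ n i) (j := G.σ n (i + 1))
      (L := G.ls h (n + 1) j) (E := M * C * G.p n i ^ α) (by omega)
      (fun t t1 t2 => G.X_lt _ _ (by omega)) (fun t t1 t2 => G.X_mem (by omega)) (by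
        intro t t1 t2
        change |G.ls h (n + 1) t - G.ls h (n + 1) j| ≤ _
        rcases le_total t j with htj | htj
        · rw [abs_sub_comm]; exact hpair t j t1 htj hj2
        · exact hpair j t hj1 htj t2)
    rw [G.σ_X n i hi.le, G.σ_X n (i + 1) hi, abs_sub_comm] at this
    exact this
  have hM : (1 : ℝ) ≤ M := by
    have := G.two_le_M
    exact_mod_cast (by omega : 1 ≤ M)
  obtain ⟨f, C', hC', hF, hH⟩ := G.exists_holder_limit (F := G.ls h) (α := α) (C := M * C) hα
    (by positivity) (fun n i hi => by
      refine (hr n i hi).trans (mul_le_mul_of_nonneg_right ?_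
        (Real.rpow_nonneg (G.p_pos (by omega)).le _))
      nlinarith) hchild
  have hslope : ∀ x ∈ Icc a b, ∀ y ∈ Icc a b, x < y →
      |logSlope h x y - f x| ≤ 2 * C' * (y - x) ^ α := by
    intro x hx y hy hxy
    -- The covering may be arbitrarily fine relative to `[x, y]`, as the bound for the log slopes of
    -- its members does not depend on their number. Letting `θ` tend to `0` removes the covering
    -- error.
    have hθ : ∀ θ > 0, θ < 1 / 2 → |logSlope h x y - f x| ≤ 2 * C' * (y - x) ^ α
        - Real.log (1 - 2 * θ) := by
      intro θ hθ hθ'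
      obtain ⟨K, hK⟩ := G.exists_fine_cover hθ 0
      obtain ⟨n, -, i, k, hik, hkK, hk, c1, c2, c3, c4, c5⟩ := hK x y hx.1 hxy hy.2
      refine logSlope_sub_le hm hik hk ?_ hθ' c1 hxy c4 c5
      intro t t1 t2
      have ht : t < G.N n := by omega
      have hp := G.p_pos ht
      have hpy : G.p n t ≤ y - x := (c5 t t1 t2).trans (by nlinarith)
      have hpi : G.p n i ≤ y - x := (c5 i le_rfl hik).trans (by nlinarith)
      have g1 := hF n t (G.X n t) ht le_rfl (G.X_lt n t ht).le
      have g2 := hH x hx (G.X n t) (G.X_mem ht.le)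
      have g3 : G.p n t ^ α ≤ (y - x) ^ α := Real.rpow_le_rpow hp.le hpy hα.le
      have g4 : |G.X n t - x| ^ α ≤ (y - x) ^ α := by
        refine Real.rpow_le_rpow (abs_nonneg _) ?_ hα.le
        have q1 := G.X_le_X (n := n) t1 ht.le
        have q2 := G.X_le_X (n := n) t2 hk.le
        have q3 : G.X n (i + 1) - G.X n i ≤ y - x := hpi
        rw [abs_le]; constructor <;> linarith
      have g5 := mul_le_mul_of_nonneg_left g3 hC'
      have g6 := mul_le_mul_of_nonneg_left g4 hC'
      have e : G.ls h n t - f x = (G.ls h n t - f (G.X n t)) + (f (G.X n t) - f x) := by ring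
      rw [e]
      refine (abs_add_le _ _).trans ?_
      linarith
    refine le_of_forall_pos_le_add fun η hη => ?_
    obtain ⟨θ, q1, q2, q3⟩ := exists_neg_log_lt hη
    exact (hθ θ q1 q2).trans (by linarith)
  refine ⟨f, ?_, ⟨C', hC', hH⟩, C', hC', hF⟩
  intro x hx
  rw [hasDerivWithinAt_iff_tendsto_slope]
  -- The minimum and maximum treat `y < x` and `x < y` together, which also covers the one-sided
  -- derivatives at the endpoints.
  set l : ℝ → ℝ := fun y => logSlope h (min x y) (max x y) with hl
  have hlim : Filter.Tendsto l (nhdsWithin x (Icc a b \ {x})) (nhds (f x)) := by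
    rw [tendsto_iff_dist_tendsto_zero]
    refine squeeze_zero' (.of_forall fun _ => dist_nonneg) ?_
      (tendsto_abs_rpow hα (3 * C') x _ nhdsWithin_le_nhds)
    filter_upwards [self_mem_nhdsWithin] with y hy
    have hpow : 0 ≤ C' * |y - x| ^ α := by positivity
    rw [Real.dist_eq]
    rcases lt_or_gt_of_ne hy.2 with hlt | hlt
    · have hlt : y < x := hlt
      have h1 := hslope y hy.1 x hx hlt
      have h2 := hH x hx y hy.1
      rw [hl]; dsimp only
      rw [min_eq_right hlt.le, max_eq_left hlt.le]
      have e : logSlope h y x - f x = (logSlope h y x - f y) + (f y - f x) := by ring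
      rw [e]
      refine (abs_add_le _ _).trans ?_
      rw [← abs_of_pos (sub_pos.2 hlt), abs_sub_comm] at h1
      rw [abs_sub_comm x y] at h1
      rw [abs_sub_comm (f y) (logSlope h y x)] at h1
      linarith
    · have hlt : x < y := hlt
      have h1 := hslope x hx y hy.1 hlt
      rw [hl]; dsimp only
      rw [min_eq_left hlt.le, max_eq_right hlt.le]
      rw [← abs_of_pos (sub_pos.2 hlt)] at h1
      linarith
  refine ((Real.continuous_exp.tendsto _).comp hlim).congr' ?_
  filter_upwards [self_mem_nhdsWithin] with y hy
  simp only [Function.comp, hl]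
  rcases lt_or_gt_of_ne hy.2 with hlt | hlt
  · have hlt : y < x := hlt
    rw [min_eq_right hlt.le, max_eq_left hlt.le, logSlope, Real.exp_log (slope_pos hm hy.1 hx hlt),
      slope_comm, slope_def_field]
  · have hlt : x < y := hlt
    rw [min_eq_left hlt.le, max_eq_right hlt.le, logSlope, Real.exp_log (slope_pos hm hx hy.1 hlt),
      slope_def_field]

lemma derivWithin_bounds (hab : a < b) {α : ℝ} (hα : 0 < α) (hm : StrictMonoOn h (Icc a b))
    (h1 : C1HolderOn α h (Icc a b)) (h2 : DerivNeZeroOn h (Icc a b)) :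
    ∃ m > 0, ∀ x ∈ Icc a b, m ≤ derivWithin h (Icc a b) x := by
  have hc := h1.2.continuousOn hα
  obtain ⟨x₀, hx₀, hmin⟩ := isCompact_Icc.exists_isMinOn (nonempty_Icc.2 hab.le) hc
  have h0 : ∀ x, 0 ≤ derivWithin h (Icc a b) x := fun x => hm.monotoneOn.derivWithin_nonneg
  exact ⟨_, lt_of_le_of_ne (h0 x₀) (h2 x₀ hx₀).symm, fun x hx => hmin hx⟩

lemma exists_slope_eq_deriv (hd : DifferentiableOn ℝ h (Icc a b)) {x y : ℝ} (hx : x ∈ Icc a b)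
    (hy : y ∈ Icc a b) (hxy : x < y) :
    ∃ ξ ∈ Ioo x y, derivWithin h (Icc a b) ξ = (h y - h x) / (y - x) := by
  refine exists_hasDerivAt_eq_slope h _ hxy (hd.continuousOn.mono (Icc_subset_Icc hx.1 hy.2)) ?_
  intro ξ hξ
  have hξm : ξ ∈ Ioo a b := ⟨hx.1.trans_lt hξ.1, hξ.2.trans_le hy.2⟩
  exact (hd ξ (Ioo_subset_Icc_self hξm)).hasDerivWithinAt.hasDerivAt (Icc_mem_nhds hξm.1 hξm.2)

/-- By the mean value theorem a ratio distortion is a difference of values of the logarithm of the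
derivative at two points of the pair, and the derivative has a positive minimum. The converse
exponentiates the limit from `exists_log_deriv`. -/
lemma c1HolderOn_iff (hm : StrictMonoOn h (Icc a b)) {α : ℝ} (hα : 0 < α) :
    (C1HolderOn α h (Icc a b) ∧ DerivNeZeroOn h (Icc a b)) ↔
      ∃ C, 0 ≤ C ∧ ∀ n i, i + 1 < G.N n → |G.r h n i| ≤ C * G.p n i ^ α := by
  have hab := G.a_lt_b
  constructor
  · rintro ⟨h1, h2⟩
    obtain ⟨m, hm0, hmb⟩ := derivWithin_bounds hab hα hm h1 h2
    obtain ⟨hd, C, hC, hH⟩ := h1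
    refine ⟨C * (1 + B) ^ α / m, by have := G.B_pos; positivity, fun n i hi => ?_⟩
    have x0 : G.X n i ∈ Icc a b := G.X_mem (by omega)
    have x1 : G.X n (i + 1) ∈ Icc a b := G.X_mem (by omega)
    have x2 : G.X n (i + 2) ∈ Icc a b := G.X_mem (by omega)
    have l1 := G.X_lt n i (by omega)
    have l2 : G.X n (i + 1) < G.X n (i + 2) := G.X_lt n (i + 1) hi
    obtain ⟨ξ, hξ, e1⟩ := exists_slope_eq_deriv hd x0 x1 l1
    obtain ⟨ζ, hζ, e2⟩ := exists_slope_eq_deriv hd x1 x2 l2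
    have mξ : ξ ∈ Icc a b := ⟨x0.1.trans hξ.1.le, hξ.2.le.trans x1.2⟩
    have mζ : ζ ∈ Icc a b := ⟨x1.1.trans hζ.1.le, hζ.2.le.trans x2.2⟩
    have hup := G.p_up hi
    have hp := G.p_pos (n := n) (i := i) (by omega)
    have hr : G.r h n i = Real.log (derivWithin h (Icc a b) ζ) -
        Real.log (derivWithin h (Icc a b) ξ) := by rw [e1, e2]; rfl
    rw [hr]
    refine (abs_log_sub_log_le hm0 (hmb ζ mζ) (hmb ξ mξ)).trans ?_
    rw [div_mul_eq_mul_div]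
    refine div_le_div_of_nonneg_right ?_ hm0.le
    refine (hH ξ mξ ζ mζ).trans ?_
    rw [mul_assoc, ← Real.mul_rpow (by linarith [G.B_pos]) hp.le]
    refine mul_le_mul_of_nonneg_left (Real.rpow_le_rpow (abs_nonneg _) ?_ hα.le) hC
    have : G.X n (i + 2) - G.X n i = G.p n i + G.p n (i + 1) := by unfold p; ring_nf
    rw [abs_of_pos (by linarith [hξ.2, hζ.1])]
    linarith [hξ.1, hζ.2]
  · rintro ⟨C, hC, hr⟩
    obtain ⟨f, hf, hH, -⟩ := exists_log_deriv hm hα hC hr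
    have he : ∀ x ∈ Icc a b, derivWithin h (Icc a b) x = Real.exp (f x) := fun x hx =>
      (hf x hx).derivWithin (uniqueDiffOn_Icc hab x hx)
    obtain ⟨K, -, hK⟩ := hH.exists_bound hα
    exact ⟨⟨fun x hx => (hf x hx).differentiableWithinAt,
      (hH.exp fun x hx => (le_abs_self _).trans (hK x hx)).congr he⟩,
      fun x hx => by rw [he x hx]; exact (Real.exp_pos _).ne'⟩

lemma affine_r_eq_zero (hA : AffineOn h (Icc a b)) {n i : ℕ}
    (hi : i + 1 < G.N n) : G.r h n i = 0 := by
  obtain ⟨m, c, H⟩ := hA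
  have hls : ∀ t < G.N n, G.ls h n t = Real.log m := by
    intro t ht
    have h1 := G.X_lt n t ht
    unfold ls logSlope
    rw [H _ (G.X_mem ht.le), H _ (G.X_mem ht)]
    congr 1
    have : G.X n (t + 1) - G.X n t ≠ 0 := by linarith
    field_simp; ring
  unfold r
  rw [hls _ hi, hls _ (by omega), sub_self]

lemma derivNeZeroOn_of_affine (hab : a < b) {m c : ℝ} (hm0 : m ≠ 0)
    (H : ∀ x ∈ Icc a b, h x = m * x + c) : DerivNeZeroOn h (Icc a b) := by
  intro x hx
  have h1 : HasDerivWithinAt (fun x => m * x + c) m (Icc a b) x := by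
    simpa using (((hasDerivAt_id x).const_mul m).add_const c).hasDerivWithinAt
  rw [(h1.congr H (H x hx)).derivWithin (uniqueDiffOn_Icc hab x hx)]
  exact hm0

lemma affine_iff {Γ : Grid B M a b} {e : ℕ → ℕ → ℕ} (hO : G.Matches Γ e)
    (hm : StrictMonoOn h (Icc a b)) :
    (AffineOn h (Icc a b) ∧ DerivNeZeroOn h (Icc a b)) ↔ Γ.LrdLittleO h := by
  have hab := G.a_lt_b
  constructor
  · rintro ⟨hA, -⟩
    refine ⟨fun _ => 0, ⟨continuousOn_const, fun _ _ => le_rfl, rfl⟩, fun n β h1 h2 h3 => ?_⟩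
    obtain ⟨m, i, hi, e1, -⟩ := hO.abs_lrd' hm h1 h2 h3
    rw [e1, affine_r_eq_zero hA hi]; simp
  · intro H
    have hA := affine_of_small hm (hO.small_of_lrdLittleO hm H)
    have hA' : ∀ x ∈ Icc a b, h x = (h b - h a) / (b - a) * x +
        (h a - (h b - h a) / (b - a) * a) := fun x hx => by rw [hA x hx]; ring
    have hlt := hm ⟨le_rfl, hab.le⟩ ⟨hab.le, le_rfl⟩ hab
    exact ⟨⟨_, _, hA'⟩, derivNeZeroOn_of_affine hab
      (div_pos (by linarith) (by linarith)).ne' hA'⟩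

/-- `cd` splits into two deviations, each of the slope over two neighbours from the slope over one
of them. An average slope lies between the slopes of its parts, so each deviation is at most one
ratio distortion. -/
lemma abs_cd_le (hm : StrictMonoOn h (Icc a b)) {n i : ℕ} (hi : i + 2 < G.N n) :
    |G.cd h n i| ≤ |G.r h n i| + |G.r h n (i + 1)| := by
  have h1 := abs_logSlope_chain_sub_le hm (x := G.X n) (i := i) (j := i + 2) (L := G.ls h n i)
    (E := |G.r h n i|) (by omega) (fun t _ _ => G.X_lt n t (by omega))
    (fun t _ _ => G.X_mem (by omega)) (by
      intro t t1 t2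
      obtain rfl | rfl : t = i ∨ t = i + 1 := by omega
      · change |G.ls h n t - G.ls h n t| ≤ _
        rw [sub_self, abs_zero]; exact abs_nonneg _
      · exact le_rfl)
  have h2 := abs_logSlope_chain_sub_le hm (x := G.X n) (i := i + 1) (j := i + 3)
    (L := G.ls h n (i + 2))
    (E := |G.r h n (i + 1)|) (by omega) (fun t _ _ => G.X_lt n t (by omega))
    (fun t _ _ => G.X_mem (by omega)) (by
      intro t t1 t2
      obtain rfl | rfl : t = i + 1 ∨ t = i + 2 := by omega
      · change |G.ls h n (i + 1) - G.ls h n (i + 2)| ≤ _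
        rw [abs_sub_comm]; exact le_rfl
      · change |G.ls h n (i + 2) - G.ls h n (i + 2)| ≤ _
        rw [sub_self, abs_zero]; exact abs_nonneg _)
  have e : G.cd h n i = (logSlope h (G.X n i) (G.X n (i + 2)) - G.ls h n i) +
      (logSlope h (G.X n (i + 1)) (G.X n (i + 3)) - G.ls h n (i + 2)) := by
    unfold cd crossDist ls; ring_nf
  rw [e]
  exact (abs_add_le _ _).trans (add_le_add h1 h2)

lemma cd_vanishes (hm : StrictMonoOn h (Icc a b)) (hV : G.Vanishes 1 (G.r h)) :
    G.Vanishes 2 (G.cd h) := by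
  intro η hη
  obtain ⟨n₀, hn⟩ := hV (η / 2) (by linarith)
  refine ⟨n₀, fun n hn0 i hi => (abs_cd_le hm hi).trans ?_⟩
  linarith [hn n hn0 i (by omega), hn n hn0 (i + 1) (by omega)]

lemma cd_bigO (hm : StrictMonoOn h (Icc a b)) {α : ℝ} (hα : 0 ≤ α)
    (H : ∃ C, 0 ≤ C ∧ ∀ n i, i + 1 < G.N n → |G.r h n i| ≤ C * G.p n i ^ α) :
    ∃ C, 0 ≤ C ∧ ∀ n i, i + 2 < G.N n → |G.cd h n i| ≤ C * G.p n i ^ α := by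
  obtain ⟨C, hC, hr⟩ := H
  have hB := G.B_pos
  refine ⟨C * (1 + B ^ α), by positivity, fun n i hi => (abs_cd_le hm hi).trans ?_⟩
  have h1 := hr n i (by omega)
  have h2 := hr n (i + 1) (by omega)
  have h3 : G.p n (i + 1) ^ α ≤ B ^ α * G.p n i ^ α := by
    rw [← Real.mul_rpow hB.le (G.p_pos (by omega)).le]
    exact Real.rpow_le_rpow (G.p_pos (by omega)).le (G.p_up (by omega)) hα
  have h4 := mul_le_mul_of_nonneg_left h3 hC
  linarith

/-- The average slopes of a `C^{2+α}` map are given by the first two derivatives at a nearby point,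
up to the order `1 + α`. -/
lemma slope_expansion {α : ℝ} (hα : 0 < α) {C : ℝ} (hC : 0 ≤ C)
    (hd : DifferentiableOn ℝ h (Icc a b))
    (hd2 : DifferentiableOn ℝ (derivWithin h (Icc a b)) (Icc a b))
    (hH : ∀ x ∈ Icc a b, ∀ y ∈ Icc a b, |derivWithin (derivWithin h (Icc a b)) (Icc a b) y -
      derivWithin (derivWithin h (Icc a b)) (Icc a b) x| ≤ C * |y - x| ^ α)
    {x₀ x y w : ℝ} (hx₀ : a ≤ x₀) (hx : x₀ ≤ x) (hxy : x < y) (hyw : y ≤ w) (hw : w ≤ b) :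
    |(h y - h x) / (y - x) - derivWithin h (Icc a b) x₀ -
      derivWithin (derivWithin h (Icc a b)) (Icc a b) x₀ * ((x + y) / 2 - x₀)| ≤
      C * (w - x₀) ^ (1 + α) := by
  set g := derivWithin h (Icc a b) with hg
  set g₂ := derivWithin g (Icc a b) with hg₂
  have hτ : 0 < w - x₀ := by linarith
  have hsub : Icc x₀ w ⊆ Icc a b := Icc_subset_Icc hx₀ hw
  have m0 : x₀ ∈ Icc x₀ w := ⟨le_rfl, by linarith⟩
  -- The mean value inequality is used twice: here for the derivative, below for `h` minus its
  -- quadratic Taylor polynomial.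
  have step1 : ∀ t ∈ Icc x₀ w, |g t - g x₀ - g₂ x₀ * (t - x₀)| ≤ C * (w - x₀) ^ (1 + α) := by
    intro t ht
    have hb := (convex_Icc x₀ w).norm_image_sub_le_of_norm_hasDerivWithin_le
      (f := fun s => g s - g₂ x₀ * s) (f' := fun s => g₂ s - g₂ x₀) (C := C * (w - x₀) ^ α)
      (fun s hs => by
        have := ((hd2 s (hsub hs)).hasDerivWithinAt.mono hsub).sub
          ((hasDerivAt_id s).const_mul (g₂ x₀)).hasDerivWithinAt
        exact this.congr_deriv (by rw [mul_one]))
      (fun s hs => by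
        rw [Real.norm_eq_abs]
        refine (hH x₀ (hsub m0) s (hsub hs)).trans (mul_le_mul_of_nonneg_left ?_ hC)
        refine Real.rpow_le_rpow (abs_nonneg _) ?_ hα.le
        rw [abs_of_nonneg (by linarith [hs.1])]; linarith [hs.2]) m0 ht
    rw [Real.norm_eq_abs, Real.norm_eq_abs, abs_of_nonneg (by linarith [ht.1] : 0 ≤ t - x₀)] at hb
    have e : g t - g x₀ - g₂ x₀ * (t - x₀) = g t - g₂ x₀ * t - (g x₀ - g₂ x₀ * x₀) := by ring
    rw [e]
    refine hb.trans ?_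
    rw [Real.rpow_add hτ, Real.rpow_one, mul_comm (w - x₀), ← mul_assoc]
    exact mul_le_mul_of_nonneg_left (by linarith [ht.2])
      (mul_nonneg hC (Real.rpow_nonneg hτ.le _))
  have hb := (convex_Icc x₀ w).norm_image_sub_le_of_norm_hasDerivWithin_le
    (f := fun s => h s - g x₀ * s - g₂ x₀ * (s - x₀) ^ 2 / 2)
    (f' := fun s => g s - g x₀ - g₂ x₀ * (s - x₀)) (C := C * (w - x₀) ^ (1 + α))
    (fun s hs => by
      have h1 := ((hd s (hsub hs)).hasDerivWithinAt.mono hsub).sub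
        ((hasDerivAt_id s).const_mul (g x₀)).hasDerivWithinAt
      have h2 := (((((hasDerivAt_id s).sub_const x₀).pow 2).const_mul
        (g₂ x₀)).div_const 2).hasDerivWithinAt (s := Icc x₀ w)
      refine (h1.sub h2).congr_deriv ?_
      simp only [id, mul_one, Nat.cast_ofNat, hg]
      ring)
    (fun s hs => by rw [Real.norm_eq_abs]; exact step1 s hs)
    (x := x) (y := y) ⟨hx, by linarith⟩ ⟨by linarith, hyw⟩
  have hyx : 0 < y - x := by linarith
  rw [Real.norm_eq_abs, Real.norm_eq_abs, abs_of_pos hyx] at hb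
  have e : (h y - h x) / (y - x) - g x₀ - g₂ x₀ * ((x + y) / 2 - x₀) =
      (h y - g x₀ * y - g₂ x₀ * (y - x₀) ^ 2 / 2 - (h x - g x₀ * x - g₂ x₀ * (x - x₀) ^ 2 / 2)) /
        (y - x) := by
    field_simp; ring
  rw [e, abs_div, abs_of_pos hyx, div_le_iff₀ hyx]
  exact hb

/-- Up to order `1 + α`, `logSlope h x y` is an affine function of the midpoint `(x + y) / 2`, with
coefficients taken at one base point. In `crossDist` the constants cancel, and so do the four
midpoints with their signs, so only the four errors remain. -/
lemma cd_bigO_of_c2 (hm : StrictMonoOn h (Icc a b)) {α : ℝ} (hα : 0 < α) (hα1 : α ≤ 1)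
    (h2 : C2HolderOn α h (Icc a b)) (h0 : DerivNeZeroOn h (Icc a b)) :
    ∃ C, 0 ≤ C ∧ ∀ n i, i + 2 < G.N n → |G.cd h n i| ≤ C * G.p n i ^ (1 + α) := by
  have hab := G.a_lt_b
  have hB := G.B_pos
  obtain ⟨hd, hd2, hH⟩ := h2
  obtain ⟨K₂, hK₂, hb2⟩ := hH.exists_bound hα
  obtain ⟨C, hC, hH⟩ := hH
  set g := derivWithin h (Icc a b) with hg
  set g₂ := derivWithin g (Icc a b) with hg₂
  have hgc : ContinuousOn g (Icc a b) := hd2.continuousOn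
  obtain ⟨x₁, hx₁, hmin⟩ := isCompact_Icc.exists_isMinOn (nonempty_Icc.2 hab.le) hgc
  obtain ⟨x₂, hx₂, hmax⟩ := isCompact_Icc.exists_isMaxOn (nonempty_Icc.2 hab.le) hgc
  have hg0 : ∀ x, 0 ≤ g x := fun x => hm.monotoneOn.derivWithin_nonneg
  set m := g x₁
  set K := g x₂
  have hm0 : 0 < m := lt_of_le_of_ne (hg0 x₁) (h0 x₁ hx₁).symm
  have hmb : ∀ x ∈ Icc a b, m ≤ g x := fun x hx => hmin hx
  have hKb : ∀ x ∈ Icc a b, g x ≤ K := fun x hx => hmax hx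
  have hK0 : 0 < K := hm0.trans_le (hKb x₁ hx₁)
  set κ := m / K with hκ
  have hκ0 : 0 < κ := div_pos hm0 hK0
  set D := (C * (b - a) ^ α + K₂) / m with hD
  have hba : 0 < b - a := by linarith
  have hD0 : 0 ≤ D := by positivity
  -- The first term comes from the expansion of the slope, the second from the quadratic remainder
  -- of `log (1 + z)` with `|z| ≤ D * (w - x₀)`; the square is of order `1 + α` because `α ≤ 1`.
  set A := C / m + D ^ 2 * (b - a) ^ (1 - α) / κ with hA
  have hA0 : 0 ≤ A := by positivity
  have key : ∀ x₀ x y w, a ≤ x₀ → x₀ ≤ x → x < y → y ≤ w → w ≤ b →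
      |logSlope h x y - (Real.log (g x₀) + g₂ x₀ / g x₀ * ((x + y) / 2 - x₀))| ≤
        A * (w - x₀) ^ (1 + α) := by
    intro x₀ x y w q1 q2 q3 q4 q5
    have hτ : 0 < w - x₀ := by linarith
    have m0 : x₀ ∈ Icc a b := ⟨q1, by linarith⟩
    have mx : x ∈ Icc a b := ⟨by linarith, by linarith⟩
    have my : y ∈ Icc a b := ⟨by linarith, by linarith⟩
    have hg₀ := hm0.trans_le (hmb x₀ m0)
    have hs := slope_expansion hα hC hd hd2 hH q1 q2 q3 q4 q5
    obtain ⟨ξ, hξ, eξ⟩ := exists_slope_eq_deriv hd mx my q3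
    have mξ : ξ ∈ Icc a b := ⟨mx.1.trans hξ.1.le, hξ.2.le.trans my.2⟩
    set s := (h y - h x) / (y - x) with hsdef
    set z := s / g x₀ - 1 with hz
    have hsz : s = g x₀ * (1 + z) := by rw [hz]; field_simp; ring
    have hκz : κ ≤ 1 + z := by
      have : 1 + z = s / g x₀ := by rw [hz]; ring
      rw [this, ← eξ]
      exact div_le_div₀ (hg0 ξ) (hmb ξ mξ) hg₀ (hKb x₀ m0)
    have hlog : logSlope h x y = Real.log (g x₀) + Real.log (1 + z) := by
      unfold logSlope
      rw [← Real.log_mul hg₀.ne' (by linarith), ← hsz]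
    have hl := abs_log_one_add_sub_le hκ0 hκz
    have e1 : z - g₂ x₀ / g x₀ * ((x + y) / 2 - x₀) =
        (s - g x₀ - g₂ x₀ * ((x + y) / 2 - x₀)) / g x₀ := by rw [hz]; field_simp
    have hz1 : |z - g₂ x₀ / g x₀ * ((x + y) / 2 - x₀)| ≤ C / m * (w - x₀) ^ (1 + α) := by
      rw [e1, abs_div, abs_of_pos hg₀, div_mul_eq_mul_div]
      exact div_le_div₀ (by positivity) hs hm0 (hmb x₀ m0)
    have hz2 : |z| ≤ D * (w - x₀) := by
      have e2 : z = (s - g x₀ - g₂ x₀ * ((x + y) / 2 - x₀) + g₂ x₀ * ((x + y) / 2 - x₀)) / g x₀ := by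
        rw [hz]; field_simp; ring
      have e3 : C * (w - x₀) ^ (1 + α) ≤ C * (b - a) ^ α * (w - x₀) := by
        rw [Real.rpow_add hτ, Real.rpow_one, mul_comm (w - x₀), ← mul_assoc]
        gcongr
      have e4 : |g₂ x₀ * ((x + y) / 2 - x₀)| ≤ K₂ * (w - x₀) := by
        rw [abs_mul]
        refine mul_le_mul (hb2 x₀ m0) ?_ (abs_nonneg _) hK₂
        rw [abs_le]; constructor <;> linarith
      rw [e2, abs_div, abs_of_pos hg₀, hD, div_mul_eq_mul_div]
      refine div_le_div₀ (by positivity) ((abs_add_le _ _).trans ?_) hm0 (hmb x₀ m0)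
      linarith
    have hz3 : z ^ 2 ≤ D ^ 2 * (b - a) ^ (1 - α) * (w - x₀) ^ (1 + α) := by
      have e5 : (w - x₀) ^ 2 = (w - x₀) ^ (1 - α) * (w - x₀) ^ (1 + α) := by
        rw [← Real.rpow_add hτ, ← Real.rpow_natCast]; congr 1; push_cast; ring
      have e6 : (w - x₀) ^ (1 - α) ≤ (b - a) ^ (1 - α) :=
        Real.rpow_le_rpow hτ.le (by linarith) (by linarith)
      calc z ^ 2 = |z| ^ 2 := (sq_abs z).symm
        _ ≤ (D * (w - x₀)) ^ 2 := by gcongr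
        _ = D ^ 2 * (w - x₀) ^ (1 - α) * (w - x₀) ^ (1 + α) := by rw [mul_pow, e5]; ring
        _ ≤ _ := by gcongr
    have hz4 : z ^ 2 / κ ≤ D ^ 2 * (b - a) ^ (1 - α) / κ * (w - x₀) ^ (1 + α) := by
      rw [div_mul_eq_mul_div]
      exact div_le_div_of_nonneg_right hz3 hκ0.le
    have e7 : logSlope h x y - (Real.log (g x₀) + g₂ x₀ / g x₀ * ((x + y) / 2 - x₀)) =
        (Real.log (1 + z) - z) + (z - g₂ x₀ / g x₀ * ((x + y) / 2 - x₀)) := by rw [hlog]; ring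
    rw [e7, hA, add_mul]
    refine (abs_add_le _ _).trans ?_
    linarith
  refine ⟨4 * A * (1 + B + B ^ 2) ^ (1 + α), by positivity, fun n i hi => ?_⟩
  have l0 := G.X_lt n i (by omega)
  have l1 : G.X n (i + 1) < G.X n (i + 2) := G.X_lt n (i + 1) (by omega)
  have l2 : G.X n (i + 2) < G.X n (i + 3) := G.X_lt n (i + 2) hi
  have ha := (G.X_mem (n := n) (i := i) (by omega)).1
  have hb := (G.X_mem (n := n) (i := i + 3) (by omega)).2
  have k1 := key (G.X n i) (G.X n i) (G.X n (i + 2)) (G.X n (i + 3)) ha le_rfl (by linarith)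
    l2.le hb
  have k2 := key (G.X n i) (G.X n (i + 1)) (G.X n (i + 3)) (G.X n (i + 3)) ha l0.le (by linarith)
    le_rfl hb
  have k3 := key (G.X n i) (G.X n i) (G.X n (i + 1)) (G.X n (i + 3)) ha le_rfl l0 (by linarith) hb
  have k4 := key (G.X n i) (G.X n (i + 2)) (G.X n (i + 3)) (G.X n (i + 3)) ha (by linarith) l2
    le_rfl hb
  have hp := G.p_pos (n := n) (i := i) (by omega)
  have hτ : (G.X n (i + 3) - G.X n i) ^ (1 + α) ≤
      (1 + B + B ^ 2) ^ (1 + α) * G.p n i ^ (1 + α) := by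
    rw [← Real.mul_rpow (by positivity) hp.le]
    refine Real.rpow_le_rpow (by linarith) ?_ (by linarith)
    have u1 := G.p_up (n := n) (i := i) (by omega)
    have u2 := G.p_up (n := n) (i := i + 1) hi
    have e : G.X n (i + 3) - G.X n i = G.p n i + G.p n (i + 1) + G.p n (i + 2) := by
      unfold p; ring_nf
    have u3 : G.p n (i + 2) ≤ B * G.p n (i + 1) := u2
    rw [e]
    nlinarith
  have hA' := mul_le_mul_of_nonneg_left hτ hA0
  set N := g₂ (G.X n i) / g (G.X n i)
  unfold cd crossDist
  rw [abs_le] at k1 k2 k3 k4 ⊢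
  constructor <;> linarith [k1.1, k1.2, k2.1, k2.2, k3.1, k3.2, k4.1, k4.2]

end OGrid

end GridSmoothness

/-! ### Cross ratio distortions of four points and of chains. -/

namespace GridSmoothness

variable {B : ℝ} {M : ℕ} {a b : ℝ} {h : ℝ → ℝ} {S : Set ℝ}

lemma logSlope_eq (hm : StrictMonoOn h S) {x y : ℝ} (hx : x ∈ S) (hy : y ∈ S) (hxy : x < y) :
    logSlope h x y = Real.log (h y - h x) - Real.log (y - x) := by
  have := hm hx hy hxy
  unfold logSlope
  rw [Real.log_div (by linarith) (by linarith)]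

/-- The reciprocal cross ratio of four points. -/
def invCross (w x y z : ℝ) : ℝ := (x - w) * (z - y) / ((y - w) * (z - x))

lemma invCross_pos {w x y z : ℝ} (h1 : w < x) (h2 : x < y) (h3 : y < z) : 0 < invCross w x y z := by
  unfold invCross
  have : 0 < x - w := by linarith
  have : 0 < z - y := by linarith
  have : 0 < y - w := by linarith
  have : 0 < z - x := by linarith
  positivity

lemma one_sub_invCross {w x y z : ℝ} (h1 : w < x) (h2 : x < y) (h3 : y < z) :
    1 - invCross w x y z = (y - x) * (z - w) / ((y - w) * (z - x)) := by
  unfold invCross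
  have : y - w ≠ 0 := by linarith
  have : z - x ≠ 0 := by linarith
  field_simp; ring

lemma crossDist_eq_log (hm : StrictMonoOn h S) {w x y z : ℝ} (hw : w ∈ S) (hx : x ∈ S) (hy : y ∈ S)
    (hz : z ∈ S) (h1 : w < x) (h2 : x < y) (h3 : y < z) :
    crossDist h w x y z = Real.log (invCross w x y z) -
      Real.log (invCross (h w) (h x) (h y) (h z)) := by
  have i1 := hm hw hx h1
  have i2 := hm hx hy h2
  have i3 := hm hy hz h3
  have key : ∀ p q r s : ℝ, p < q → q < r → r < s → Real.log (invCross p q r s) =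
      Real.log (q - p) + Real.log (s - r) - Real.log (r - p) - Real.log (s - q) := by
    intro p q r s g1 g2 g3
    have q1 : q - p ≠ 0 := by linarith
    have q2 : s - r ≠ 0 := by linarith
    have q3 : r - p ≠ 0 := by linarith
    have q4 : s - q ≠ 0 := by linarith
    unfold invCross
    rw [Real.log_div (mul_ne_zero q1 q2) (mul_ne_zero q3 q4), Real.log_mul q1 q2,
      Real.log_mul q3 q4]
    ring
  rw [key _ _ _ _ h1 h2 h3, key _ _ _ _ i1 i2 i3]
  unfold crossDist
  rw [logSlope_eq hm hw hy (by linarith), logSlope_eq hm hx hz (by linarith), logSlope_eq hm hw hx h1,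
    logSlope_eq hm hy hz h3]
  ring

lemma invCross_image (hm : StrictMonoOn h S) {w x y z : ℝ} (hw : w ∈ S) (hx : x ∈ S) (hy : y ∈ S)
    (hz : z ∈ S) (h1 : w < x) (h2 : x < y) (h3 : y < z) :
    invCross (h w) (h x) (h y) (h z) =
      invCross w x y z * Real.exp (-crossDist h w x y z) := by
  have p1 := invCross_pos h1 h2 h3
  have p2 := invCross_pos (hm hw hx h1) (hm hx hy h2) (hm hy hz h3)
  rw [crossDist_eq_log hm hw hx hy hz h1 h2 h3, neg_sub, Real.exp_sub, Real.exp_log p1,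
    Real.exp_log p2]
  field_simp

/-- The distortion of the complementary cross ratio. -/
def dualDist (h : ℝ → ℝ) (w x y z : ℝ) : ℝ :=
  logSlope h w z + logSlope h x y - logSlope h w y - logSlope h x z

lemma dualDist_eq_log (hm : StrictMonoOn h S) {w x y z : ℝ} (hw : w ∈ S) (hx : x ∈ S) (hy : y ∈ S)
    (hz : z ∈ S) (h1 : w < x) (h2 : x < y) (h3 : y < z) :
    dualDist h w x y z = Real.log (1 - invCross (h w) (h x) (h y) (h z)) -
      Real.log (1 - invCross w x y z) := by
  have i1 := hm hw hx h1
  have i2 := hm hx hy h2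
  have i3 := hm hy hz h3
  have key : ∀ p q r s : ℝ, p < q → q < r → r < s → Real.log (1 - invCross p q r s) =
      Real.log (r - q) + Real.log (s - p) - Real.log (r - p) - Real.log (s - q) := by
    intro p q r s g1 g2 g3
    have q1 : r - q ≠ 0 := by linarith
    have q2 : s - p ≠ 0 := by linarith
    have q3 : r - p ≠ 0 := by linarith
    have q4 : s - q ≠ 0 := by linarith
    rw [one_sub_invCross g1 g2 g3, Real.log_div (mul_ne_zero q1 q2) (mul_ne_zero q3 q4),
      Real.log_mul q1 q2, Real.log_mul q3 q4]
    ring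
  rw [key _ _ _ _ h1 h2 h3, key _ _ _ _ i1 i2 i3]
  unfold dualDist
  rw [logSlope_eq hm hw hz (by linarith), logSlope_eq hm hx hy h2,
    logSlope_eq hm hw hy (by linarith), logSlope_eq hm hx hz (by linarith)]
  ring

lemma abs_exp_neg_sub_one_le {x η : ℝ} (hx : |x| ≤ η) (hη : η ≤ 1) : |Real.exp (-x) - 1| ≤ 2 * η := by
  have := Real.abs_exp_sub_one_le (x := -x) (by rw [abs_neg]; linarith)
  rw [abs_neg] at this
  linarith

/-- The two complementary cross ratios add up to `1`. A small relative change of one is a small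
absolute change of the other, and this is again relatively small because the middle interval keeps
the other above `γ`. -/
lemma abs_dualDist_le (hm : StrictMonoOn h S) {w x y z : ℝ} (hw : w ∈ S) (hx : x ∈ S) (hy : y ∈ S)
    (hz : z ∈ S) (h1 : w < x) (h2 : x < y) (h3 : y < z) {γ η : ℝ} (hγ : 0 < γ)
    (hγx : γ * (z - w) ≤ y - x) (hη : |crossDist h w x y z| ≤ η) (hηγ : η ≤ γ / 4) :
    |dualDist h w x y z| ≤ 4 / γ * η := by
  have hτ := invCross_pos h1 h2 h3
  have e1 := one_sub_invCross h1 h2 h3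
  have hyw : 0 < y - w := by linarith
  have hzx : 0 < z - x := by linarith
  have hyx : 0 < y - x := by linarith
  have hγ1 : γ ≤ 1 := by
    by_contra hc
    nlinarith
  have hlow : γ ≤ 1 - invCross w x y z := by
    rw [e1, le_div_iff₀ (by positivity)]
    have q1 : (y - w) * (z - x) ≤ (z - w) * (z - w) :=
      mul_le_mul (by linarith) (by linarith) hzx.le (by linarith)
    nlinarith
  have hτ1 : invCross w x y z ≤ 1 := by linarith
  have hexp := abs_exp_neg_sub_one_le hη (by linarith)
  have himg := invCross_image hm hw hx hy hz h1 h2 h3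
  have hη0 : 0 ≤ η := (abs_nonneg _).trans hη
  have hdiff : |invCross (h w) (h x) (h y) (h z) - invCross w x y z| ≤ 2 * η := by
    have : invCross (h w) (h x) (h y) (h z) - invCross w x y z =
        invCross w x y z * (Real.exp (-crossDist h w x y z) - 1) := by rw [himg]; ring
    rw [this, abs_mul, abs_of_pos hτ]
    nlinarith [abs_nonneg (Real.exp (-crossDist h w x y z) - 1)]
  have hd := abs_le.1 hdiff
  rw [dualDist_eq_log hm hw hx hy hz h1 h2 h3]
  refine (abs_log_sub_log_le (m := γ / 2) (by linarith) (by linarith) (by linarith)).trans ?_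
  have e2 : 1 - invCross (h w) (h x) (h y) (h z) - (1 - invCross w x y z) =
      -(invCross (h w) (h x) (h y) (h z) - invCross w x y z) := by ring
  rw [e2, abs_neg, div_le_iff₀ (by linarith)]
  have : 4 / γ * η * (γ / 2) = 2 * η := by field_simp; ring
  linarith

/-- How the exponentiated ratio distortion of `w, x, y` changes when `y` is replaced by `z`. -/
lemma exp_ratio_extend_right (hm : StrictMonoOn h S) {w x y z : ℝ} (hw : w ∈ S) (hx : x ∈ S)
    (hy : y ∈ S) (hz : z ∈ S) (h1 : w < x) (h2 : x < y) (h3 : y < z) {K η : ℝ}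
    (hK : z - y ≤ K * (y - x)) (hη : |crossDist h w x y z| ≤ η) (hη1 : η ≤ 1) :
    |(Real.exp (logSlope h w x - logSlope h x y) - 1) -
      (y - w) / (z - w) * (Real.exp (logSlope h w x - logSlope h x z) - 1)| ≤
      2 * K * η * (Real.exp (logSlope h w x - logSlope h x y) + 1) := by
  have i1 := hm hw hx h1
  have i2 := hm hx hy h2
  have i3 := hm hy hz h3
  have himg := invCross_image hm hw hx hy hz h1 h2 h3
  have hexp := abs_exp_neg_sub_one_le hη hη1
  set κ := Real.exp (-crossDist h w x y z) with hκ
  have expLS : ∀ u v, u ∈ S → v ∈ S → u < v →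
      Real.exp (logSlope h u v) = (h v - h u) / (v - u) := fun u v hu hv huv =>
    Real.exp_log (div_pos (sub_pos.2 (hm hu hv huv)) (sub_pos.2 huv))
  set A := Real.exp (logSlope h w x - logSlope h x y) with hA
  have hA0 : 0 < A := Real.exp_pos _
  have eA : A = (h x - h w) / (x - w) / ((h y - h x) / (y - x)) := by
    rw [hA, Real.exp_sub, expLS w x hw hx h1, expLS x y hx hy h2]
  have eZ : Real.exp (logSlope h w x - logSlope h x z) =
      (h x - h w) / (x - w) / ((h z - h x) / (z - x)) := by
    rw [Real.exp_sub, expLS w x hw hx h1, expLS x z hx hz (by linarith)]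
  obtain ⟨p, hp, ep⟩ : ∃ p, 0 < p ∧ x = w + p := ⟨x - w, by linarith, by ring⟩
  obtain ⟨q, hq, eq⟩ : ∃ q, 0 < q ∧ y = w + p + q := ⟨y - x, by linarith, by rw [← ep]; ring⟩
  obtain ⟨s, hs, es⟩ : ∃ s, 0 < s ∧ z = w + p + q + s := ⟨z - y, by linarith, by rw [← eq]; ring⟩
  obtain ⟨P, hP, eP⟩ : ∃ P, 0 < P ∧ h x = h w + P := ⟨h x - h w, by linarith, by ring⟩
  obtain ⟨Q, hQ, eQ⟩ : ∃ Q, 0 < Q ∧ h y = h w + P + Q := ⟨h y - h x, by linarith, by rw [← eP]; ring⟩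
  obtain ⟨T, hT, eT⟩ : ∃ T, 0 < T ∧ h z = h w + P + Q + T :=
    ⟨h z - h y, by linarith, by rw [← eQ]; ring⟩
  have d1 : x - w = p := by rw [ep]; ring
  have d2 : y - x = q := by rw [ep, eq]; ring
  have d3 : z - y = s := by rw [es, eq]; ring
  have d4 : y - w = p + q := by rw [eq]; ring
  have d5 : z - x = q + s := by rw [ep, es]; ring
  have d6 : z - w = p + q + s := by rw [es]; ring
  have D1 : h x - h w = P := by rw [eP]; ring
  have D2 : h y - h x = Q := by rw [eP, eQ]; ring
  have D3 : h z - h y = T := by rw [eT, eQ]; ring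
  have D4 : h y - h w = P + Q := by rw [eQ]; ring
  have D5 : h z - h x = Q + T := by rw [eP, eT]; ring
  unfold invCross at himg
  rw [d1, d3, d4, d5, D1, D3, D4, D5] at himg
  have hκ' : κ = P * T * ((p + q) * (q + s)) / ((P + Q) * (Q + T) * (p * s)) := by
    field_simp at himg ⊢
    linarith
  rw [d1, d2, D1, D2] at eA
  rw [d1, d5, D1, D5] at eZ
  rw [eZ, d4, d6]
  rw [d2, d3] at hK
  -- An exact identity whose error term carries the factor `κ - 1`. For a Möbius map `κ = 1`, and
  -- the exponentiated distortion minus `1` is proportional to the distance of the last point from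
  -- the fixed endpoint `w`.
  have main : A - 1 - (p + q) / (p + q + s) * (P / p / ((Q + T) / (q + s)) - 1) =
      (p + q) / (p + q + s) * (s / q) * ((p * A + q) / (p + q)) * (κ - 1) := by
    rw [hκ', eA]
    field_simp
    ring
  rw [main, abs_mul]
  have b1 : (p + q) / (p + q + s) ≤ 1 := by rw [div_le_one (by positivity)]; linarith
  have b2 : s / q ≤ K := by rw [div_le_iff₀ hq]; exact hK
  have b3 : (p * A + q) / (p + q) ≤ A + 1 := by rw [div_le_iff₀ (by positivity)]; nlinarith
  have hK0 : 0 < K := (div_pos hs hq).trans_le b2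
  rw [abs_of_pos (by positivity)]
  calc (p + q) / (p + q + s) * (s / q) * ((p * A + q) / (p + q)) * |κ - 1|
      ≤ 1 * K * (A + 1) * (2 * η) := by gcongr
    _ = _ := by ring

lemma strictMonoOn_reflect (hm : StrictMonoOn h S) : StrictMonoOn (fun t => -h (-t)) (-S) := by
  intro x hx y hy hxy
  exact neg_lt_neg (hm hy hx (neg_lt_neg hxy))

lemma logSlope_reflect (x y : ℝ) : logSlope (fun t => -h (-t)) (-y) (-x) = logSlope h x y := by
  unfold logSlope
  congr 1
  simp only [neg_neg]
  congr 1 <;> ring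

/-- How the exponentiated ratio distortion of `x, y, z` changes when `x` is replaced by `w`. -/
lemma exp_ratio_extend_left (hm : StrictMonoOn h S) {w x y z : ℝ} (hw : w ∈ S) (hx : x ∈ S)
    (hy : y ∈ S) (hz : z ∈ S) (h1 : w < x) (h2 : x < y) (h3 : y < z) {K η : ℝ}
    (hK : x - w ≤ K * (y - x)) (hη : |crossDist h w x y z| ≤ η) (hη1 : η ≤ 1) :
    |(Real.exp (logSlope h y z - logSlope h x y) - 1) -
      (z - x) / (z - w) * (Real.exp (logSlope h y z - logSlope h w y) - 1)| ≤
      2 * K * η * (Real.exp (logSlope h y z - logSlope h x y) + 1) := by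
  have e : crossDist (fun t => -h (-t)) (-z) (-y) (-x) (-w) = crossDist h w x y z := by
    unfold crossDist
    simp only [logSlope_reflect]
    ring
  have := exp_ratio_extend_right (strictMonoOn_reflect hm) (w := -z) (x := -y) (y := -x) (z := -w)
    (by simpa) (by simpa) (by simpa) (by simpa) (by linarith) (by linarith) (by linarith)
    (K := K) (η := η) (by linarith) (by rw [e]; exact hη) hη1
  simp only [logSlope_reflect] at this
  have e1 : -x - -z = z - x := by ring
  have e2 : -w - -z = z - w := by ring
  rw [e1, e2] at this
  exact this

namespace OGrid

variable {G : OGrid B M a b}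

lemma X_sub_le {n s j : ℕ} (hj : j < G.N n) {i l : ℕ} (hil : i ≤ l) (hl : l ≤ G.N n)
    (h1 : l ≤ i + s) (h2 : i ≤ j) (h3 : j < l) :
    G.X n l - G.X n i ≤ s * B ^ s * G.p n j := by
  have hB := G.one_le
  have hp := G.p_pos hj
  have key : ∀ d, i + d ≤ l → G.X n (i + d) - G.X n i ≤ d * (B ^ s * G.p n j) := by
    intro d
    induction d with
    | zero => simp
    | succ d ih =>
      intro hd
      have q1 := ih (by omega)
      have q2 : G.p n (i + d) ≤ B ^ s * G.p n j :=
        G.p_le_pow (by omega) hj (by omega) (by omega)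
      unfold p at q2 q1 ⊢
      push_cast
      rw [← add_assoc]
      linarith
  have := key (l - i) (by omega)
  rw [Nat.add_sub_cancel' hil] at this
  refine this.trans ?_
  rw [mul_assoc]
  have : ((l - i : ℕ) : ℝ) ≤ s := by exact_mod_cast (by omega : l - i ≤ s)
  gcongr

/-- If the cross ratio distortions of consecutive intervals in a chain are small, then so are the
distortions of all cross ratios of points of the chain. -/
lemma exists_crossDist_bound (G : OGrid B M a b) (hm : StrictMonoOn h (Icc a b)) (s : ℕ) :
    ∃ C ε₀ : ℝ, 1 ≤ C ∧ 0 < ε₀ ∧ ∀ n lo hi ε, hi ≤ G.N n → 0 ≤ ε → ε ≤ ε₀ →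
      (∀ t, lo ≤ t → t + 3 ≤ hi → |G.cd h n t| ≤ ε) →
      ∀ i j k l, lo ≤ i → i < j → j < k → k < l → l ≤ hi → l ≤ i + s →
        |crossDist h (G.X n i) (G.X n j) (G.X n k) (G.X n l)| ≤ C * ε := by
  have hB := G.one_le
  induction s with
  | zero => exact ⟨1, 1, le_rfl, one_pos, by intros; omega⟩
  | succ s ih =>
    obtain ⟨C, ε₀, hC, hε₀, H⟩ := ih
    -- Every interval of a chain of `s + 1` consecutive intervals occupies at least this proportion
    -- of the chain, as `abs_dualDist_le` needs.
    set γ : ℝ := ((s + 1 : ℕ) * B ^ (s + 1))⁻¹ with hγ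
    have hγ0 : 0 < γ := by positivity
    set D : ℝ := C + 4 / γ * C with hD
    have hD1 : 1 ≤ D := by
      have : 0 ≤ 4 / γ * C := by positivity
      linarith
    refine ⟨(s + 1 : ℕ) * D, min ε₀ (γ / (4 * C)), ?_, by positivity, ?_⟩
    · have : (1 : ℝ) ≤ (s + 1 : ℕ) := by exact_mod_cast (by omega : 1 ≤ s + 1)
      nlinarith
    intro n lo hi ε hhi hε0 hε hcd i j k l hlo hij hjk hkl hl hls
    have hε1 : ε ≤ ε₀ := hε.trans (min_le_left _ _)
    have hε2 : C * ε ≤ γ / 4 := by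
      have := hε.trans (min_le_right _ _)
      rw [le_div_iff₀ (by positivity)] at this
      linarith
    have H' := H n lo hi ε hhi hε0 hε1 hcd
    have hdual : ∀ w x y z, lo ≤ w → w < x → x < y → y < z → z ≤ hi → z ≤ w + s →
        |dualDist h (G.X n w) (G.X n x) (G.X n y) (G.X n z)| ≤ 4 / γ * (C * ε) := by
      intro w x y z hw hwx hxy hyz hz hzs
      refine abs_dualDist_le hm (G.X_mem (by omega)) (G.X_mem (by omega)) (G.X_mem (by omega))
        (G.X_mem (by omega)) (G.X_lt_X hwx (by omega)) (G.X_lt_X hxy (by omega))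
        (G.X_lt_X hyz (by omega)) hγ0 ?_ (H' w x y z hw hwx hxy hyz hz hzs) hε2
      have q1 := X_sub_le (G := G) (n := n) (s := s + 1) (j := x) (by omega) (i := w) (l := z)
        (by omega) (by omega) (by omega) (by omega) (by omega)
      have q2 := G.X_le_X (n := n) (i := x + 1) (j := y) hxy (by omega)
      rw [hγ, inv_mul_le_iff₀ (by positivity)]
      refine q1.trans (mul_le_mul_of_nonneg_left ?_ (by positivity))
      unfold p; linarith
    -- When the two middle points are consecutive, moving an outer endpoint one step inwards costs a
    -- `dualDist`. Both resulting terms live on shorter chains, where the induction hypothesis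
    -- applies; only the chain of three intervals uses the assumption directly.
    have hadj : ∀ t, i < t → t + 1 < l →
        |crossDist h (G.X n i) (G.X n t) (G.X n (t + 1)) (G.X n l)| ≤ D * ε := by
      intro t ht1 ht2
      have hCε : 0 ≤ C * ε := by positivity
      have hdε : 0 ≤ 4 / γ * (C * ε) := by positivity
      have eD : D * ε = C * ε + 4 / γ * (C * ε) := by rw [hD]; ring
      by_cases c1 : i + 1 < t
      · have g1 := H' (i + 1) t (t + 1) l (by omega) c1 (by omega) ht2 hl (by omega)
        have g2 := hdual i (i + 1) t (t + 1) hlo (by omega) c1 (by omega) (by omega) (by omega)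
        have e : crossDist h (G.X n i) (G.X n t) (G.X n (t + 1)) (G.X n l) =
            crossDist h (G.X n (i + 1)) (G.X n t) (G.X n (t + 1)) (G.X n l) +
            dualDist h (G.X n i) (G.X n (i + 1)) (G.X n t) (G.X n (t + 1)) := by
          unfold crossDist dualDist; ring
        rw [e, eD]
        exact (abs_add_le _ _).trans (add_le_add g1 g2)
      · obtain rfl : t = i + 1 := by omega
        by_cases c2 : l = i + 3
        · subst c2
          have := hcd i hlo hl
          refine this.trans ?_
          nlinarith
        · obtain ⟨l, rfl⟩ : ∃ l', l = l' + 1 := ⟨l - 1, by omega⟩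
          have g1 := H' i (i + 1) (i + 1 + 1) l hlo (by omega) (by omega) (by omega) (by omega)
            (by omega)
          have g2 := hdual (i + 1) (i + 1 + 1) l (l + 1) (by omega) (by omega) (by omega)
            (by omega) (by omega) (by omega)
          have e : crossDist h (G.X n i) (G.X n (i + 1)) (G.X n (i + 1 + 1)) (G.X n (l + 1)) =
              crossDist h (G.X n i) (G.X n (i + 1)) (G.X n (i + 1 + 1)) (G.X n l) +
              dualDist h (G.X n (i + 1)) (G.X n (i + 1 + 1)) (G.X n l) (G.X n (l + 1)) := by
            unfold crossDist dualDist; ring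
          rw [e, eD]
          exact (abs_add_le _ _).trans (add_le_add g1 g2)
    -- With the outer points fixed, `crossDist` is additive in the middle interval.
    have hsum : ∀ d, j + d + 1 < l →
        |crossDist h (G.X n i) (G.X n j) (G.X n (j + d + 1)) (G.X n l)| ≤ (d + 1 : ℕ) * (D * ε) := by
      intro d
      induction d with
      | zero => intro hd; simpa using hadj j hij hd
      | succ d ihd =>
        intro hd
        have g1 := ihd (by omega)
        have g2 := hadj (j + d + 1) (by omega) (by omega)
        have e : crossDist h (G.X n i) (G.X n j) (G.X n (j + (d + 1) + 1)) (G.X n l) =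
            crossDist h (G.X n i) (G.X n j) (G.X n (j + d + 1)) (G.X n l) +
            crossDist h (G.X n i) (G.X n (j + d + 1)) (G.X n (j + d + 1 + 1)) (G.X n l) := by
          unfold crossDist
          have : j + (d + 1) + 1 = j + d + 1 + 1 := by ring
          rw [this]; ring
        rw [e]
        refine (abs_add_le _ _).trans ?_
        push_cast at g1 ⊢
        linarith
    have := hsum (k - j - 1) (by omega)
    have ek : j + (k - j - 1) + 1 = k := by omega
    rw [ek] at this
    refine this.trans ?_
    rw [mul_assoc]
    have : ((k - j - 1 + 1 : ℕ) : ℝ) ≤ (s + 1 : ℕ) := by exact_mod_cast (by omega)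
    gcongr

end OGrid

end GridSmoothness

/-! ### Contraction and linearization of ratio distortions along chains. -/

namespace GridSmoothness

variable {B : ℝ} {M : ℕ} {a b : ℝ} {h : ℝ → ℝ}

/-- For `r < 0` one passes to reciprocals, and the harmonic mean of `1` and `exp |ρ|` with weights
`1 - θ` and `θ` is at most the arithmetic one. Bounds in `|r|` and `|ρ|` do not see signs, so that
steps for `r` and for `-r` can be composed. -/
lemma exp_abs_sub_one_le {r ρ θ δ R : ℝ} (hr : |r| ≤ R) (hρ : |ρ| ≤ R) (hθ : 0 ≤ θ) (hθ1 : θ ≤ 1)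
    (H : |(Real.exp r - 1) - θ * (Real.exp ρ - 1)| ≤ δ) :
    Real.exp |r| - 1 ≤ θ * (Real.exp |ρ| - 1) + Real.exp (2 * R) * δ := by
  have hδ : 0 ≤ δ := (abs_nonneg _).trans H
  have hR : 0 ≤ R := (abs_nonneg _).trans hr
  have hH := abs_le.1 H
  rcases le_total 0 r with h0 | h0
  · rw [abs_of_nonneg h0]
    have h1 : Real.exp ρ ≤ Real.exp |ρ| := Real.exp_le_exp.2 (le_abs_self ρ)
    have h2 : θ * Real.exp ρ ≤ θ * Real.exp |ρ| := mul_le_mul_of_nonneg_left h1 hθ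
    have h3 : (1 : ℝ) ≤ Real.exp (2 * R) := Real.one_le_exp (by linarith)
    nlinarith [hH.2]
  · set E := Real.exp |ρ| with hE
    set Q := Real.exp |r| with hQ
    have hE1 : 1 ≤ E := Real.one_le_exp (abs_nonneg _)
    have hQ0 : 0 < Q := Real.exp_pos _
    have hE0 : 0 < E := by linarith
    have e1 : Real.exp r = Q⁻¹ := by rw [hQ, abs_of_nonpos h0, Real.exp_neg, inv_inv]
    have e2 : E⁻¹ ≤ Real.exp ρ := by
      rw [hE, ← Real.exp_neg]; exact Real.exp_le_exp.2 (neg_abs_le ρ)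
    have e3 : Q * E ≤ Real.exp (2 * R) := by
      rw [hQ, hE, ← Real.exp_add]; exact Real.exp_le_exp.2 (by linarith)
    have e4 : 1 + θ * (E⁻¹ - 1) - δ ≤ Q⁻¹ := by
      have : θ * E⁻¹ ≤ θ * Real.exp ρ := mul_le_mul_of_nonneg_left e2 hθ
      rw [← e1]; linarith [hH.1]
    have e5 : Q * (E - θ * (E - 1)) ≤ E + δ * (Q * E) := by
      have := mul_le_mul_of_nonneg_left e4 (mul_pos hQ0 hE0).le
      have u1 : Q * E * (1 + θ * (E⁻¹ - 1) - δ) = Q * (E - θ * (E - 1)) - δ * (Q * E) := by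
        field_simp; ring
      have u2 : Q * E * Q⁻¹ = E := by field_simp
      linarith
    have hP1 : 1 ≤ E - θ * (E - 1) := by nlinarith
    have e6 : E ≤ (1 + θ * (E - 1)) * (E - θ * (E - 1)) := by
      nlinarith [mul_nonneg hθ (sub_nonneg.2 hθ1), sq_nonneg (E - 1),
        mul_nonneg (mul_nonneg hθ (sub_nonneg.2 hθ1)) (sq_nonneg (E - 1))]
    have e7 : δ * (Q * E) ≤ Real.exp (2 * R) * δ := by
      rw [mul_comm]; exact mul_le_mul_of_nonneg_right e3 hδ
    have e8 : 0 ≤ Real.exp (2 * R) * δ := by positivity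
    by_contra hc
    push Not at hc
    have : (1 + θ * (E - 1) + Real.exp (2 * R) * δ) * (E - θ * (E - 1)) < Q * (E - θ * (E - 1)) :=
      mul_lt_mul_of_pos_right (by linarith) (by linarith)
    nlinarith

lemma abs_exp_sub_one_sub_le {x R : ℝ} (hx : |x| ≤ R) :
    |Real.exp x - 1 - x| ≤ Real.exp R * x ^ 2 := by
  have h1 := Real.add_one_le_exp x
  have h2 := Real.add_one_le_exp (-x)
  have h3 : Real.exp x * Real.exp (-x) = 1 := by rw [← Real.exp_add]; simp
  have h4 := Real.exp_pos x
  have h5 : Real.exp x - 1 ≤ x * Real.exp x := by nlinarith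
  have h6 : Real.exp x ≤ Real.exp R := Real.exp_le_exp.2 ((le_abs_self x).trans hx)
  have h7 : 1 ≤ Real.exp R := Real.one_le_exp ((abs_nonneg x).trans hx)
  rw [abs_of_nonneg (by linarith)]
  rcases le_total 0 x with h0 | h0
  · have : x * (x * Real.exp x) ≤ x ^ 2 * Real.exp R := by
      nlinarith [mul_nonneg (sq_nonneg x) (sub_nonneg.2 h6)]
    nlinarith
  · nlinarith [mul_nonneg (sq_nonneg x) (sub_nonneg.2 h7)]

/-- Since `exp x - 1` equals `x` up to `O (x ^ 2)`, the exponentials may be dropped at a quadratic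
cost. -/
lemma abs_sub_mul_le {r ρ θ δ R T : ℝ} (hr : |r| ≤ T) (hρ : |ρ| ≤ T) (hTR : T ≤ R) (hθ : 0 ≤ θ)
    (hθ1 : θ ≤ 1) (H : |(Real.exp r - 1) - θ * (Real.exp ρ - 1)| ≤ δ) :
    |r - θ * ρ| ≤ δ + 2 * Real.exp R * T ^ 2 := by
  have h1 := abs_exp_sub_one_sub_le (hr.trans hTR)
  have h2 := abs_exp_sub_one_sub_le (hρ.trans hTR)
  have hE := Real.exp_pos R
  have h3 : Real.exp R * r ^ 2 ≤ Real.exp R * T ^ 2 :=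
    mul_le_mul_of_nonneg_left (sq_le_sq' (abs_le.1 hr).1 (abs_le.1 hr).2) hE.le
  have h4 : Real.exp R * ρ ^ 2 ≤ Real.exp R * T ^ 2 :=
    mul_le_mul_of_nonneg_left (sq_le_sq' (abs_le.1 hρ).1 (abs_le.1 hρ).2) hE.le
  have h5 : |θ * (Real.exp ρ - 1 - ρ)| ≤ Real.exp R * T ^ 2 := by
    rw [abs_mul, abs_of_nonneg hθ]
    nlinarith [abs_nonneg (Real.exp ρ - 1 - ρ)]
  rw [abs_le] at *
  constructor <;> linarith [h1.1, h1.2, h5.1, h5.2, H.1, H.2]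

namespace OGrid

variable {G : OGrid B M a b}

lemma abs_logSlope_sub_ls_le (hm : StrictMonoOn h (Icc a b)) {n lo hi s : ℕ} (hhi : hi ≤ G.N n)
    (hs : hi ≤ lo + s) {ρ : ℝ} (hρ : 0 ≤ ρ) (hr : ∀ t, lo ≤ t → t + 2 ≤ hi → |G.r h n t| ≤ ρ)
    {i j : ℕ} (hi1 : lo ≤ i) (hij : i < j) (hj : j ≤ hi) :
    |logSlope h (G.X n i) (G.X n j) - G.ls h n lo| ≤ s * ρ := by
  refine abs_logSlope_chain_sub_le hm hij (fun t t1 t2 => G.X_lt n t (by omega))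
    (fun t t1 t2 => G.X_mem (by omega)) fun t t1 t2 => ?_
  refine (abs_ls_sub_le (k := hi - 1) (fun t' q1 q2 => hr t' q1 (by omega))
    (by omega : lo ≤ t) (by omega)).trans ?_
  gcongr
  omega

/-- Comparison of the ratio distortion of two consecutive intervals in a chain with the ratio
distortion of two blocks that make up the chain, in two steps. -/
lemma exists_two_step (G : OGrid B M a b) (hm : StrictMonoOn h (Icc a b)) (s : ℕ) {K₁ : ℝ}
    (hK₁ : 0 ≤ K₁) :
    ∃ C ε₀ : ℝ, 0 ≤ C ∧ 0 < ε₀ ∧ ∀ n lo hi f k ε ρ, hi ≤ G.N n → hi ≤ lo + s → lo ≤ f →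
      f + 2 ≤ hi → lo < k → k < hi → 0 ≤ ε → ε ≤ ε₀ → 0 ≤ ρ → ρ ≤ K₁ →
      (∀ t, lo ≤ t → t + 3 ≤ hi → |G.cd h n t| ≤ ε) →
      (∀ t, lo ≤ t → t + 2 ≤ hi → |G.r h n t| ≤ ρ) →
      ∃ r₂ rc : ℝ, rc = logSlope h (G.X n k) (G.X n hi) - logSlope h (G.X n lo) (G.X n k) ∧
        |G.r h n f| ≤ 2 * s * ρ ∧ |r₂| ≤ 2 * s * ρ ∧ |rc| ≤ 2 * s * ρ ∧
        |(Real.exp (G.r h n f) - 1) - (G.X n (f + 2) - G.X n f) / (G.X n (f + 2) - G.X n lo) *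
          (Real.exp r₂ - 1)| ≤ C * ε ∧
        |(Real.exp (-r₂) - 1) - (G.X n (f + 2) - G.X n lo) / (G.X n hi - G.X n lo) *
          (Real.exp (-rc) - 1)| ≤ C * ε := by
  have hB := G.one_le
  obtain ⟨C₀, ε₁, hC₀, hε₁, H⟩ := G.exists_crossDist_bound hm s
  set R : ℝ := 2 * s * K₁ with hR
  have hR0 : 0 ≤ R := by positivity
  set K : ℝ := s * B ^ s with hK
  have hK0 : 0 ≤ K := by positivity
  refine ⟨2 * K * C₀ * (Real.exp R + 1) + Real.exp R * C₀, min ε₁ (1 / C₀), by positivity,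
    by positivity, ?_⟩
  intro n lo hi f k ε ρ hhi hs hf1 hf2 hk1 hk2 hε hε₀ hρ hρK hcd hr
  have hCε : C₀ * ε ≤ 1 := by
    have := hε₀.trans (min_le_right _ _)
    rw [le_div_iff₀ (by positivity)] at this
    linarith
  have hCε0 : 0 ≤ C₀ * ε := by positivity
  have H' := H n lo hi ε hhi hε (hε₀.trans (min_le_left _ _)) hcd
  have hLS := fun i j (q1 : lo ≤ i) (q2 : i < j) (q3 : j ≤ hi) =>
    abs_logSlope_sub_ls_le hm hhi hs hρ hr q1 q2 q3
  have hdiff : ∀ i j i' j', lo ≤ i → i < j → j ≤ hi → lo ≤ i' → i' < j' → j' ≤ hi →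
      |logSlope h (G.X n i) (G.X n j) - logSlope h (G.X n i') (G.X n j')| ≤ 2 * s * ρ := by
    intro i j i' j' q1 q2 q3 q4 q5 q6
    have g1 := abs_le.1 (hLS i j q1 q2 q3)
    have g2 := abs_le.1 (hLS i' j' q4 q5 q6)
    rw [abs_le]; constructor <;> linarith [g1.1, g1.2, g2.1, g2.2]
  have hρR : 2 * s * ρ ≤ R := by rw [hR]; gcongr
  have hmem : ∀ i, i ≤ hi → G.X n i ∈ Icc a b := fun i q => G.X_mem (q.trans hhi)
  have hexp : ∀ x : ℝ, |x| ≤ 2 * s * ρ → Real.exp x ≤ Real.exp R := fun x hx =>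
    Real.exp_le_exp.2 ((le_abs_self x).trans (hx.trans hρR))
  have herr : ∀ x : ℝ, |x| ≤ 2 * s * ρ →
      2 * K * (C₀ * ε) * (Real.exp x + 1) ≤ 2 * K * C₀ * (Real.exp R + 1) * ε := by
    intro x hx
    calc 2 * K * (C₀ * ε) * (Real.exp x + 1) ≤ 2 * K * (C₀ * ε) * (Real.exp R + 1) := by
          have := hexp x hx
          gcongr
      _ = _ := by ring
  have hgeom : ∀ j, lo ≤ j → j < hi → G.X n hi - G.X n lo ≤ K * (G.X n (j + 1) - G.X n j) :=
    fun j q1 q2 => X_sub_le (G := G) (by omega) (by omega) hhi hs q1 q2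
  have hErε : 0 ≤ Real.exp R * C₀ * ε := by positivity
  -- The left interval is first extended to `lo` with the right end `f + 2` fixed, which gives `r₂`.
  -- Then the right interval is extended to `hi` with `lo` fixed, which is a statement about `-r₂`.
  -- Finally the division point `f + 1` is moved to `k`, at the cost of one `crossDist`.
  refine ⟨logSlope h (G.X n (f + 1)) (G.X n (f + 2)) - logSlope h (G.X n lo) (G.X n (f + 1)), _, rfl,
    hdiff _ _ _ _ (by omega) (by omega) (by omega) hf1 (by omega) (by omega),
    hdiff _ _ _ _ (by omega) (by omega) (by omega) le_rfl (by omega) (by omega),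
    hdiff _ _ _ _ (by omega) (by omega) (by omega) le_rfl (by omega) (by omega), ?_, ?_⟩
  · rcases hf1.eq_or_lt with rfl | hlt
    · have hne : G.X n (lo + 2) - G.X n lo ≠ 0 :=
        sub_ne_zero.2 (G.X_lt_X (by omega) (by omega)).ne'
      rw [div_self hne]
      change |(Real.exp (logSlope h (G.X n (lo + 1)) (G.X n (lo + 2)) -
        logSlope h (G.X n lo) (G.X n (lo + 1))) - 1) - _| ≤ _
      rw [one_mul, sub_self, abs_zero]
      positivity
    · have g1 := exp_ratio_extend_left hm (hmem lo (by omega)) (hmem f (by omega))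
        (hmem (f + 1) (by omega)) (hmem (f + 2) hf2) (G.X_lt_X hlt (by omega))
        (G.X_lt_X (by omega) (by omega)) (G.X_lt_X (by omega) (by omega)) (K := K) (η := C₀ * ε)
        (by
          have q1 := hgeom f hf1 (by omega)
          have q2 := G.X_le_X (n := n) (i := f) (j := hi) (by omega) hhi
          linarith)
        (H' lo f (f + 1) (f + 2) le_rfl hlt (by omega) (by omega) hf2 (by omega)) hCε
      refine g1.trans ((herr _ (hdiff _ _ _ _ (by omega) (by omega) (by omega) hf1 (by omega)
        (by omega))).trans ?_)
      rw [add_mul]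
      linarith
  · set r₂ := logSlope h (G.X n (f + 1)) (G.X n (f + 2)) - logSlope h (G.X n lo) (G.X n (f + 1))
      with hr₂
    set r₃ := logSlope h (G.X n (f + 1)) (G.X n hi) - logSlope h (G.X n lo) (G.X n (f + 1)) with hr₃
    set rc := logSlope h (G.X n k) (G.X n hi) - logSlope h (G.X n lo) (G.X n k) with hrc
    set θ := (G.X n (f + 2) - G.X n lo) / (G.X n hi - G.X n lo) with hθ
    have l1 := G.X_lt_X (n := n) (i := lo) (j := f + 2) (by omega) (by omega)
    have l2 := G.X_le_X (n := n) (i := f + 2) (j := hi) (by omega) (by omega)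
    have hθ0 : 0 ≤ θ := div_nonneg (by linarith) (by linarith)
    have hθ1 : θ ≤ 1 := by rw [hθ, div_le_one (by linarith)]; linarith
    have b2 : |r₂| ≤ 2 * s * ρ :=
      hdiff _ _ _ _ (by omega) (by omega) (by omega) le_rfl (by omega) (by omega)
    have b3 : |r₃| ≤ 2 * s * ρ :=
      hdiff _ _ _ _ (by omega) (by omega) (by omega) le_rfl (by omega) (by omega)
    have bc : |rc| ≤ 2 * s * ρ :=
      hdiff _ _ _ _ (by omega) (by omega) (by omega) le_rfl (by omega) (by omega)
    have g1 : |(Real.exp (-r₂) - 1) - θ * (Real.exp (-r₃) - 1)| ≤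
        2 * K * C₀ * (Real.exp R + 1) * ε := by
      rcases hf2.eq_or_lt with heq | hlt
      · have : θ = 1 := by rw [hθ, heq]; exact div_self (by rw [heq] at l1; linarith)
        rw [this, hr₃, ← heq, hr₂, one_mul, sub_self, abs_zero]
        positivity
      · have := exp_ratio_extend_right hm (hmem lo (by omega)) (hmem (f + 1) (by omega))
          (hmem (f + 2) (by omega)) (hmem hi le_rfl) (G.X_lt_X (by omega) (by omega))
          (G.X_lt_X (by omega) (by omega)) (G.X_lt_X hlt hhi) (K := K) (η := C₀ * ε)
          (by
            have q1 := hgeom (f + 1) (by omega) (by omega)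
            have q2 : G.X n (f + 1 + 1) = G.X n (f + 2) := rfl
            rw [q2] at q1
            linarith)
          (H' lo (f + 1) (f + 2) hi le_rfl (by omega) (by omega) hlt le_rfl hs) hCε
        rw [hr₂, hr₃, neg_sub, neg_sub]
        refine this.trans (herr _ ?_)
        rw [abs_sub_comm]; exact b2
    have g2 : |r₃ - rc| ≤ C₀ * ε := by
      rcases lt_trichotomy (f + 1) k with hlt | heq | hlt
      · have := H' lo (f + 1) k hi le_rfl (by omega) hlt hk2 le_rfl hs
        have e : r₃ - rc = crossDist h (G.X n lo) (G.X n (f + 1)) (G.X n k) (G.X n hi) := by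
          rw [hr₃, hrc]; unfold crossDist; ring
        rw [e]; exact this
      · rw [hr₃, hrc, heq, sub_self, abs_zero]; exact hCε0
      · have := H' lo k (f + 1) hi le_rfl hk1 hlt (by omega) le_rfl hs
        have e : rc - r₃ = crossDist h (G.X n lo) (G.X n k) (G.X n (f + 1)) (G.X n hi) := by
          rw [hr₃, hrc]; unfold crossDist; ring
        rw [abs_sub_comm, e]; exact this
    have g3 : |Real.exp (-r₃) - Real.exp (-rc)| ≤ Real.exp R * C₀ * ε := by
      refine (abs_exp_sub_exp_le (K := R) ((neg_le_abs _).trans (b3.trans hρR))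
        ((neg_le_abs _).trans (bc.trans hρR))).trans ?_
      have e : -r₃ - -rc = -(r₃ - rc) := by ring
      rw [e, abs_neg, mul_assoc]
      exact mul_le_mul_of_nonneg_left g2 (Real.exp_pos _).le
    have e : (Real.exp (-r₂) - 1) - θ * (Real.exp (-rc) - 1) =
        ((Real.exp (-r₂) - 1) - θ * (Real.exp (-r₃) - 1)) +
          θ * (Real.exp (-r₃) - Real.exp (-rc)) := by ring
    rw [e, add_mul]
    refine (abs_add_le _ _).trans (add_le_add g1 ?_)
    rw [abs_mul, abs_of_nonneg hθ0]
    exact (mul_le_of_le_one_left (abs_nonneg _) hθ1).trans g3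

lemma two_step_proportions {n lo hi f : ℕ} (hhi : hi ≤ G.N n) (hf1 : lo ≤ f) (hf2 : f + 2 ≤ hi) :
    let θ₁ := (G.X n (f + 2) - G.X n f) / (G.X n (f + 2) - G.X n lo)
    let θ₂ := (G.X n (f + 2) - G.X n lo) / (G.X n hi - G.X n lo)
    0 ≤ θ₁ ∧ θ₁ ≤ 1 ∧ 0 ≤ θ₂ ∧ θ₂ ≤ 1 ∧
      θ₁ * θ₂ = (G.X n (f + 2) - G.X n f) / (G.X n hi - G.X n lo) := by
  have l1 := G.X_lt_X (n := n) (i := lo) (j := f + 2) (by omega) (by omega)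
  have l2 := G.X_le_X (n := n) (i := f + 2) (j := hi) (by omega) (by omega)
  have l3 := G.X_lt_X (n := n) (i := f) (j := f + 2) (by omega) (by omega)
  have l4 := G.X_le_X (n := n) (i := lo) (j := f) (by omega) (by omega)
  have l5 : G.X n (f + 2) - G.X n lo ≠ 0 := by linarith
  refine ⟨div_nonneg (by linarith) (by linarith), ?_, div_nonneg (by linarith) (by linarith), ?_, ?_⟩
  · rw [div_le_one (by linarith)]; linarith
  · rw [div_le_one (by linarith)]; linarith
  · field_simp

/-- The exponentiated ratio distortion contracts from a chain to two consecutive members. -/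
lemma exists_contraction (G : OGrid B M a b) (hm : StrictMonoOn h (Icc a b)) (s : ℕ) {K₁ : ℝ}
    (hK₁ : 0 ≤ K₁) :
    ∃ C : ℝ, 0 ≤ C ∧ ∀ n lo hi f k ε, hi ≤ G.N n → hi ≤ lo + s → lo ≤ f →
      f + 2 ≤ hi → lo < k → k < hi → 0 ≤ ε →
      (∀ t, lo ≤ t → t + 3 ≤ hi → |G.cd h n t| ≤ ε) →
      (∀ t, lo ≤ t → t + 2 ≤ hi → |G.r h n t| ≤ K₁) →
      Real.exp |G.r h n f| - 1 ≤ (G.X n (f + 2) - G.X n f) / (G.X n hi - G.X n lo) *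
        (Real.exp |logSlope h (G.X n k) (G.X n hi) - logSlope h (G.X n lo) (G.X n k)| - 1) +
          C * ε := by
  obtain ⟨C, ε₀, hC, hε₀, H⟩ := G.exists_two_step hm s hK₁
  set R : ℝ := 2 * s * K₁ with hR
  -- The first summand collects the errors of the two steps; the second makes the claim trivial for
  -- `ε > ε₀`, where the bound `K₁` is enough.
  refine ⟨2 * Real.exp (2 * R) * C + Real.exp K₁ / ε₀, by positivity, ?_⟩
  intro n lo hi f k ε hhi hs hf1 hf2 hk1 hk2 hε hcd hr
  obtain ⟨t1, t2, t3, t4, t5⟩ := two_step_proportions (G := G) hhi hf1 hf2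
  have hA : 0 ≤ 2 * Real.exp (2 * R) * C * ε := by positivity
  have hD : 0 ≤ Real.exp K₁ / ε₀ * ε := by positivity
  rcases le_or_gt ε ε₀ with hle | hgt
  · obtain ⟨r₂, rc, hrc, b1, b2, b3, g1, g2⟩ := H n lo hi f k ε K₁ hhi hs hf1 hf2 hk1 hk2 hε hle
      hK₁ le_rfl hcd hr
    rw [← hrc]
    have u1 := exp_abs_sub_one_le b1 b2 t1 t2 g1
    have u2 := exp_abs_sub_one_le (R := R) (by rwa [abs_neg]) (by rwa [abs_neg]) t3 t4 g2
    rw [abs_neg, abs_neg] at u2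
    have u3 := mul_le_mul_of_nonneg_left u2 t1
    have u4 : 0 ≤ Real.exp (2 * R) * (C * ε) := by positivity
    have u5 := mul_le_mul_of_nonneg_right t2 u4
    rw [mul_add, ← mul_assoc, t5] at u3
    rw [add_mul]
    linarith
  · have u1 := Real.exp_le_exp.2 (hr f hf1 hf2)
    have u2 : Real.exp K₁ ≤ Real.exp K₁ / ε₀ * ε := by
      rw [div_mul_eq_mul_div, le_div_iff₀ hε₀]
      exact mul_le_mul_of_nonneg_left hgt.le (Real.exp_pos _).le
    have u3 : 0 ≤ (G.X n (f + 2) - G.X n f) / (G.X n hi - G.X n lo) *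
        (Real.exp |logSlope h (G.X n k) (G.X n hi) - logSlope h (G.X n lo) (G.X n k)| - 1) := by
      rw [← t5]
      exact mul_nonneg (mul_nonneg t1 t3) (sub_nonneg.2 (Real.one_le_exp (abs_nonneg _)))
    rw [add_mul]
    linarith

/-- To first order the ratio distortion is proportional to the length. -/
lemma exists_linearization (G : OGrid B M a b) (hm : StrictMonoOn h (Icc a b)) (s : ℕ) {K₁ : ℝ}
    (hK₁ : 0 ≤ K₁) :
    ∃ C : ℝ, 0 ≤ C ∧ ∀ n lo hi f k ε ρ, hi ≤ G.N n → hi ≤ lo + s → lo ≤ f →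
      f + 2 ≤ hi → lo < k → k < hi → 0 ≤ ε → 0 ≤ ρ → ρ ≤ K₁ →
      (∀ t, lo ≤ t → t + 3 ≤ hi → |G.cd h n t| ≤ ε) →
      (∀ t, lo ≤ t → t + 2 ≤ hi → |G.r h n t| ≤ ρ) →
      |G.r h n f - (G.X n (f + 2) - G.X n f) / (G.X n hi - G.X n lo) *
        (logSlope h (G.X n k) (G.X n hi) - logSlope h (G.X n lo) (G.X n k))| ≤
          C * (ε + ρ ^ 2) := by
  obtain ⟨C, ε₀, hC, hε₀, H⟩ := G.exists_two_step hm s hK₁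
  set R : ℝ := 2 * s * K₁ with hR
  set A : ℝ := 4 * Real.exp R * (2 * s) ^ 2 with hA
  have hA0 : 0 ≤ A := by positivity
  have hR0 : 0 ≤ R := by positivity
  -- `A` collects the quadratic errors of the two steps, and the last summand covers `ε > ε₀`, where
  -- both terms on the left are at most `R`.
  refine ⟨2 * C + A + 2 * R / ε₀, by positivity, ?_⟩
  intro n lo hi f k ε ρ hhi hs hf1 hf2 hk1 hk2 hε hρ hρK hcd hr
  obtain ⟨t1, t2, t3, t4, t5⟩ := two_step_proportions (G := G) hhi hf1 hf2
  have z1 : 0 ≤ C * ρ ^ 2 := by positivity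
  have z2 : 0 ≤ A * ε := by positivity
  have z3 : 0 ≤ 2 * R / ε₀ * (ε + ρ ^ 2) := by positivity
  have z4 : 0 ≤ C * ε := by positivity
  have z5 : 0 ≤ A * ρ ^ 2 := by positivity
  have hρR : 2 * s * ρ ≤ R := by rw [hR]; gcongr
  rcases le_or_gt ε ε₀ with hle | hgt
  · obtain ⟨r₂, rc, hrc, b1, b2, b3, g1, g2⟩ := H n lo hi f k ε ρ hhi hs hf1 hf2 hk1 hk2 hε hle
      hρ hρK hcd hr
    rw [← hrc]
    have u1 := abs_sub_mul_le b1 b2 hρR t1 t2 g1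
    have u2 := abs_sub_mul_le (R := R) (by rwa [abs_neg]) (by rwa [abs_neg]) hρR t3 t4 g2
    have e1 : 2 * Real.exp R * (2 * s * ρ) ^ 2 = A / 2 * ρ ^ 2 := by rw [hA]; ring
    rw [e1] at u1 u2
    set θ₁ := (G.X n (f + 2) - G.X n f) / (G.X n (f + 2) - G.X n lo)
    set θ₂ := (G.X n (f + 2) - G.X n lo) / (G.X n hi - G.X n lo)
    have e2 : G.r h n f - (G.X n (f + 2) - G.X n f) / (G.X n hi - G.X n lo) * rc =
        (G.r h n f - θ₁ * r₂) + -(θ₁ * (-r₂ - θ₂ * -rc)) := by rw [← t5]; ring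
    rw [e2]
    refine (abs_add_le _ _).trans ?_
    rw [abs_neg, abs_mul, abs_of_nonneg t1]
    have u3 := (mul_le_of_le_one_left (abs_nonneg (-r₂ - θ₂ * -rc)) t2).trans u2
    linarith
  · have hLS := fun i j (q1 : lo ≤ i) (q2 : i < j) (q3 : j ≤ hi) =>
      (abs_logSlope_sub_ls_le hm hhi hs hρ hr q1 q2 q3)
    have g1 := hLS f (f + 1) hf1 (by omega) (by omega)
    have g2 := hLS (f + 1) (f + 2) (by omega) (by omega) (by omega)
    have g3 := hLS lo k le_rfl hk1 hk2.le
    have g4 := hLS k hi hk1.le hk2 le_rfl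
    set rc := logSlope h (G.X n k) (G.X n hi) - logSlope h (G.X n lo) (G.X n k) with hrc
    have b1 : |G.r h n f| ≤ R := by
      change |logSlope h (G.X n (f + 1)) (G.X n (f + 2)) - logSlope h (G.X n f) (G.X n (f + 1))| ≤ R
      rw [abs_le] at g1 g2 ⊢; constructor <;> linarith [g1.1, g1.2, g2.1, g2.2]
    have b2 : |rc| ≤ R := by
      rw [abs_le] at g3 g4 ⊢; constructor <;> linarith [g3.1, g3.2, g4.1, g4.2]
    have b3 : 2 * R ≤ 2 * R / ε₀ * (ε + ρ ^ 2) := by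
      rw [div_mul_eq_mul_div, le_div_iff₀ hε₀]
      exact mul_le_mul_of_nonneg_left (by nlinarith) (by linarith)
    have b4 : |(G.X n (f + 2) - G.X n f) / (G.X n hi - G.X n lo) * rc| ≤ R := by
      rw [← t5, abs_mul, abs_of_nonneg (mul_nonneg t1 t3)]
      exact (mul_le_of_le_one_left (abs_nonneg _) (mul_le_one₀ t2 t3 t4)).trans b2
    refine (abs_sub _ _).trans ?_
    linarith

end OGrid

end GridSmoothness

/-! ### From cross ratio distortions to ratio distortions. -/

namespace GridSmoothness

variable {B : ℝ} {M : ℕ} {a b : ℝ} {h : ℝ → ℝ}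

lemma logSlope_le_of_subset {S : Set ℝ} (hm : StrictMonoOn h S) {u v w z : ℝ} (hu : u ∈ S)
    (hv : v ∈ S) (hw : w ∈ S) (hz : z ∈ S) (huv : u ≤ v) (hvw : v < w) (hwz : w ≤ z) :
    logSlope h v w ≤ logSlope h u z + Real.log ((z - u) / (w - v)) := by
  have i1 := hm hv hw hvw
  have i2 := hm.monotoneOn hu hv huv
  have i3 := hm.monotoneOn hw hz hwz
  have d1 : 0 < w - v := by linarith
  have d2 : 0 < z - u := by linarith
  have d3 : 0 < h z - h u := by linarith
  unfold logSlope
  rw [← Real.log_mul (div_pos d3 d2).ne' (div_pos d2 d1).ne', div_mul_div_cancel₀ d2.ne']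
  exact Real.log_le_log (div_pos (by linarith) d1) (by gcongr)

namespace OGrid

variable {G : OGrid B M a b}

/-- The length of the union of the intervals `i` and `i + 1` of level `n`. -/
def pairLen (G : OGrid B M a b) (n i : ℕ) : ℝ := G.X n (i + 2) - G.X n i

lemma pairLen_eq (n i : ℕ) : G.pairLen n i = G.p n i + G.p n (i + 1) := by
  unfold pairLen p; ring_nf

lemma pairLen_pos {n i : ℕ} (hi : i + 1 < G.N n) : 0 < G.pairLen n i := by
  have h1 := G.p_pos (n := n) (i := i) (by omega)
  have h2 := G.p_pos hi
  rw [pairLen_eq]; linarith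

lemma pairLen_le {n i : ℕ} (hi : i + 1 < G.N n) : G.pairLen n i ≤ (1 + B) * G.p n i := by
  have := G.p_up hi
  rw [pairLen_eq]; linarith

lemma p_left_le_pairLen {n i : ℕ} (hi : i + 1 < G.N n) : G.p n i ≤ G.lam * G.pairLen n i := by
  have := G.p_down hi
  have hB := G.B_pos
  rw [pairLen_eq]
  unfold lam
  rw [div_mul_eq_mul_div, le_div_iff₀ (by linarith)]
  linarith

lemma p_right_le_pairLen {n i : ℕ} (hi : i + 1 < G.N n) :
    G.p n (i + 1) ≤ G.lam * G.pairLen n i := by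
  have := G.p_up hi
  have hB := G.B_pos
  rw [pairLen_eq]
  unfold lam
  rw [div_mul_eq_mul_div, le_div_iff₀ (by linarith)]
  linarith

/-- Two consecutive intervals of a level lie in two consecutive intervals of the previous level. -/
lemma exists_parent_pair {n j : ℕ} (hN : 2 ≤ G.N n) (hj : j + 1 < G.N (n + 1)) :
    ∃ i, i + 1 < G.N n ∧ G.σ n i ≤ j ∧ j + 2 ≤ G.σ n (i + 2) := by
  obtain ⟨k, hk, k1, k2⟩ := G.exists_parent (n := n) (j := j) (by omega)
  by_cases hk1 : k + 1 < G.N n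
  · have := G.σ_lower n (k + 1) hk1
    exact ⟨k, hk1, k1, by have e : k + 1 + 1 = k + 2 := rfl; rw [e] at this; omega⟩
  · obtain ⟨i, rfl⟩ : ∃ i, k = i + 1 := ⟨k - 1, by omega⟩
    refine ⟨i, hk, (G.σ_le (Nat.le_succ i) hk.le).trans k1, ?_⟩
    have e : i + 2 = G.N n := by omega
    rw [e, G.σ_last]; omega

lemma p_child_le_pairLen {n i j : ℕ} (hi : i + 1 < G.N n) (h1 : G.σ n i ≤ j)
    (h2 : j + 1 ≤ G.σ n (i + 2)) : G.p (n + 1) j ≤ G.pairLen n i := by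
  have q0 := G.σ_le_N (n := n) (i := i + 2) hi
  have q1 := G.X_le_X (n := n + 1) h1 (by omega)
  have q2 := G.X_le_X (n := n + 1) h2 q0
  rw [G.σ_X _ _ (by omega)] at q1 q2
  unfold pairLen p; linarith

lemma pairLen_child_le {n i j : ℕ} (hi : i + 1 < G.N n) (h1 : G.σ n i ≤ j)
    (h2 : j + 2 ≤ G.σ n (i + 2)) : G.pairLen (n + 1) j ≤ G.lam * G.pairLen n i := by
  have q0 := G.σ_le_N (n := n) (i := i + 2) hi
  have s1 := G.σ_lt (n := n) (i := i + 1) (j := i + 2) (by omega) (by omega)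
  have s0 := G.σ_lt (n := n) (i := i) (j := i + 1) (by omega) (by omega)
  have w1 := G.p_left_le_pairLen hi
  have w2 := G.p_right_le_pairLen hi
  rcases lt_trichotomy (j + 1) (G.σ n (i + 1)) with hlt | heq | hgt
  · refine le_trans ?_ w1
    have u1 := G.X_le_X (n := n + 1) h1 (by omega)
    have u2 := G.X_le_X (n := n + 1) (i := j + 2) (j := G.σ n (i + 1)) (by omega) (by omega)
    rw [G.σ_X _ _ (by omega)] at u1 u2
    unfold pairLen p; linarith
  · have u1 := G.child_le (n := n) (i := i) (j := j) (by omega) h1 (by omega)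
    have u2 := G.child_le (n := n) (i := i + 1) (j := j + 1) hi heq.ge h2
    rw [pairLen_eq, pairLen_eq, mul_add]
    linarith
  · refine le_trans ?_ w2
    have u1 := G.X_le_X (n := n + 1) (i := G.σ n (i + 1)) (j := j) (by omega) (by omega)
    have u2 := G.X_le_X (n := n + 1) h2 q0
    rw [G.σ_X _ _ (by omega)] at u1 u2
    unfold pairLen p; ring_nf at *; linarith

lemma pairLen_le_child {n i j : ℕ} (hi : i + 1 < G.N n) (h1 : G.σ n i ≤ j)
    (h2 : j + 2 ≤ G.σ n (i + 2)) :
    G.pairLen n i ≤ (1 + B) * (M * B ^ M) * G.pairLen (n + 1) j := by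
  have q0 := G.σ_le_N (n := n) (i := i + 2) hi
  have hB := G.B_pos
  have l2 := G.p_pos (n := n + 1) (i := j + 1) (by omega)
  have l1 : G.p (n + 1) j ≤ G.pairLen (n + 1) j := by rw [pairLen_eq]; linarith
  have hup := G.p_up hi
  have hdn := G.p_down hi
  have hc : (0 : ℝ) ≤ (1 + B) * (M * B ^ M) := by positivity
  refine le_trans ?_ (mul_le_mul_of_nonneg_left l1 hc)
  rw [mul_assoc, pairLen_eq]
  rcases lt_or_ge j (G.σ n (i + 1)) with hlt | hge
  · have u1 := G.child_ge (n := n) (i := i) (j := j) (by omega) h1 hlt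
    refine le_trans ?_ (mul_le_mul_of_nonneg_left u1 (by linarith : 0 ≤ 1 + B))
    linarith
  · have u1 := G.child_ge (n := n) (i := i + 1) (j := j) hi hge (by have e : i + 1 + 1 = i + 2 := rfl; rw [e]; omega)
    refine le_trans ?_ (mul_le_mul_of_nonneg_left u1 (by linarith : 0 ≤ 1 + B))
    linarith

lemma σ_add_two_le {n i : ℕ} (hi : i + 1 < G.N n) : G.σ n (i + 2) ≤ G.σ n i + 2 * M := by
  have h1 := G.σ_upper n i (by omega)
  have h2 := G.σ_upper n (i + 1) hi
  have e : i + 1 + 1 = i + 2 := rfl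
  rw [e] at h2; omega

lemma r_eq_children {n i : ℕ} (hi : i + 1 < G.N n) :
    G.r h n i = logSlope h (G.X (n + 1) (G.σ n (i + 1))) (G.X (n + 1) (G.σ n (i + 2))) -
      logSlope h (G.X (n + 1) (G.σ n i)) (G.X (n + 1) (G.σ n (i + 1))) := by
  rw [G.σ_X _ _ (by omega), G.σ_X _ _ (by omega), G.σ_X _ _ (by omega)]
  rfl

/-- In the interior of a triple of intervals the ratio distortions are bounded in terms of the
cross ratio distortion. -/
lemma r_le_of_cd (hm : StrictMonoOn h (Icc a b)) {n i : ℕ} (hi : i + 2 < G.N n) :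
    G.r h n i ≤ |G.cd h n i| + 2 * Real.log (1 + B) ∧
      -G.r h n (i + 1) ≤ |G.cd h n i| + 2 * Real.log (1 + B) := by
  have hB := G.B_pos
  have m0 := G.X_mem (n := n) (i := i) (by omega)
  have m1 := G.X_mem (n := n) (i := i + 1) (by omega)
  have m2 := G.X_mem (n := n) (i := i + 2) (by omega)
  have m3 := G.X_mem (n := n) (i := i + 3) (by omega)
  have l0 := G.X_lt n i (by omega)
  have l1 := G.X_lt n (i + 1) (by omega)
  have l2 := G.X_lt n (i + 2) (by omega)
  have u0 := G.ratio_up n i (by omega)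
  have u1 := G.ratio_up n (i + 1) (by omega)
  have d0 := G.ratio_down n i (by omega)
  have d1 := G.ratio_down n (i + 1) (by omega)
  simp only [add_assoc, Nat.reduceAdd] at *
  have hlog : ∀ x y : ℝ, 0 < y → 0 < x → x ≤ (1 + B) * y → Real.log (x / y) ≤ Real.log (1 + B) :=
    fun x y hy hx hxy => Real.log_le_log (div_pos hx hy) (by rwa [div_le_iff₀ hy])
  have hcd := le_abs_self (G.cd h n i)
  have hcd' : G.cd h n i = logSlope h (G.X n i) (G.X n (i + 2)) +
    logSlope h (G.X n (i + 1)) (G.X n (i + 3)) - logSlope h (G.X n i) (G.X n (i + 1)) -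
    logSlope h (G.X n (i + 2)) (G.X n (i + 3)) := rfl
  -- Each of the two long slopes in `cd` is bounded below by the slope of a subinterval, up to `log
  -- (1 + B)`. Choosing subintervals so that one subtracted term cancels leaves a single ratio
  -- distortion; the choices `a1`, `a2` and `a3`, `a4` give the two bounds.
  have a1 := logSlope_le_of_subset hm m0 m1 m2 m2 l0.le l1 le_rfl
  have a2 := logSlope_le_of_subset hm m1 m2 m3 m3 l1.le l2 le_rfl
  have a3 := logSlope_le_of_subset hm m1 m1 m2 m3 le_rfl l1 l2.le
  have a4 := logSlope_le_of_subset hm m0 m0 m1 m2 le_rfl l0 l1.le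
  have g1 := hlog (G.X n (i + 2) - G.X n i) (G.X n (i + 2) - G.X n (i + 1)) (by linarith)
    (by linarith) (by linarith)
  have g2 := hlog (G.X n (i + 3) - G.X n (i + 1)) (G.X n (i + 3) - G.X n (i + 2)) (by linarith)
    (by linarith) (by linarith)
  have g3 := hlog (G.X n (i + 3) - G.X n (i + 1)) (G.X n (i + 2) - G.X n (i + 1)) (by linarith)
    (by linarith) (by linarith)
  have g4 := hlog (G.X n (i + 2) - G.X n i) (G.X n (i + 1) - G.X n i) (by linarith)
    (by linarith) (by linarith)
  unfold r ls
  simp only [add_assoc, Nat.reduceAdd]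
  constructor <;> linarith

/-- One-sided bounds of the ratio distortions, away from one end of the interval each. -/
lemma r_bounds_of_cd (hm : StrictMonoOn h (Icc a b)) {n : ℕ} {C : ℝ}
    (hcd : ∀ i, i + 2 < G.N n → |G.cd h n i| ≤ C) :
    (∀ i, i + 2 < G.N n → G.r h n i ≤ C + 2 * Real.log (1 + B)) ∧
      ∀ i, i + 2 < G.N n → -G.r h n (i + 1) ≤ C + 2 * Real.log (1 + B) := by
  constructor
  · intro i hi; linarith [hcd i hi, (G.r_le_of_cd hm hi).1]
  · intro i hi; linarith [hcd i hi, (G.r_le_of_cd hm hi).2]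

/-- At deep levels a pair whose common endpoint lies in `[u, v]` is neither the first nor the last
one, so both one-sided bounds of `r_bounds_of_cd` apply to it. -/
lemma quasisymmetricOn_of_cd (hm : StrictMonoOn h (Icc a b)) {C : ℝ} (hC : 0 ≤ C)
    (hcd : ∀ n i, i + 2 < G.N n → |G.cd h n i| ≤ C) {u v : ℝ} (hu : a < u) (hv : v < b) :
    QuasisymmetricOn h (Icc u v) := by
  have hB := G.one_le
  have hlog : 0 ≤ Real.log (1 + B) := Real.log_nonneg (by linarith)
  obtain ⟨n₀, hn₀⟩ := G.exists_mesh_lt (δ := min (u - a) (b - v))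
    (lt_min (by linarith) (by linarith))
  refine quasisymmetricOn_of_bound (G := G) hm hu.le hv.le (n₀ := n₀)
    (C := C + 2 * Real.log (1 + B)) (by positivity) fun n hn t ht hX => ?_
  obtain ⟨h1, h2⟩ := G.r_bounds_of_cd hm (hcd n)
  have ht0 : t ≠ 0 := by
    rintro rfl
    have := (hn₀ n hn 0 (by omega)).trans_le (min_le_left _ _)
    unfold p at this
    rw [G.X_zero, zero_add] at this
    rw [zero_add] at hX
    linarith [hX.1]
  have ht1 : t + 2 < G.N n := by
    by_contra hc
    have e : t + 1 + 1 = G.N n := by omega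
    have := (hn₀ n hn (t + 1) ht).trans_le (min_le_right _ _)
    unfold p at this
    rw [e, G.X_last] at this
    linarith [hX.2]
  obtain ⟨t, rfl⟩ := Nat.exists_eq_succ_of_ne_zero ht0
  exact abs_le.2 ⟨by linarith [h2 t (by omega)], h1 _ ht1⟩

/-- The gap between `l` and `(1 + l) / 2` absorbs the factors `exp η` and `1 - κ` with `κ = 2 * K *
η`. Since `κ ≤ 1 / 2`, the constant terms contribute at most `(1 + κ) / (1 - κ) ≤ 3`. -/
lemma boundary_step_aux {A A' E θ l K η : ℝ} (hA : 0 < A) (hE : E ≤ A * Real.exp η)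
    (hE0 : 0 ≤ E) (hθ0 : 0 ≤ θ) (hθ : θ ≤ l) (hl : l < 1) (hK : 0 ≤ K) (hη : 0 ≤ η)
    (hη1 : (2 * K + 2) * η ≤ (1 - l) / 2)
    (H : |(A' - 1) - θ * (E - 1)| ≤ 2 * K * η * (A' + 1)) : A' ≤ (1 + l) / 2 * A + 3 := by
  have hH := (abs_le.1 H).2
  have hl0 : 0 ≤ l := hθ0.trans hθ
  have hKη : 0 ≤ K * η := by positivity
  have hexp : Real.exp η ≤ 1 + 2 * η := by
    have h1 := Real.exp_bound_div_one_sub_of_interval hη (by nlinarith)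
    refine h1.trans ?_
    rw [div_le_iff₀ (by nlinarith)]
    nlinarith
  have hE' : θ * E ≤ l * (A * (1 + 2 * η)) := by
    calc θ * E ≤ l * E := mul_le_mul_of_nonneg_right hθ hE0
      _ ≤ l * (A * (1 + 2 * η)) := by gcongr; exact hE.trans (by gcongr)
  set κ := 2 * K * η with hκ
  have hκ0 : 0 ≤ κ := by positivity
  have hκ1 : κ + 2 * η ≤ (1 - l) / 2 := by rw [hκ]; linarith
  have h1 : A' * (1 - κ) ≤ 1 + κ + l * (A * (1 + 2 * η)) := by nlinarith
  have h2 : l * (1 + 2 * η) ≤ (1 + l) / 2 * (1 - κ) := by nlinarith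
  have h3 : l * (A * (1 + 2 * η)) ≤ (1 + l) / 2 * A * (1 - κ) := by nlinarith
  have h4 : A' * (1 - κ) ≤ ((1 + l) / 2 * A + 3) * (1 - κ) := by nlinarith
  exact le_of_mul_le_mul_right h4 (by linarith)

lemma bounded_of_step {A : ℕ → ℝ} {q D : ℝ} (hq0 : 0 ≤ q) (hq : q < 1) {n₀ : ℕ}
    (H : ∀ n ≥ n₀, A (n + 1) ≤ q * A n + D) : ∃ K, ∀ n ≥ n₀, A n ≤ K := by
  refine ⟨max (A n₀) (D / (1 - q)), fun n hn => ?_⟩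
  induction n, hn using Nat.le_induction with
  | base => exact le_max_left _ _
  | succ n hn ih =>
    have h1 := le_max_right (A n₀) (D / (1 - q))
    rw [div_le_iff₀ (by linarith)] at h1
    nlinarith [H n hn, mul_le_mul_of_nonneg_left ih hq0]

/-- If the cross ratio distortions tend to zero, then the ratio distortions at the ends of the
interval satisfy a contracting recursion. -/
lemma exists_boundary_step (hm : StrictMonoOn h (Icc a b)) (hV : G.Vanishes 2 (G.cd h)) :
    ∃ n₀, ∀ n ≥ n₀, 2 ≤ G.N n →
      (Real.exp (-G.r h (n + 1) 0) ≤ (1 + G.lam) / 2 * Real.exp (-G.r h n 0) + 3) ∧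
      Real.exp (G.r h (n + 1) (G.N (n + 1) - 2)) ≤
        (1 + G.lam) / 2 * Real.exp (G.r h n (G.N n - 2)) + 3 := by
  have hB := G.one_le
  have hl0 := G.lam_pos
  have hl1 := G.lam_lt_one
  obtain ⟨C, ε₀, hC, hε₀, H⟩ := G.exists_crossDist_bound hm (2 * M)
  set K : ℝ := (2 * M : ℕ) * B ^ (2 * M) with hK
  have hK0 : 0 ≤ K := by positivity
  -- The first term keeps `η / C` in the range of `exists_crossDist_bound`, the second is what
  -- `boundary_step_aux` asks for.
  set η : ℝ := min (C * ε₀) ((1 - G.lam) / (4 * K + 4)) with hη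
  have hη0 : 0 < η := lt_min (by positivity) (div_pos (by linarith) (by linarith))
  have hη2 : (2 * K + 2) * η ≤ (1 - G.lam) / 2 := by
    have := min_le_right (C * ε₀) ((1 - G.lam) / (4 * K + 4))
    rw [← hη, le_div_iff₀ (by linarith)] at this
    linarith
  have hη1 : η ≤ 1 := by nlinarith
  obtain ⟨n₀, hn₀⟩ := hV (η / C) (by positivity)
  refine ⟨n₀, fun n hn hN => ?_⟩
  have hCη : C * (η / C) = η := by field_simp
  have hstep := fun lo hi (hhi : hi ≤ G.N (n + 1)) => H (n + 1) lo hi (η / C) hhi (by positivity)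
    (by rw [div_le_iff₀ (by linarith), mul_comm]; exact min_le_left _ _)
    (fun t _ ht => hn₀ (n + 1) (by omega) t (by omega))
  rw [hCη] at hstep
  have hmem : ∀ i, i ≤ G.N (n + 1) → G.X (n + 1) i ∈ Icc a b := fun i q => G.X_mem q
  constructor
  · have s0 := G.σ_lower n 0 (by omega)
    have s1 := G.σ_lower n 1 (by omega)
    have s2 := G.σ_add_two_le (n := n) (i := 0) (by omega)
    have s3 := G.σ_le_N (n := n) (i := 2) hN
    rw [G.σ_zero] at s0 s2
    simp only [Nat.reduceAdd, zero_add] at s0 s1 s2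
    have x1 := G.X_lt_X (n := n + 1) (i := 0) (j := 1) (by omega) (by omega)
    have x2 := G.X_lt_X (n := n + 1) (i := 1) (j := 2) (by omega) (by omega)
    have x3 := G.X_lt_X (n := n + 1) (i := 2) (j := G.σ n 2) (by omega) (by omega)
    -- The first child pair is compared with the first pair of the previous level, which ends at the
    -- position `σ n 2`: `c1` serves to extend the right interval to this point, `c2` to move the
    -- division point from `1` to `σ n 1`.
    have c1 := hstep 0 (G.σ n 2) s3 0 1 2 (G.σ n 2) le_rfl (by omega) (by omega) (by omega) le_rfl
      (by omega)
    have c2 := hstep 0 (G.σ n 2) s3 0 1 (G.σ n 1) (G.σ n 2) le_rfl (by omega) (by omega) (by omega)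
      le_rfl (by omega)
    have k1 := G.X_sub_le (n := n + 1) (s := 2 * M) (i := 0) (l := G.σ n 2) (j := 1) (by omega)
      (by omega) s3 (by omega) (by omega) (by omega)
    have g := exp_ratio_extend_right hm (hmem 0 (by omega)) (hmem 1 (by omega)) (hmem 2 (by omega))
      (hmem _ s3) x1 x2 x3 (K := K) (by unfold p at k1; simp only [Nat.reduceAdd] at k1; linarith)
      c1 hη1
    have hθ := G.pairLen_child_le (n := n) (i := 0) (j := 0) (by omega) (by rw [G.σ_zero])
      (by simp only [zero_add]; omega)
    have hr := G.r_eq_children (h := h) (n := n) (i := 0) (by omega)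
    simp only [zero_add, G.σ_zero] at hr
    unfold pairLen at hθ
    simp only [zero_add] at hθ
    rw [← G.σ_X n 2 hN, ← G.σ_X n 0 (by omega), G.σ_zero] at hθ
    have e1 : -G.r h (n + 1) 0 = logSlope h (G.X (n + 1) 0) (G.X (n + 1) 1) -
        logSlope h (G.X (n + 1) 1) (G.X (n + 1) 2) := by unfold r ls; ring_nf
    rw [e1]
    refine boundary_step_aux (Real.exp_pos _) ?_ (Real.exp_pos _).le
      (div_nonneg (by linarith) (by linarith)) ?_ hl1 hK0 hη0.le hη2 g
    · rw [← Real.exp_add]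
      refine Real.exp_le_exp.2 ?_
      have := (abs_le.1 c2).1
      unfold crossDist at this
      rw [hr]; linarith
    · rw [div_le_iff₀ (by linarith)]; exact hθ
  · obtain ⟨k, hk⟩ : ∃ k, G.N n = k + 2 := ⟨G.N n - 2, by omega⟩
    obtain ⟨j, hj⟩ : ∃ j, G.N (n + 1) = j + 2 := ⟨G.N (n + 1) - 2, by have := G.two_le_N n; omega⟩
    have e0 : G.σ n (k + 2) = j + 2 := by rw [← hk, G.σ_last, hj]
    rw [hk, hj, Nat.add_sub_cancel, Nat.add_sub_cancel]
    have s0 := G.σ_lower n k (by omega)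
    have s1 := G.σ_lower n (k + 1) (by omega)
    have s2 := G.σ_add_two_le (n := n) (i := k) (by omega)
    simp only [add_assoc, Nat.reduceAdd] at s0 s1 s2
    rw [e0] at s1 s2
    have x1 := G.X_lt_X (n := n + 1) (i := G.σ n k) (j := j) (by omega) (by omega)
    have x2 := G.X_lt_X (n := n + 1) (i := j) (j := j + 1) (by omega) (by omega)
    have x3 := G.X_lt_X (n := n + 1) (i := j + 1) (j := j + 2) (by omega) (by omega)
    have c1 := hstep (G.σ n k) (j + 2) hj.ge (G.σ n k) j (j + 1) (j + 2) le_rfl (by omega) (by omega)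
      (by omega) le_rfl (by omega)
    have c2 := hstep (G.σ n k) (j + 2) hj.ge (G.σ n k) (G.σ n (k + 1)) (j + 1) (j + 2) le_rfl
      (by omega) (by omega) (by omega) le_rfl (by omega)
    have k1 := G.X_sub_le (n := n + 1) (s := 2 * M) (i := G.σ n k) (l := j + 2) (j := j) (by omega)
      (by omega) hj.ge (by omega) (by omega) (by omega)
    have g := exp_ratio_extend_left hm (hmem (G.σ n k) (by omega)) (hmem j (by omega))
      (hmem (j + 1) (by omega)) (hmem (j + 2) hj.ge) x1 x2 x3 (K := K)
      (by unfold p at k1; linarith) c1 hη1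
    have hθ := G.pairLen_child_le (n := n) (i := k) (j := j) (by omega) (by omega) e0.ge
    have hr := G.r_eq_children (h := h) (n := n) (i := k) (by omega)
    unfold pairLen at hθ
    rw [← G.σ_X n (k + 2) hk.ge, ← G.σ_X n k (by omega), e0] at hθ
    rw [e0] at hr
    have e1 : G.r h (n + 1) j = logSlope h (G.X (n + 1) (j + 1)) (G.X (n + 1) (j + 2)) -
        logSlope h (G.X (n + 1) j) (G.X (n + 1) (j + 1)) := rfl
    rw [e1]
    refine boundary_step_aux (Real.exp_pos _) ?_ (Real.exp_pos _).le
      (div_nonneg (by linarith) (by linarith)) ?_ hl1 hK0 hη0.le hη2 g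
    · rw [← Real.exp_add]
      refine Real.exp_le_exp.2 ?_
      have := (abs_le.1 c2).1
      unfold crossDist at this
      rw [hr]; linarith
    · rw [div_le_iff₀ (by linarith)]; exact hθ

/-- Ratio distortions are bounded if the cross ratio distortions tend to zero. -/
lemma exists_r_bound_of_cd (hm : StrictMonoOn h (Icc a b)) (hV : G.Vanishes 2 (G.cd h)) :
    ∃ K, 0 ≤ K ∧ ∀ n i, i + 1 < G.N n → |G.r h n i| ≤ K := by
  have hB := G.one_le
  have hl0 := G.lam_pos
  have hl1 := G.lam_lt_one
  have hlog : 0 ≤ Real.log (1 + B) := Real.log_nonneg (by linarith)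
  obtain ⟨C, hC, hcd⟩ := hV.exists_bound
  obtain ⟨n₀, H⟩ := G.exists_boundary_step hm hV
  have hN : ∀ n ≥ n₀ + 1, 2 ≤ G.N n := fun n hn => by
    obtain ⟨m, rfl⟩ : ∃ m, n = m + 1 := ⟨n - 1, by omega⟩
    exact G.two_le_N m
  obtain ⟨K₁, hK₁⟩ := bounded_of_step (A := fun n => Real.exp (-G.r h n 0)) (by linarith)
    (by linarith : (1 + G.lam) / 2 < 1) (n₀ := n₀ + 1)
    fun n hn => (H n (by omega) (hN n hn)).1
  obtain ⟨K₂, hK₂⟩ := bounded_of_step (A := fun n => Real.exp (G.r h n (G.N n - 2))) (by linarith)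
    (by linarith : (1 + G.lam) / 2 < 1) (n₀ := n₀ + 1)
    fun n hn => (H n (by omega) (hN n hn)).2
  obtain ⟨K₃, hK₃0, hK₃⟩ := G.exists_bound_below 1 (G.r h) (n₀ + 1)
  have hle : ∀ x y : ℝ, Real.exp x ≤ y → x ≤ |y| := fun x y hxy => by
    have := Real.add_one_le_exp x
    linarith [le_abs_self y]
  refine ⟨C + 2 * Real.log (1 + B) + |K₁| + |K₂| + K₃, by positivity, fun n i hi => ?_⟩
  have z1 := abs_nonneg K₁
  have z2 := abs_nonneg K₂
  rcases lt_or_ge n (n₀ + 1) with hn | hn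
  · linarith [hK₃ n hn i hi]
  -- Triples miss only the lower bound for the first pair and the upper bound for the last pair; the
  -- recursions supply these as `K₁` and `K₂`.
  · obtain ⟨h1, h2⟩ := G.r_bounds_of_cd hm (hcd n)
    rw [abs_le]
    constructor
    · rcases Nat.eq_zero_or_pos i with rfl | hi0
      · have := hle _ _ (hK₁ n hn)
        linarith
      · obtain ⟨t, rfl⟩ := Nat.exists_eq_succ_of_ne_zero hi0.ne'
        have := h2 t (by omega)
        rw [Nat.succ_eq_add_one]
        linarith
    · rcases lt_or_ge (i + 2) (G.N n) with hi2 | hi2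
      · linarith [h1 i hi2]
      · have := hle _ _ (hK₂ n hn)
        rw [(by omega : G.N n - 2 = i)] at this
        linarith

/-- The recursion for the exponentiated ratio distortions of consecutive levels. -/
lemma exists_pair_contraction (hm : StrictMonoOn h (Icc a b)) {K₁ : ℝ} (hK₁ : 0 ≤ K₁)
    (hr : ∀ n i, i + 1 < G.N n → |G.r h n i| ≤ K₁) :
    ∃ C, 0 ≤ C ∧ ∀ n i j ε, i + 1 < G.N n → G.σ n i ≤ j → j + 2 ≤ G.σ n (i + 2) → 0 ≤ ε →
      (∀ t, G.σ n i ≤ t → t + 3 ≤ G.σ n (i + 2) → |G.cd h (n + 1) t| ≤ ε) →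
      Real.exp |G.r h (n + 1) j| - 1 ≤
        G.pairLen (n + 1) j / G.pairLen n i * (Real.exp |G.r h n i| - 1) + C * ε := by
  obtain ⟨C, hC, H⟩ := G.exists_contraction hm (2 * M) hK₁
  refine ⟨C, hC, fun n i j ε hi h1 h2 hε hcd => ?_⟩
  have q0 := G.σ_le_N (n := n) (i := i + 2) hi
  -- The chain consists of all children of the pair `i`, `i + 1`, divided at their common endpoint,
  -- so the distortion of its two blocks is `r h n i`.
  have := H (n + 1) (G.σ n i) (G.σ n (i + 2)) j (G.σ n (i + 1)) ε q0 (G.σ_add_two_le hi) h1 h2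
    (G.σ_lt (by omega) (by omega)) (G.σ_lt (by omega) hi) hε hcd
    (fun t _ ht => hr (n + 1) t (by omega))
  rw [← r_eq_children hi, G.σ_X _ _ hi, G.σ_X _ _ (by omega)] at this
  exact this

/-- Along parent pairs `exp |r| - 1` is multiplied by at most `lam` at each level, up to `C * ε`
with `ε` arbitrarily small at deep levels. -/
lemma r_vanishes_of_cd (hm : StrictMonoOn h (Icc a b)) (hV : G.Vanishes 2 (G.cd h)) :
    G.Vanishes 1 (G.r h) := by
  obtain ⟨K₁, hK₁, hr⟩ := exists_r_bound_of_cd hm hV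
  obtain ⟨C, hC, H⟩ := exists_pair_contraction hm hK₁ hr
  have hl0 := G.lam_pos
  have hl1 := G.lam_lt_one
  intro η hη
  -- With this choice the affine recursion maps `η / 2` to at most `η / 2`.
  set ε : ℝ := η / 2 * (1 - G.lam) / (C + 1) with hεd
  have hε : 0 < ε := div_pos (mul_pos (by linarith) (by linarith)) (by linarith)
  have hCε : C * ε ≤ η / 2 * (1 - G.lam) := by
    rw [hεd, mul_div_assoc', div_le_iff₀ (by linarith)]
    have : 0 < η / 2 * (1 - G.lam) := mul_pos (by linarith) (by linarith)
    linarith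
  obtain ⟨n₀, hn₀⟩ := hV ε hε
  have key : ∀ k i, i + 1 < G.N (n₀ + 1 + k) →
      Real.exp |G.r h (n₀ + 1 + k) i| - 1 ≤ G.lam ^ k * Real.exp K₁ + η / 2 := by
    intro k
    induction k with
    | zero =>
      intro i hi
      have := Real.exp_le_exp.2 (hr _ i hi)
      rw [pow_zero, one_mul]
      simp only [add_zero] at this ⊢
      linarith
    | succ k ih =>
      intro j hj
      obtain ⟨i, hi, i1, i2⟩ := exists_parent_pair (G := G) (n := n₀ + 1 + k) (j := j)
        (by rw [(by omega : n₀ + 1 + k = n₀ + k + 1)]; exact G.two_le_N _) hj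
      have h1 := H _ i j ε hi i1 i2 hε.le
        fun t _ ht => hn₀ _ (by omega) t (by have := G.σ_le_N (n := n₀ + 1 + k) (i := i + 2) hi; omega)
      have h2 := ih i hi
      have h3 : G.pairLen (n₀ + 1 + k + 1) j / G.pairLen (n₀ + 1 + k) i ≤ G.lam := by
        rw [div_le_iff₀ (pairLen_pos hi)]; exact pairLen_child_le hi i1 i2
      have h4 : 0 ≤ Real.exp |G.r h (n₀ + 1 + k) i| - 1 :=
        sub_nonneg.2 (Real.one_le_exp (abs_nonneg _))
      have h5 := mul_le_mul_of_nonneg_right h3 h4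
      have h6 := mul_le_mul_of_nonneg_left h2 hl0.le
      rw [pow_succ]
      have e : n₀ + 1 + (k + 1) = n₀ + 1 + k + 1 := rfl
      rw [e]
      linarith
  have hlim : Filter.Tendsto (fun k : ℕ => G.lam ^ k * Real.exp K₁) Filter.atTop (nhds 0) := by
    simpa using (tendsto_pow_atTop_nhds_zero_of_lt_one hl0.le hl1).mul_const (Real.exp K₁)
  obtain ⟨k₀, hk₀⟩ := Filter.eventually_atTop.1 (hlim.eventually_lt_const (half_pos hη))
  refine ⟨n₀ + 1 + k₀, fun n hn i hi => ?_⟩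
  obtain ⟨k, rfl⟩ : ∃ k, n = n₀ + 1 + k := ⟨n - (n₀ + 1), by omega⟩
  have h1 := key k i hi
  have h2 := hk₀ k (by omega)
  have h3 := Real.add_one_le_exp |G.r h (n₀ + 1 + k) i|
  linarith

lemma vanishes_of_bigO {k : ℕ} {D : ℕ → ℕ → ℝ} {α C : ℝ} (hα : 0 < α) (hC : 0 ≤ C)
    (hD : ∀ n i, i + k < G.N n → |D n i| ≤ C * G.p n i ^ α) : G.Vanishes k D := by
  intro η hη
  obtain ⟨n₀, hn₀⟩ := G.exists_mesh_lt (δ := (η / (C + 1)) ^ α⁻¹) (by positivity)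
  refine ⟨n₀, fun n hn i hi => (hD n i hi).trans ?_⟩
  have h1 := hn₀ n hn i (by omega)
  have h2 := Real.rpow_le_rpow (G.p_pos (n := n) (i := i) (by omega)).le h1.le hα.le
  rw [← Real.rpow_mul (by positivity), inv_mul_cancel₀ hα.ne', Real.rpow_one,
    le_div_iff₀ (by positivity)] at h2
  have : 0 ≤ G.p n i ^ α := Real.rpow_nonneg (G.p_pos (by omega)).le _
  linarith

/-- Let a pair of length `L` contain a child pair of length `L'`. The contraction turns a bound `W *
L ^ α` into `W * (L' / L) ^ (1 - α) * L' ^ α`, so relative to `L' ^ α` the factor `lam ^ (1 - α) <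
1` is gained. For `α = 1` nothing would be gained. -/
lemma r_bigO_of_cd (hN : ∀ n, 2 ≤ G.N n) (hm : StrictMonoOn h (Icc a b)) {α Cc : ℝ} (hα : 0 < α)
    (hα1 : α < 1) (hCc : 0 ≤ Cc) (hcd : ∀ n i, i + 2 < G.N n → |G.cd h n i| ≤ Cc * G.p n i ^ α) :
    ∃ C, 0 ≤ C ∧ ∀ n i, i + 1 < G.N n → |G.r h n i| ≤ C * G.p n i ^ α := by
  obtain ⟨K₁, hK₁, hr⟩ := exists_r_bound_of_cd hm (vanishes_of_bigO hα hCc hcd)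
  obtain ⟨C, hC, H⟩ := exists_pair_contraction hm hK₁ hr
  obtain ⟨m, hm0, hmp⟩ := G.exists_lower_bound_p 1
  have hl0 := G.lam_pos
  have hl1 := G.lam_lt_one
  have hB := G.one_le
  set κ : ℝ := (1 + B) * (M * B ^ M) with hκ
  have hκ0 : 0 ≤ κ := by positivity
  set q : ℝ := G.lam ^ (1 - α) with hq
  have hq1 : q < 1 := Real.rpow_lt_one hl0.le hl1 (by linarith)
  set D : ℝ := C * (Cc * κ ^ α) with hD
  have hD0 : 0 ≤ D := by positivity
  -- The first summand starts the induction at level `0`, where the pairs have length at least `m`;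
  -- the second makes `W` stable under `W ↦ W * q + D`.
  set W : ℝ := Real.exp K₁ / m ^ α + D / (1 - q) with hW
  have hq1' : 0 < 1 - q := by linarith
  have hW0 : 0 ≤ W := by positivity
  have hWq : W * q + D ≤ W := by
    have : D / (1 - q) ≤ W := le_add_of_nonneg_left (by positivity)
    rw [div_le_iff₀ hq1'] at this
    linarith
  have key : ∀ n i, i + 1 < G.N n → Real.exp |G.r h n i| - 1 ≤ W * G.pairLen n i ^ α := by
    intro n
    induction n with
    | zero =>
      intro i hi
      have h1 := Real.exp_le_exp.2 (hr _ i hi)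
      have h2 : m ≤ G.pairLen 0 i := by
        rw [pairLen_eq]
        linarith [hmp 0 one_pos i (by omega), G.p_pos hi]
      have h3 := Real.rpow_le_rpow hm0.le h2 hα.le
      have h4 : Real.exp K₁ / m ^ α * m ^ α = Real.exp K₁ := by
        have : m ^ α ≠ 0 := (Real.rpow_pos_of_pos hm0 _).ne'
        field_simp
      have h5 : Real.exp K₁ / m ^ α ≤ W := le_add_of_nonneg_right (by positivity)
      have h6 : 0 < m ^ α := Real.rpow_pos_of_pos hm0 _
      have h7 := mul_le_mul_of_nonneg_right h5 h6.le
      have h8 := mul_le_mul_of_nonneg_left h3 hW0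
      linarith
    | succ n ih =>
      intro j hj
      obtain ⟨i, hi, i1, i2⟩ := exists_parent_pair (hN n) hj
      have hσ := G.σ_le_N (n := n) (i := i + 2) hi
      have L0 := pairLen_pos (G := G) hi
      have L1 := pairLen_pos (G := G) hj
      set L := G.pairLen n i with hL
      set L' := G.pairLen (n + 1) j with hL'
      have h1 := H n i j (Cc * L ^ α) hi i1 i2 (by positivity) fun t t1 t2 =>
        (hcd _ t (by omega)).trans (by
          have := G.p_pos (n := n + 1) (i := t) (by omega)
          have := G.p_child_le_pairLen hi t1 (by omega)
          gcongr)
      have h2 := ih i hi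
      have h3 : L' / L ≤ G.lam := by
        rw [div_le_iff₀ L0]; exact pairLen_child_le hi i1 i2
      have h4 : L' / L * L ^ α ≤ q * L' ^ α := by
        have e1 : L' / L * L ^ α = (L' / L) ^ (1 - α) * L' ^ α := by
          rw [Real.rpow_sub (by positivity), Real.rpow_one, Real.div_rpow L1.le L0.le]
          field_simp
        rw [e1]
        have := Real.rpow_le_rpow (by positivity) h3 (by linarith : 0 ≤ 1 - α)
        gcongr
      have h5 : L ^ α ≤ κ ^ α * L' ^ α := by
        rw [← Real.mul_rpow hκ0 L1.le]
        exact Real.rpow_le_rpow L0.le (pairLen_le_child hi i1 i2) hα.le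
      have h6 : L' / L * (Real.exp |G.r h n i| - 1) ≤ W * (q * L' ^ α) := by
        calc L' / L * (Real.exp |G.r h n i| - 1) ≤ L' / L * (W * L ^ α) := by gcongr
          _ = W * (L' / L * L ^ α) := by ring
          _ ≤ _ := by gcongr
      have h7 : C * (Cc * L ^ α) ≤ D * L' ^ α := by
        calc C * (Cc * L ^ α) ≤ C * (Cc * (κ ^ α * L' ^ α)) := by gcongr
          _ = _ := by rw [hD]; ring
      have h8 : (W * q + D) * L' ^ α ≤ W * L' ^ α := by gcongr
      linarith
  refine ⟨W * (1 + B) ^ α, by positivity, fun n i hi => ?_⟩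
  have h1 := key n i hi
  have h2 := Real.add_one_le_exp |G.r h n i|
  have h3 : G.pairLen n i ^ α ≤ (1 + B) ^ α * G.p n i ^ α := by
    rw [← Real.mul_rpow (by linarith) (G.p_pos (by omega)).le]
    exact Real.rpow_le_rpow (pairLen_pos hi).le (pairLen_le hi) hα.le
  have h4 := mul_le_mul_of_nonneg_left h3 hW0
  linarith

end OGrid

end GridSmoothness

/-! ### Second order smoothness. -/

namespace GridSmoothness

variable {B : ℝ} {M : ℕ} {a b : ℝ} {h : ℝ → ℝ}

lemma HolderContOn.mul {α K₁ K₂ : ℝ} {f g : ℝ → ℝ} {S : Set ℝ} (hf : HolderContOn α f S)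
    (hg : HolderContOn α g S) (hK₁ : ∀ x ∈ S, |f x| ≤ K₁) (hK₂ : ∀ x ∈ S, |g x| ≤ K₂) :
    HolderContOn α (fun x => f x * g x) S := by
  obtain ⟨C₁, h1, H1⟩ := hf
  obtain ⟨C₂, h2, H2⟩ := hg
  refine ⟨C₁ * |K₂| + |K₁| * C₂, by positivity, fun x hx y hy => ?_⟩
  have e : f y * g y - f x * g x = (f y - f x) * g y + f x * (g y - g x) := by ring
  rw [e, add_mul]
  refine (abs_add_le _ _).trans ?_
  rw [abs_mul, abs_mul]
  have hx' : |f x| ≤ |K₁| := (hK₁ x hx).trans (le_abs_self _)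
  have hy' : |g y| ≤ |K₂| := (hK₂ y hy).trans (le_abs_self _)
  have u1 := mul_le_mul (H1 x hx y hy) hy' (abs_nonneg _) (by positivity)
  have u2 := mul_le_mul hx' (H2 x hx y hy) (abs_nonneg _) (abs_nonneg _)
  linarith

lemma rpow_le_of_le_of_exponent_le {p L x y : ℝ} (hp : 0 < p) (hpL : p ≤ L) (hxy : x ≤ y) :
    p ^ y ≤ L ^ (y - x) * p ^ x := by
  have e : p ^ y = p ^ (y - x) * p ^ x := by rw [← Real.rpow_add hp]; ring_nf
  rw [e]
  exact mul_le_mul_of_nonneg_right (Real.rpow_le_rpow hp.le hpL (by linarith))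
    (Real.rpow_nonneg hp.le _)

/-- A one-sided first order expansion with Hölder coefficient is two-sided. -/
lemma abs_expansion_of_lt {f g : ℝ → ℝ} {S : Set ℝ} {C α : ℝ}
    (hg : ∀ x ∈ S, ∀ y ∈ S, |g y - g x| ≤ C * |y - x| ^ α)
    (H : ∀ x ∈ S, ∀ y ∈ S, x < y → |f y - f x - g x * (y - x)| ≤ C * ((y - x) * (y - x) ^ α))
    {x y : ℝ} (hx : x ∈ S) (hy : y ∈ S) :
    |f y - f x - g x * (y - x)| ≤ 2 * C * (|y - x| * |y - x| ^ α) := by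
  rcases lt_trichotomy x y with hlt | rfl | hlt
  · have h1 := H x hx y hy hlt
    rw [abs_of_pos (sub_pos.2 hlt)]
    linarith [abs_nonneg (f y - f x - g x * (y - x))]
  · simp
  · have h1 := H y hy x hx hlt
    have h2 := hg x hx y hy
    have hpos : 0 < x - y := sub_pos.2 hlt
    rw [abs_sub_comm y x, abs_of_pos hpos] at *
    have h3 := mul_le_mul_of_nonneg_right h2 hpos.le
    have e : f y - f x - g x * (y - x) =
      -(f x - f y - g y * (x - y)) + -((g y - g x) * (x - y)) := by ring
    rw [e]
    refine (abs_add_le _ _).trans ?_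
    rw [abs_neg, abs_neg, abs_mul (g y - g x), abs_of_pos hpos]
    linarith

namespace OGrid

variable {G : OGrid B M a b}

/-- The exponent `(1 + γ) / 2` is chosen so that the quadratic error of the linearization has the
order `1 + γ` of `cd`. Division by a length, comparable with that of the chain, leaves the order
`γ`. -/
lemma exists_normalized_linearization (G : OGrid B M a b) (hm : StrictMonoOn h (Icc a b)) (s : ℕ)
    {γ A T : ℝ} (hγ : 0 < γ) (hA : 0 ≤ A) (hT : 0 ≤ T)
    (hcd : ∀ n i, i + 2 < G.N n → |G.cd h n i| ≤ A * G.p n i ^ (1 + γ))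
    (hr : ∀ n i, i + 1 < G.N n → |G.r h n i| ≤ T * G.p n i ^ ((1 + γ) / 2)) :
    ∃ C, 0 ≤ C ∧ ∀ n lo hi f k, hi ≤ G.N n → hi ≤ lo + s → lo ≤ f → f + 2 ≤ hi → lo < k → k < hi →
      |G.r h n f / G.pairLen n f - (logSlope h (G.X n k) (G.X n hi) -
        logSlope h (G.X n lo) (G.X n k)) / (G.X n hi - G.X n lo)| ≤
          C * (G.X n hi - G.X n lo) ^ γ := by
  have hB := G.one_le
  have hab := G.a_lt_b
  obtain ⟨C, hC, H⟩ := G.exists_linearization hm s (K₁ := T * (b - a) ^ ((1 + γ) / 2))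
    (mul_nonneg hT (Real.rpow_nonneg (by linarith) _))
  refine ⟨C * (A + T ^ 2) * (s * B ^ s), by positivity, ?_⟩
  intro n lo hi f k hhi hs hf1 hf2 hk1 hk2
  have hq0 := G.X_lt_X (n := n) (i := lo) (j := hi) (by omega) hhi
  have hLf := pairLen_pos (G := G) (n := n) (i := f) (by omega)
  have hqL : G.X n hi - G.X n lo ≤ s * B ^ s * G.pairLen n f := by
    refine (G.X_sub_le (n := n) (j := f) (by omega) (by omega) hhi hs hf1 (by omega)).trans ?_
    have := G.p_pos (n := n) (i := f + 1) (by omega)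
    rw [pairLen_eq]
    exact mul_le_mul_of_nonneg_left (by linarith) (by positivity)
  have hqab : G.X n hi - G.X n lo ≤ b - a := by
    linarith [(G.X_mem hhi).2, (G.X_mem (n := n) (i := lo) (by omega)).1]
  have hpq : ∀ t, lo ≤ t → t < hi → G.p n t ≤ G.X n hi - G.X n lo := fun t t1 t2 => by
    have u1 := G.X_le_X (n := n) t1 (by omega)
    have u2 := G.X_le_X (n := n) (i := t + 1) (j := hi) t2 hhi
    unfold p; linarith
  set q := G.X n hi - G.X n lo with hq
  set Z := logSlope h (G.X n k) (G.X n hi) - logSlope h (G.X n lo) (G.X n k)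
  have hq0 : 0 < q := sub_pos.2 hq0
  have hsq : (T * q ^ ((1 + γ) / 2)) ^ 2 = T ^ 2 * q ^ (1 + γ) := by
    rw [mul_pow, ← Real.rpow_natCast (q ^ ((1 + γ) / 2)) 2, ← Real.rpow_mul hq0.le]
    norm_num
  have h1 := H n lo hi f k (A * q ^ (1 + γ)) (T * q ^ ((1 + γ) / 2)) hhi hs hf1 hf2 hk1 hk2
    (by positivity) (by positivity) (by gcongr)
    (fun t t1 t2 => (hcd n t (by omega)).trans (by
      have := G.p_pos (n := n) (i := t) (by omega)
      have := hpq t t1 (by omega)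
      gcongr))
    (fun t t1 t2 => (hr n t (by omega)).trans (by
      have := G.p_pos (n := n) (i := t) (by omega)
      have := hpq t t1 (by omega)
      gcongr))
  rw [hsq] at h1
  have e : G.r h n f / G.pairLen n f - Z / q =
      (G.r h n f - G.pairLen n f / q * Z) / G.pairLen n f := by field_simp
  rw [e, abs_div, abs_of_pos hLf, div_le_iff₀ hLf]
  refine h1.trans ?_
  rw [Real.rpow_add hq0, Real.rpow_one]
  have : C * (A + T ^ 2) * q ^ γ * q ≤ C * (A + T ^ 2) * q ^ γ * (s * B ^ s * G.pairLen n f) :=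
    mul_le_mul_of_nonneg_left hqL (by positivity)
  linarith

/-- The ratio distortions divided by the lengths converge to a Hölder continuous function. -/
lemma exists_nonlinearity (hN : ∀ n, 2 ≤ G.N n) (hm : StrictMonoOn h (Icc a b)) {γ A T : ℝ}
    (hγ : 0 < γ) (hA : 0 ≤ A) (hT : 0 ≤ T)
    (hcd : ∀ n i, i + 2 < G.N n → |G.cd h n i| ≤ A * G.p n i ^ (1 + γ))
    (hr : ∀ n i, i + 1 < G.N n → |G.r h n i| ≤ T * G.p n i ^ ((1 + γ) / 2)) :
    ∃ (g : ℝ → ℝ) (C : ℝ), 0 ≤ C ∧ (∀ n i x, i + 1 < G.N n → G.X n i ≤ x → x ≤ G.X n (i + 1) →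
      |G.r h n i / G.pairLen n i - g x| ≤ C * G.p n i ^ γ) ∧
      ∀ x ∈ Icc a b, ∀ y ∈ Icc a b, |g y - g x| ≤ C * |y - x| ^ γ := by
  have hB := G.one_le
  obtain ⟨C₁, hC₁, H₁⟩ := G.exists_normalized_linearization hm 3 hγ hA hT hcd hr
  obtain ⟨C₂, hC₂, H₂⟩ := G.exists_normalized_linearization hm (2 * M) hγ hA hT hcd hr
  -- The last interval of a level starts no pair; it receives the value of the last pair.
  set F : ℕ → ℕ → ℝ := fun n i => G.r h n (min i (G.N n - 2)) / G.pairLen n (min i (G.N n - 2))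
    with hF
  have hmin : ∀ n i, i + 1 < G.N n → F n i = G.r h n i / G.pairLen n i := fun n i hi => by
    rw [hF]; simp only; rw [min_eq_left (by omega)]
  obtain ⟨κ, hκ, hκ0⟩ : ∃ κ : ℝ, κ = (3 : ℕ) * B ^ 3 ∧ 0 ≤ κ := ⟨_, rfl, by positivity⟩
  set C : ℝ := 2 * C₁ * κ ^ γ + C₂ * (1 + B) ^ γ with hC
  have hz1 : 0 ≤ 2 * C₁ * κ ^ γ := by positivity
  have hz2 : 0 ≤ C₂ * (1 + B) ^ γ := by positivity
  have h1 : ∀ n i, i + 1 < G.N n → |F n (i + 1) - F n i| ≤ C * G.p n i ^ γ := by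
    intro n i hi
    have hp := G.p_pos (n := n) (i := i) (by omega)
    rcases lt_or_ge (i + 2) (G.N n) with h2 | h2
    · rw [hmin n i hi, hmin n (i + 1) h2]
      have u1 := H₁ n i (i + 3) i (i + 1) h2 le_rfl le_rfl (by omega) (by omega) (by omega)
      have u2 := H₁ n i (i + 3) (i + 1) (i + 1) h2 le_rfl (by omega) (by omega) (by omega) (by omega)
      have u3 := G.X_sub_le (n := n) (s := 3) (i := i) (l := i + 3) (j := i) (by omega) (by omega) h2
        le_rfl le_rfl (by omega)
      have u5 := G.X_lt_X (n := n) (i := i) (j := i + 3) (by omega) h2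
      rw [← hκ] at u3
      have u4 := Real.rpow_le_rpow (by linarith) u3 hγ.le
      rw [Real.mul_rpow (by positivity) hp.le] at u4
      have u6 := mul_le_mul_of_nonneg_left u4 hC₁
      have hz3 : 0 ≤ C₂ * (1 + B) ^ γ * G.p n i ^ γ := by positivity
      rw [hC, add_mul]
      rw [abs_le] at u1 u2 ⊢
      constructor <;> linarith [u1.1, u1.2, u2.1, u2.2]
    · have : F n (i + 1) = F n i := by
        rw [hF]; simp only; rw [min_eq_right (by omega), min_eq_left (by omega),
          (by omega : G.N n - 2 = i)]
      rw [this, sub_self, abs_zero]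
      positivity
  have h2 : ∀ n i j, i < G.N n → G.σ n i ≤ j → j < G.σ n (i + 1) →
      |F (n + 1) j - F n i| ≤ C * G.p n i ^ γ := by
    intro n i j hi j1 j2
    have hNn := hN n
    have hp := G.p_pos hi
    have s0 := G.σ_le_N (n := n) (i := i + 1) hi
    -- After this truncation the pair at `j'` still lies in the pair at `i'`, whose length is
    -- comparable with that of the interval `i`.
    obtain ⟨i', hi', j', e1, e2, q1, q2, q3⟩ : ∃ i', i' + 1 < G.N n ∧ ∃ j',
        min i (G.N n - 2) = i' ∧ min j (G.N (n + 1) - 2) = j' ∧ G.σ n i' ≤ j' ∧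
        j' + 2 ≤ G.σ n (i' + 2) ∧ G.pairLen n i' ≤ (1 + B) * G.p n i := by
      refine ⟨_, ?_, _, rfl, rfl, ?_⟩
      · omega
      rcases lt_or_ge (i + 1) (G.N n) with h2 | h2
      · have := G.σ_lower n (i + 1) h2
        have := G.σ_le_N (n := n) (i := i + 2) h2
        simp only [add_assoc, Nat.reduceAdd] at *
        rw [min_eq_left (by omega), min_eq_left (by omega)]
        exact ⟨j1, by omega, pairLen_le h2⟩
      · obtain ⟨k, rfl⟩ : ∃ k, i = k + 1 := ⟨i - 1, by omega⟩
        have e : k + 2 = G.N n := by omega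
        have s1 := G.σ_lower n (k + 1) hi
        have s2 := G.σ_lt (n := n) (i := k) (j := k + 1) (by omega) (by omega)
        have e3 := G.σ_last n
        rw [← e] at e3
        simp only [add_assoc, Nat.reduceAdd] at *
        rw [(by omega : min (k + 1) (G.N n - 2) = k), e3]
        refine ⟨by omega, by omega, ?_⟩
        have := G.p_down hi
        rw [pairLen_eq]; linarith
    have hFj : F (n + 1) j = G.r h (n + 1) j' / G.pairLen (n + 1) j' := by rw [← e2]
    have hFi : F n i = G.r h n i' / G.pairLen n i' := by rw [← e1]
    rw [hFj, hFi]
    have q0 := G.σ_le_N (n := n) (i := i' + 2) hi'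
    have u1 := H₂ (n + 1) (G.σ n i') (G.σ n (i' + 2)) j' (G.σ n (i' + 1)) q0 (G.σ_add_two_le hi') q1
      q2 (G.σ_lt (by omega) (by omega)) (G.σ_lt (by omega) hi')
    rw [← r_eq_children hi', G.σ_X _ _ hi', G.σ_X _ _ (by omega)] at u1
    refine u1.trans ?_
    have u2 := Real.rpow_le_rpow (pairLen_pos hi').le q3 hγ.le
    rw [Real.mul_rpow (by linarith) hp.le] at u2
    have u3 := mul_le_mul_of_nonneg_left u2 hC₂
    have hz3 : 0 ≤ 2 * C₁ * κ ^ γ * G.p n i ^ γ := by positivity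
    rw [hC, add_mul]
    refine le_trans u3 ?_
    linarith
  obtain ⟨g, C', hC', g1, g2⟩ := G.exists_holder_limit hγ (by positivity) h1 h2
  exact ⟨g, C', hC', fun n i x hi x1 x2 => by
    rw [← hmin n i hi]; exact g1 n i x (by omega) x1 x2, g2⟩

lemma sum_pairLen (n u d : ℕ) : ∑ t ∈ Finset.range d, G.pairLen n (u + t) =
    (G.X n (u + d + 1) + G.X n (u + d)) - (G.X n (u + 1) + G.X n u) := by
  induction d with
  | zero => simp
  | succ d ih => rw [Finset.sum_range_succ, ih]; unfold pairLen; ring_nf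

lemma sum_r (n u d : ℕ) :
    ∑ t ∈ Finset.range d, G.r h n (u + t) = G.ls h n (u + d) - G.ls h n u := by
  induction d with
  | zero => simp
  | succ d ih => rw [Finset.sum_range_succ, ih]; unfold r; ring_nf

/-- The limits of the logarithmic slopes and of the normalized ratio distortions are related as a
function and its derivative. -/
lemma abs_log_deriv_expansion {f g : ℝ → ℝ} {α C : ℝ} (hα : 0 < α) (hC : 0 ≤ C)
    (hf : ∀ n i x, i < G.N n → G.X n i ≤ x → x ≤ G.X n (i + 1) →
      |G.ls h n i - f x| ≤ C * G.p n i ^ α)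
    (hR : ∀ n i x, i + 1 < G.N n → G.X n i ≤ x → x ≤ G.X n (i + 1) →
      |G.r h n i / G.pairLen n i - g x| ≤ C * G.p n i ^ α)
    (hg : ∀ x ∈ Icc a b, ∀ y ∈ Icc a b, |g y - g x| ≤ C * |y - x| ^ α)
    {x y : ℝ} (hx : x ∈ Icc a b) (hy : y ∈ Icc a b) (hxy : x < y) :
    |f y - f x - 2 * g x * (y - x)| ≤ 2 * C * ((y - x) * (y - x) ^ α) := by
  have hxy' : 0 < y - x := sub_pos.2 hxy
  have hab := G.a_lt_b
  -- A Riemann sum at level `n`: the ratio distortions between `x` and `y` add up to a difference of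
  -- log slopes, and each is nearly `g x` times the length of its pair.
  have key : ∀ n : ℕ, |f y - f x - 2 * g x * (y - x)| ≤
      2 * C * (G.lam ^ n * (b - a)) ^ α + |g x| * (2 * (G.lam ^ n * (b - a))) +
        C * ((G.lam ^ n * (b - a)) ^ α + (y - x) ^ α) *
          (2 * (y - x) + 2 * (G.lam ^ n * (b - a))) := by
    intro n
    obtain ⟨u, hu, u1, u2⟩ := G.exists_mem (n := n) hx
    obtain ⟨v, hv, v1, v2⟩ := G.exists_mem (n := n) hy
    have huv : u ≤ v := by
      by_contra hc
      have := G.X_le_X (n := n) (i := v + 1) (j := u) (by omega) hu.le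
      linarith
    obtain ⟨d, rfl⟩ := Nat.exists_eq_add_of_le huv
    have hδ0 : 0 < G.lam ^ n * (b - a) := mul_pos (pow_pos G.lam_pos _) (by linarith)
    have hp : ∀ i < G.N n, G.p n i ^ α ≤ (G.lam ^ n * (b - a)) ^ α := fun i hi =>
      Real.rpow_le_rpow (G.p_pos hi).le (G.p_le_mesh hi) hα.le
    have pu := G.p_le_mesh hu
    have pv := G.p_le_mesh hv
    set δ := G.lam ^ n * (b - a) with hδ
    have a1 := (hf n u x hu u1 u2).trans (mul_le_mul_of_nonneg_left (hp u hu) hC)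
    have a2 := (hf n (u + d) y hv v1 v2).trans (mul_le_mul_of_nonneg_left (hp (u + d) hv) hC)
    have a3 : |∑ t ∈ Finset.range d, (G.r h n (u + t) - g x * G.pairLen n (u + t))| ≤
        ∑ t ∈ Finset.range d, C * (δ ^ α + (y - x) ^ α) * G.pairLen n (u + t) := by
      refine (Finset.abs_sum_le_sum_abs _ _).trans (Finset.sum_le_sum fun t ht => ?_)
      rw [Finset.mem_range] at ht
      have hL := pairLen_pos (G := G) (n := n) (i := u + t) (by omega)
      have e : G.r h n (u + t) - g x * G.pairLen n (u + t) =
          ((G.r h n (u + t) / G.pairLen n (u + t) - g (G.X n (u + t + 1))) +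
            (g (G.X n (u + t + 1)) - g x)) * G.pairLen n (u + t) := by field_simp; ring
      rw [e, abs_mul, abs_of_pos hL]
      refine mul_le_mul_of_nonneg_right ((abs_add_le _ _).trans ?_) hL.le
      have w1 := G.X_le_X (n := n) (i := u + 1) (j := u + t + 1) (by omega) (by omega)
      have w2 := G.X_le_X (n := n) (i := u + t + 1) (j := u + d) (by omega) (by omega)
      have c1 := (hR n (u + t) (G.X n (u + t + 1)) (by omega) (G.X_lt n _ (by omega)).le le_rfl).trans
        (mul_le_mul_of_nonneg_left (hp (u + t) (by omega)) hC)
      have c2 := hg x hx (G.X n (u + t + 1)) (G.X_mem (by omega))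
      rw [abs_of_nonneg (by linarith : 0 ≤ G.X n (u + t + 1) - x)] at c2
      have c3 := mul_le_mul_of_nonneg_left (Real.rpow_le_rpow (by linarith)
        (by linarith : G.X n (u + t + 1) - x ≤ y - x) hα.le) hC
      linarith
    rw [← Finset.mul_sum, Finset.sum_sub_distrib, ← Finset.mul_sum, sum_pairLen, sum_r] at a3
    unfold p at pu pv
    -- In the sum of the pair lengths almost every interval is counted twice. This is the source of
    -- the factor `2` in front of `g`.
    set S := G.X n (u + d + 1) + G.X n (u + d) - (G.X n (u + 1) + G.X n u) with hS
    have a4 : |S - 2 * (y - x)| ≤ 2 * δ := by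
      rw [abs_le]; constructor <;> linarith
    have a5 : |g x * (S - 2 * (y - x))| ≤ |g x| * (2 * δ) := by
      rw [abs_mul]; exact mul_le_mul_of_nonneg_left a4 (abs_nonneg _)
    have a6 : C * (δ ^ α + (y - x) ^ α) * S ≤ C * (δ ^ α + (y - x) ^ α) * (2 * (y - x) + 2 * δ) :=
      mul_le_mul_of_nonneg_left (by linarith [(abs_le.1 a4).2]) (by positivity)
    have e : f y - f x - 2 * g x * (y - x) =
        (G.ls h n (u + d) - G.ls h n u - g x * S) + g x * (S - 2 * (y - x)) +
          (G.ls h n u - f x) - (G.ls h n (u + d) - f y) := by ring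
    rw [e]
    rw [abs_le] at a1 a2 a3 a5 ⊢
    constructor <;> linarith [a1.1, a1.2, a2.1, a2.2, a3.1, a3.2, a5.1, a5.2]
  have ht := G.tendsto_mesh
  have hta : Filter.Tendsto (fun n : ℕ => (G.lam ^ n * (b - a)) ^ α) Filter.atTop (nhds 0) := by
    have := ht.rpow_const (p := α) (Or.inr hα.le)
    rwa [Real.zero_rpow hα.ne'] at this
  have hlim := (((hta.const_mul (2 * C)).add ((ht.const_mul 2).const_mul |g x|)).add
    (((hta.add_const ((y - x) ^ α)).const_mul C).mul ((ht.const_mul 2).const_add (2 * (y - x)))))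
  refine (ge_of_tendsto' hlim key).trans (le_of_eq ?_)
  ring

/-- Cross ratio distortions of order `1 + α` give `C ^ (2 + α)` smoothness. -/
lemma c2HolderOn_of_cd (hN : ∀ n, 2 ≤ G.N n) (hm : StrictMonoOn h (Icc a b)) {α A : ℝ} (hα : 0 < α)
    (hα1 : α ≤ 1) (hA : 0 ≤ A)
    (hcd : ∀ n i, i + 2 < G.N n → |G.cd h n i| ≤ A * G.p n i ^ (1 + α)) :
    C2HolderOn α h (Icc a b) ∧ DerivNeZeroOn h (Icc a b) := by
  have hab := G.a_lt_b
  have hab0 : 0 < b - a := sub_pos.2 hab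
  have hconv : ∀ (k : ℕ) {D : ℕ → ℕ → ℝ} {x y K : ℝ}, x ≤ y → 0 ≤ K →
      (∀ n i, i + k < G.N n → |D n i| ≤ K * G.p n i ^ y) →
      ∀ n i, i + k < G.N n → |D n i| ≤ K * (b - a) ^ (y - x) * G.p n i ^ x := by
    intro k D x y K hxy hK hD n i hi
    refine (hD n i hi).trans ?_
    rw [mul_assoc]
    exact mul_le_mul_of_nonneg_left (rpow_le_of_le_of_exponent_le (G.p_pos (by omega))
      (G.p_le_length (by omega)) hxy) hK
  obtain ⟨T₁, hT₁, hr₁⟩ := r_bigO_of_cd hN hm (α := 3 / 4) (by norm_num) (by norm_num)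
    (by positivity) (hconv 2 (x := 3 / 4) (by linarith) hA hcd)
  -- Bootstrapping: the order `3 / 4` of the ratio distortions suffices for `exists_nonlinearity`
  -- with exponent `min α (1 / 2)`. The limit it yields is bounded, so the ratio distortions are of
  -- order `1`, and this permits the full exponent `α ≤ 1` afterwards.
  obtain ⟨T, hT, hr⟩ : ∃ T, 0 ≤ T ∧ ∀ n i, i + 1 < G.N n → |G.r h n i| ≤ T * G.p n i ^ (1 : ℝ) := by
    have hγ0 : 0 < min α (1 / 2) := lt_min hα (by norm_num)
    have hγ1 := min_le_left α (1 / 2)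
    have hγ2 := min_le_right α (1 / 2)
    obtain ⟨g, C, hC, g1, g2⟩ := exists_nonlinearity hN hm hγ0 (by positivity) (by positivity)
      (hconv 2 (x := 1 + min α (1 / 2)) (by linarith) hA hcd)
      (hconv 1 (x := (1 + min α (1 / 2)) / 2) (by linarith) hT₁ hr₁)
    obtain ⟨K, hK, hgK⟩ := HolderContOn.exists_bound hγ0 ⟨C, hC, g2⟩
    have hB := G.one_le
    refine ⟨(C * (b - a) ^ min α (1 / 2) + K) * (1 + B), by positivity, fun n i hi => ?_⟩
    have hL := pairLen_pos (G := G) hi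
    have hp := G.p_pos (n := n) (i := i) (by omega)
    have u1 := g1 n i (G.X n i) hi le_rfl (G.X_lt n i (by omega)).le
    have u2 := hgK (G.X n i) (G.X_mem (by omega))
    have u3 := mul_le_mul_of_nonneg_left
      (Real.rpow_le_rpow hp.le (G.p_le_length (by omega)) hγ0.le) hC
    have u4 : |G.r h n i / G.pairLen n i| ≤ C * (b - a) ^ min α (1 / 2) + K := by
      rw [abs_le] at u1 u2 ⊢; constructor <;> linarith [u1.1, u1.2, u2.1, u2.2]
    rw [abs_div, abs_of_pos hL, div_le_iff₀ hL] at u4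
    refine u4.trans ?_
    rw [Real.rpow_one, mul_assoc]
    exact mul_le_mul_of_nonneg_left (pairLen_le hi) (by positivity)
  obtain ⟨g, C₁, hC₁, g1, g2⟩ := exists_nonlinearity hN hm hα hA (by positivity) hcd
    (hconv 1 (x := (1 + α) / 2) (by linarith) hT hr)
  have hrα := hconv 1 (x := α) hα1 hT hr
  obtain ⟨f, f1, f2, C₂, hC₂, f3⟩ := exists_log_deriv hm hα (by positivity) hrα
  set C := max C₁ C₂ with hCd
  have hC : 0 ≤ C := hC₁.trans (le_max_left _ _)
  have hpα : ∀ n i, i < G.N n → 0 ≤ G.p n i ^ α := fun n i hi => Real.rpow_nonneg (G.p_pos hi).le _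
  have g2' : ∀ x ∈ Icc a b, ∀ y ∈ Icc a b, |g y - g x| ≤ C * |y - x| ^ α := fun x hx y hy =>
    (g2 x hx y hy).trans (mul_le_mul_of_nonneg_right (le_max_left _ _)
      (Real.rpow_nonneg (abs_nonneg _) _))
  have hexp : ∀ x ∈ Icc a b, ∀ y ∈ Icc a b, x < y →
      |f y - f x - 2 * g x * (y - x)| ≤ 2 * C * ((y - x) * (y - x) ^ α) := fun x hx y hy hxy =>
    abs_log_deriv_expansion (G := G) hα hC
      (fun n i x hi x1 x2 => (f3 n i x hi x1 x2).trans
        (mul_le_mul_of_nonneg_right (le_max_right _ _) (hpα n i hi)))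
      (fun n i x hi x1 x2 => (g1 n i x hi x1 x2).trans
        (mul_le_mul_of_nonneg_right (le_max_left _ _) (hpα n i (by omega)))) g2' hx hy hxy
  have g2'' : ∀ x ∈ Icc a b, ∀ y ∈ Icc a b, |2 * g y - 2 * g x| ≤ 2 * C * |y - x| ^ α :=
    fun x hx y hy => by
      rw [← mul_sub, abs_mul, abs_two, mul_assoc]
      exact mul_le_mul_of_nonneg_left (g2' x hx y hy) zero_le_two
  have hfd : ∀ x ∈ Icc a b, HasDerivWithinAt f (2 * g x) (Icc a b) x := fun x hx =>
    hasDerivWithinAt_of_abs_sub_le (C := 2 * (2 * C)) hα fun y hy => by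
      refine (abs_expansion_of_lt (g := fun x => 2 * g x) g2'' hexp hx hy).trans (le_of_eq ?_)
      congr 1
      rcases (abs_nonneg (y - x)).eq_or_lt with h0 | h0
      · rw [← h0, Real.zero_rpow (by linarith : 1 + α ≠ 0), zero_mul]
      · rw [Real.rpow_add h0, Real.rpow_one]
  have hud := uniqueDiffOn_Icc hab
  have he : ∀ x ∈ Icc a b, derivWithin h (Icc a b) x = Real.exp (f x) := fun x hx =>
    (f1 x hx).derivWithin (hud x hx)
  -- With `f` the logarithm of the derivative of `h` and `2 * g` the derivative of `f`, the second
  -- derivative is `exp f * (2 * g)`, a product of bounded Hölder functions.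
  have hd2 : ∀ x ∈ Icc a b, HasDerivWithinAt (derivWithin h (Icc a b))
      (Real.exp (f x) * (2 * g x)) (Icc a b) x := fun x hx =>
    ((hfd x hx).exp).congr he (he x hx)
  obtain ⟨K₁, -, hK₁⟩ := f2.exists_bound hα
  have hgH : HolderContOn α (fun x => 2 * g x) (Icc a b) := ⟨2 * C, by positivity, g2''⟩
  obtain ⟨K₂, -, hK₂⟩ := hgH.exists_bound hα
  refine ⟨⟨fun x hx => (f1 x hx).differentiableWithinAt,
    fun x hx => (hd2 x hx).differentiableWithinAt, ?_⟩,
    fun x hx => by rw [he x hx]; exact (Real.exp_pos _).ne'⟩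
  have hfK : ∀ x ∈ Icc a b, f x ≤ K₁ := fun x hx => (le_abs_self _).trans (hK₁ x hx)
  exact ((f2.exp hfK).mul hgH (K₁ := Real.exp K₁)
    (fun x hx => by rw [abs_of_pos (Real.exp_pos _)]; exact Real.exp_le_exp.2 (hfK x hx)) hK₂).congr
    fun x hx => (hd2 x hx).derivWithin (hud x hx)

end OGrid

end GridSmoothness

/-! ### Reversal of orientation and assembly of the tables. -/

namespace GridSmoothness

variable {B : ℝ} {M : ℕ} {a b : ℝ} {h : ℝ → ℝ}

section Neg

variable {S : Set ℝ}

lemma quasisymmetricOn_neg : QuasisymmetricOn (fun x => -h x) S ↔ QuasisymmetricOn h S := by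
  have e : ∀ x y z : ℝ, (-h x - -h y) / (-h y - -h z) = (h x - h y) / (h y - h z) := fun x y z => by
    rw [← neg_div_neg_eq]; ring_nf
  simp only [QuasisymmetricOn, e]

lemma uaaOn_neg : UaaOn (fun x => -h x) S ↔ UaaOn h S := by
  have e : ∀ x y z : ℝ, (-h x - -h y) / (-h y - -h z) = (h x - h y) / (h y - h z) := fun x y z => by
    rw [← neg_div_neg_eq]; ring_nf
  simp only [UaaOn, e]

lemma holderContOn_neg {α : ℝ} : HolderContOn α (fun x => -h x) S ↔ HolderContOn α h S := by
  have e : ∀ x y : ℝ, |-h y - -h x| = |h y - h x| := fun x y => by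
    rw [← abs_neg]; ring_nf
  simp only [HolderContOn, e]

lemma derivWithin_neg_eq :
    derivWithin (fun x => -h x) S = fun x => -derivWithin h S x := by
  funext x; exact derivWithin.fun_neg

lemma c1HolderOn_neg {α : ℝ} : C1HolderOn α (fun x => -h x) S ↔ C1HolderOn α h S := by
  simp only [C1HolderOn, derivWithin_neg_eq, holderContOn_neg, differentiableOn_fun_neg_iff]

lemma c2HolderOn_neg {α : ℝ} : C2HolderOn α (fun x => -h x) S ↔ C2HolderOn α h S := by
  simp only [C2HolderOn, derivWithin_neg_eq, holderContOn_neg, differentiableOn_fun_neg_iff]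

lemma derivNeZeroOn_neg : DerivNeZeroOn (fun x => -h x) S ↔ DerivNeZeroOn h S := by
  simp only [DerivNeZeroOn, derivWithin_neg_eq, ne_eq, neg_eq_zero]

lemma affineOn_neg : AffineOn (fun x => -h x) S ↔ AffineOn h S := by
  constructor
  · rintro ⟨m, c, H⟩
    exact ⟨-m, -c, fun x hx => by linarith [H x hx]⟩
  · rintro ⟨m, c, H⟩
    exact ⟨-m, -c, fun x hx => by linarith [H x hx]⟩

lemma Grid.imageLen_neg (Γ : Grid B M a b) : Γ.imageLen (fun x => -h x) = Γ.imageLen h := by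
  funext n β
  unfold Grid.imageLen
  rw [← abs_neg]; ring_nf

lemma Grid.lrd_neg (Γ : Grid B M a b) : Γ.lrd (fun x => -h x) = Γ.lrd h := by
  funext n β
  simp only [Grid.lrd, Grid.imageLen_neg]

lemma Grid.crd_neg (Γ : Grid B M a b) : Γ.crd (fun x => -h x) = Γ.crd h := by
  funext n β
  simp only [Grid.crd, Grid.imageLen_neg]

end Neg

lemma UaaOn.mono {S T : Set ℝ} (H : UaaOn h S) (hTS : T ⊆ S) : UaaOn h T := fun d hd => by
  obtain ⟨ε, hε, H⟩ := H d hd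
  exact ⟨ε, hε, fun x δ₁ δ₂ h1 h2 m1 m2 m3 => H x δ₁ δ₂ h1 h2 (hTS m1) (hTS m2) (hTS m3)⟩

namespace OGrid

/-- The grid without its first level. -/
def shift (G : OGrid B M a b) : OGrid B M a b where
  N n := G.N (n + 1)
  X n := G.X (n + 1)
  σ n := G.σ (n + 1)
  one_le := G.one_le
  N_pos n := G.N_pos (n + 1)
  X_zero n := G.X_zero (n + 1)
  X_last n := G.X_last (n + 1)
  X_lt n := G.X_lt (n + 1)
  ratio_up n := G.ratio_up (n + 1)
  ratio_down n := G.ratio_down (n + 1)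
  σ_zero n := G.σ_zero (n + 1)
  σ_last n := G.σ_last (n + 1)
  σ_X n := G.σ_X (n + 1)
  σ_lower n := G.σ_lower (n + 1)
  σ_upper n := G.σ_upper (n + 1)

variable {G : OGrid B M a b}

/-- Level `0` may consist of a single interval, which forms no pair; after `shift` every level has
at least two intervals, so that every pair has a parent pair. The smoothness obtained does not
depend on the grid. -/
lemma c1HolderOn_of_cd (hm : StrictMonoOn h (Icc a b)) {α : ℝ} (hα : 0 < α) (hα1 : α < 1)
    (H : ∃ C, 0 ≤ C ∧ ∀ n i, i + 2 < G.N n → |G.cd h n i| ≤ C * G.p n i ^ α) :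
    C1HolderOn α h (Icc a b) ∧ DerivNeZeroOn h (Icc a b) := by
  obtain ⟨C, hC, hcd⟩ := H
  exact (c1HolderOn_iff (G := G.shift) hm hα).2
    (r_bigO_of_cd G.two_le_N hm hα hα1 hC fun n i hi => hcd (n + 1) i hi)

end OGrid

/-- The equivalences and implications between smoothness and distortions. -/
def SmoothnessTables (G : Grid B M a b) (h : ℝ → ℝ) : Prop :=
    ((QuasisymmetricOn h (Icc a b) ↔ G.LrdBigO h (fun _ => 1)) ∧
      (UaaOn h (Icc a b) ↔ G.LrdLittleODiv h) ∧
      (∀ α : ℝ, 0 < α → α < 1 →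
        ((C1HolderOn α h (Icc a b) ∧
            DerivNeZeroOn h (Icc a b)) ↔
          G.LrdBigO h (fun t => t ^ α))) ∧
      ((C1HolderOn 1 h (Icc a b) ∧
          DerivNeZeroOn h (Icc a b)) ↔
        G.LrdBigO h (fun t => t)) ∧
      ((AffineOn h (Icc a b) ∧
          DerivNeZeroOn h (Icc a b)) ↔
        G.LrdLittleO h)) ∧
    ((QuasisymmetricOn h (Icc a b) → G.CrdBigO h (fun _ => 1)) ∧
      (UaaOn h (Icc a b) → G.CrdLittleODiv h) ∧
      (∀ α : ℝ, 0 < α → α ≤ 1 →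
        C1HolderOn α h (Icc a b) →
        DerivNeZeroOn h (Icc a b) →
          G.CrdBigO h (fun t => t ^ α)) ∧
      (∀ α : ℝ, 0 < α → α < 1 →
        C2HolderOn α h (Icc a b) →
        DerivNeZeroOn h (Icc a b) →
          G.CrdBigO h (fun t => t ^ (1 + α))) ∧
      (C2HolderOn 1 h (Icc a b) →
        DerivNeZeroOn h (Icc a b) →
          G.CrdBigO h (fun t => t ^ 2))) ∧
    ((G.CrdBigO h (fun _ => 1) →
        ∀ u v : ℝ, a < u → u < v → v < b →
          QuasisymmetricOn h (Icc u v)) ∧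
      (G.CrdLittleODiv h →
        ∀ u v : ℝ, a < u → u < v → v < b →
          UaaOn h (Icc u v)) ∧
      (∀ α : ℝ, 0 < α → α < 1 → G.CrdBigO h (fun t => t ^ α) →
        (∀ u v : ℝ, a < u → u < v → v < b →
          C1HolderOn α h (Icc u v)) ∧
        DerivNeZeroOn h (Icc a b)) ∧
      (∀ α : ℝ, 0 < α → α < 1 → G.CrdBigO h (fun t => t ^ (1 + α)) →
        (∀ u v : ℝ, a < u → u < v → v < b →
          C2HolderOn α h (Icc u v)) ∧
        DerivNeZeroOn h (Icc a b)) ∧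
      (G.CrdBigO h (fun t => t ^ 2) →
        (∀ u v : ℝ, a < u → u < v → v < b →
          C2HolderOn 1 h (Icc u v)) ∧
        DerivNeZeroOn h (Icc a b)))

/-- Distortions of the grid involve only absolute values of increments of `h`, and the smoothness
conditions are unchanged by a sign. This reduces decreasing maps to increasing ones. -/
lemma smoothnessTables_neg {Γ : Grid B M a b} (H : SmoothnessTables Γ (fun x => -h x)) :
    SmoothnessTables Γ h := by
  simp only [SmoothnessTables, Grid.LrdBigO, Grid.LrdLittleODiv, Grid.LrdLittleO, Grid.CrdBigO,
    Grid.CrdLittleODiv, Grid.lrd_neg, Grid.crd_neg, quasisymmetricOn_neg, uaaOn_neg,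
    c1HolderOn_neg, c2HolderOn_neg, derivNeZeroOn_neg, affineOn_neg] at H ⊢
  exact H

lemma smoothnessTables_of_strictMonoOn (hab : a < b) (hB : 1 ≤ B) (Γ : Grid B M a b)
    (hm : StrictMonoOn h (Icc a b)) : SmoothnessTables Γ h := by
  obtain ⟨G, e, hO⟩ := Γ.exists_ogrid hab hB
  replace hO : G.Matches Γ e := hO
  -- Writing the bounds as real powers with exponents `0`, `1` and `1 + 1` lets the statements for a
  -- general exponent serve the remaining lines of the tables.
  have e0 : (fun _ => 1 : ℝ → ℝ) = fun t => t ^ (0 : ℝ) := by funext t; simp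
  have e1 : (fun t => t : ℝ → ℝ) = fun t => t ^ (1 : ℝ) := by funext t; simp
  have e2 : (fun t => t ^ 2 : ℝ → ℝ) = fun t => t ^ ((1 : ℝ) + 1) := by
    funext t; norm_num
  have hl := fun (α : ℝ) (hα : 0 ≤ α) => hO.lrdBigO_iff hm (OGrid.doubling_rpow hB hα)
  have hc := fun (α : ℝ) (hα : 0 ≤ α) => hO.crdBigO_iff hm (OGrid.doubling_rpow hB hα)
  have hq : QuasisymmetricOn h (Icc a b) ↔
      ∃ C, 0 ≤ C ∧ ∀ n i, i + 1 < G.N n → |G.r h n i| ≤ C * G.p n i ^ (0 : ℝ) := by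
    simp only [Real.rpow_zero, mul_one]
    exact OGrid.quasisymmetricOn_iff hm
  have hC1 : ∀ α : ℝ, 0 < α → ((C1HolderOn α h (Icc a b) ∧ DerivNeZeroOn h (Icc a b)) ↔
      Γ.LrdBigO h (fun t => t ^ α)) := fun α hα =>
    (OGrid.c1HolderOn_iff hm hα).trans (hl α hα.le).symm
  have hC2 : ∀ α : ℝ, 0 < α → α ≤ 1 → C2HolderOn α h (Icc a b) → DerivNeZeroOn h (Icc a b) →
      Γ.CrdBigO h (fun t => t ^ (1 + α)) := fun α hα hα1 h1 h2 =>
    (hc (1 + α) (by linarith)).2 (OGrid.cd_bigO_of_c2 hm hα hα1 h1 h2)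
  have hC2' : ∀ α : ℝ, 0 < α → α ≤ 1 → Γ.CrdBigO h (fun t => t ^ (1 + α)) →
      (∀ u v : ℝ, a < u → u < v → v < b → C2HolderOn α h (Icc u v)) ∧
        DerivNeZeroOn h (Icc a b) := fun α hα hα1 H => by
    obtain ⟨C, hC, hcd⟩ := (hc (1 + α) (by linarith)).1 H
    obtain ⟨h1, h2⟩ := OGrid.c2HolderOn_of_cd (G := G.shift) G.two_le_N hm hα hα1 hC
      fun n i hi => hcd (n + 1) i hi
    exact ⟨fun u v hu huv hv => h1.mono_Icc hu.le hv.le huv, h2⟩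
  refine ⟨⟨?_, ?_, fun α hα _ => hC1 α hα, ?_, OGrid.affine_iff hO hm⟩,
    ⟨?_, ?_, ?_, fun α hα hα1 => hC2 α hα hα1.le, ?_⟩,
    ?_, ?_, ?_, fun α hα hα1 => hC2' α hα hα1.le, ?_⟩
  · rw [e0, hl 0 le_rfl]; exact hq
  · exact (OGrid.uaaOn_iff hm).trans (hO.lrdLittleODiv_iff hm).symm
  · rw [e1]; exact hC1 1 one_pos
  · intro H
    rw [e0]
    exact (hc 0 le_rfl).2 (OGrid.cd_bigO hm le_rfl (hq.1 H))
  · intro H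
    exact (hO.crdLittleODiv_iff hm).2 (OGrid.cd_vanishes hm ((OGrid.uaaOn_iff hm).1 H))
  · intro α hα _ h1 h2
    exact (hc α hα.le).2 (OGrid.cd_bigO hm hα.le ((OGrid.c1HolderOn_iff hm hα).1 ⟨h1, h2⟩))
  · rw [e2]; exact hC2 1 one_pos le_rfl
  · intro H u v hu _ hv
    rw [e0] at H
    obtain ⟨C, hC, hcd⟩ := (hc 0 le_rfl).1 H
    exact OGrid.quasisymmetricOn_of_cd hm hC (fun n i hi => by simpa using hcd n i hi) hu hv
  · intro H u v hu _ hv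
    -- Here, as in the Hölder lines below, smoothness holds on all of `[a, b]` and is then
    -- restricted; only the quasisymmetric line uses that `[u, v]` stays away from the ends.
    exact ((OGrid.uaaOn_iff hm).2 (OGrid.r_vanishes_of_cd hm ((hO.crdLittleODiv_iff hm).1 H))).mono
      (Icc_subset_Icc hu.le hv.le)
  · intro α hα hα1 H
    obtain ⟨h1, h2⟩ := OGrid.c1HolderOn_of_cd hm hα hα1 ((hc α hα.le).1 H)
    exact ⟨fun u v hu huv hv => h1.mono_Icc hu.le hv.le huv, h2⟩
  · rw [e2]; exact hC2' 1 one_pos le_rfl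

end GridSmoothness

end

theorem theorem1p3 {a b c d : ℝ} (hab : a < b) {B : ℝ} {M : ℕ} (hB : 1 ≤ B) (hM : 1 < M)
    (G : GridSmoothness.Grid B M a b) (h : ℝ → ℝ)
    (hcont : ContinuousOn h (Set.Icc a b))
    (hbij : Set.BijOn h (Set.Icc a b) (Set.Icc c d)) :
    -- the logarithmic ratio distortion
    ((GridSmoothness.QuasisymmetricOn h (Set.Icc a b) ↔ G.LrdBigO h (fun _ => 1)) ∧
      (GridSmoothness.UaaOn h (Set.Icc a b) ↔ G.LrdLittleODiv h) ∧
      (∀ α : ℝ, 0 < α → α < 1 →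
        ((GridSmoothness.C1HolderOn α h (Set.Icc a b) ∧
            GridSmoothness.DerivNeZeroOn h (Set.Icc a b)) ↔
          G.LrdBigO h (fun t => t ^ α))) ∧
      ((GridSmoothness.C1HolderOn 1 h (Set.Icc a b) ∧
          GridSmoothness.DerivNeZeroOn h (Set.Icc a b)) ↔
        G.LrdBigO h (fun t => t)) ∧
      ((GridSmoothness.AffineOn h (Set.Icc a b) ∧
          GridSmoothness.DerivNeZeroOn h (Set.Icc a b)) ↔
        G.LrdLittleO h)) ∧
    -- from smoothness to cross ratio distortion
    ((GridSmoothness.QuasisymmetricOn h (Set.Icc a b) → G.CrdBigO h (fun _ => 1)) ∧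
      (GridSmoothness.UaaOn h (Set.Icc a b) → G.CrdLittleODiv h) ∧
      (∀ α : ℝ, 0 < α → α ≤ 1 →
        GridSmoothness.C1HolderOn α h (Set.Icc a b) →
        GridSmoothness.DerivNeZeroOn h (Set.Icc a b) →
          G.CrdBigO h (fun t => t ^ α)) ∧
      (∀ α : ℝ, 0 < α → α < 1 →
        GridSmoothness.C2HolderOn α h (Set.Icc a b) →
        GridSmoothness.DerivNeZeroOn h (Set.Icc a b) →
          G.CrdBigO h (fun t => t ^ (1 + α))) ∧
      (GridSmoothness.C2HolderOn 1 h (Set.Icc a b) →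
        GridSmoothness.DerivNeZeroOn h (Set.Icc a b) →
          G.CrdBigO h (fun t => t ^ 2))) ∧
    -- from cross ratio distortion to smoothness on every `[u, v] ⊆ (a, b)`
    ((G.CrdBigO h (fun _ => 1) →
        ∀ u v : ℝ, a < u → u < v → v < b →
          GridSmoothness.QuasisymmetricOn h (Set.Icc u v)) ∧
      (G.CrdLittleODiv h →
        ∀ u v : ℝ, a < u → u < v → v < b →
          GridSmoothness.UaaOn h (Set.Icc u v)) ∧
      (∀ α : ℝ, 0 < α → α < 1 → G.CrdBigO h (fun t => t ^ α) →
        (∀ u v : ℝ, a < u → u < v → v < b →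
          GridSmoothness.C1HolderOn α h (Set.Icc u v)) ∧
        GridSmoothness.DerivNeZeroOn h (Set.Icc a b)) ∧
      (∀ α : ℝ, 0 < α → α < 1 → G.CrdBigO h (fun t => t ^ (1 + α)) →
        (∀ u v : ℝ, a < u → u < v → v < b →
          GridSmoothness.C2HolderOn α h (Set.Icc u v)) ∧
        GridSmoothness.DerivNeZeroOn h (Set.Icc a b)) ∧
      (G.CrdBigO h (fun t => t ^ 2) →
        (∀ u v : ℝ, a < u → u < v → v < b →
          GridSmoothness.C2HolderOn 1 h (Set.Icc u v)) ∧
        GridSmoothness.DerivNeZeroOn h (Set.Icc a b))) := by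
  rcases hcont.strictMonoOn_of_injOn_Icc' hab.le hbij.injOn with hm | hm
  · exact GridSmoothness.smoothnessTables_of_strictMonoOn hab hB G hm
  · exact GridSmoothness.smoothnessTables_neg
      (GridSmoothness.smoothnessTables_of_strictMonoOn hab hB G fun x hx y hy hxy =>
        neg_lt_neg (hm hx hy hxy))
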